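/- Let $(M,J,\omega_0)$ be a compact almost Hermitian manifold of real dimension $2n$ whose universal cover is a Lie group $G$ such that, if $\pi:G\to M$ is the covering map, $\pi^*J$ and $\pi^*\omega_0$ are left invariant; here $\omega(X,Y)=g(JX,Y)$ is the fundamental form of the metric $g$. For an almost Hermitian metric $\omega$ on $(M,J)$ let $\nabla$ be its Chern (second canonical) connection, i.e. the connection with $\nabla J=0$, $\nabla g=0$ and vanishing $(1,1)$ part of the torsion, let $\Omega_i^j$ be its curvature on $T^{1,0}M$, let $\mathrm{Ric}(\omega)=\sqrt{-1}\,\Omega_i^i$ be the Chern-Ricci form and $R(\omega)=\mathrm{tr}_\omega\mathrm{Ric}(\omega)=g^{i\bar j}R_{i\bar j}$ the Chern scalar curvature. Consider the flow $$\frac{\partial\omega_t}{\partial t}=-\mathrm{Ric}(\omega_t)^{(1,1)},\qquad \omega(0)=\omega_0,$$ where $\xi^{(1,1)}(X,Y)=\frac12(\xi(X,Y)+\xi(JX,JY))$. On the Lie algebra $\mathfrak g$ of $G$ (with the induced $J$ and $\omega_0$) put $$p(X,Y)=-\tfrac14\,\mathrm{tr}\,J\,\mathrm{ad}[X,Y]+\tfrac14\,\mathrm{tr}\,\mathrm{ad}\,J[X,Y],$$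 and let the Chern-Ricci operators $P_0$ of $\omega_0$ and $P_t$ of $\omega_t$ be defined by $p^{(1,1)}=\omega_0(P_0\cdot,\cdot)=\omega_t(P_t\cdot,\cdot)$. Left invariant forms on $G$ are identified with forms on $\mathfrak g$, and forms on $M$ with their pullbacks to $G$. Then: (1) The flow has a unique maximal smooth solution $\omega_t$, $t\in[0,T)$, $0<T\le\infty$ (every smooth solution on some $[0,\tau)$ has $\tau\le T$ and agrees with it on $[0,\tau)$). It is given by $\omega_t=\omega_0-2t\,p^{(1,1)}$, and $\mathrm{Ric}(\omega_t)=2p$ for all $t\in[0,T)$. Moreover $\mathrm{Id}-2tP_0$ is invertible and $P_t=(\mathrm{Id}-2tP_0)^{-1}P_0$. (2) $P_0$ is diagonalizable in a basis orthonormal for $g_0$, with real eigenvalues $p_1,\dots,p_{2n}$. If $P_0\le 0$ then $T=\infty$; otherwise $T=1/(2p_+)$, where $p_+>0$ is the largest eigenvalue of $P_0$. (3) For $t\in[0,T)$ the Chern scalar curvature $R(\omega_t)$ is constant on $M$, $$R(\omega_t)=\sum_{\alpha=1}^{2n}\frac{p_\alpha}{1-2tp_\alpha},\qquad \frac{d}{dt}R(\omega_t)=\sum_{\alpha=1}^{2n}\frac{2p_\alpha^2}{(1-2tp_\alpha)^2}\ge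 0;$$ so $R(\omega_t)$ is nondecreasing in $t$, and strictly increasing unless $P_0=0$. If $T<\infty$, then $\int_0^TR(\omega_t)\,dt=\infty$ and there is a constant $C>0$ such that $R(\omega_t)\le C/(T-t)$ for all $t\in[0,T)$. If $T=\infty$, then $R(\omega_t)\le 0$ for all $t\ge0$. -/

import Mathlib

open scoped Manifold ContDiff
open Set Filter Topology

noncomputable section

namespace AlmostComplexFlow

/-! ### Linear algebra on one vector space -/

section LinearAlgebra

variable {V : Type*} [AddCommGroup V] [Module ℝ V]

/-- The complex trace of an endomorphism `A` of `V` commuting with `J`, where `V` is regarded as a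
complex vector space with `i` acting as `J` (for `V = T_xM` this is the trace of the action of the
complexification of `A` on `T^{1,0}`, through `u ↦ u - i J u`). In real terms it is
`(tr A - i tr (J A)) / 2`. -/
def complexTrace (J A : V →ₗ[ℝ] V) : ℂ :=
  ((LinearMap.trace ℝ V A : ℂ) - Complex.I * (LinearMap.trace ℝ V (J ∘ₗ A) : ℂ)) / 2

/-- The `(1,1)` part of a real two-form on a vector space with complex structure `J`. -/
def oneOnePart (J : V → V) (ρ : V → V → ℝ) (u v : V) : ℝ :=
  (ρ u v + ρ (J u) (J v)) / 2

/-- The trace `g^{ij} B_{ij}` of a bilinear form `B` with respect to a metric `g`, computed in some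
basis (the value does not depend on the basis when `g` is nondegenerate). -/
def metricTrace [FiniteDimensional ℝ V] (g B : V → V → ℝ) : ℝ :=
  Matrix.trace
    ((Matrix.of fun i j => g (Module.finBasis ℝ V i) (Module.finBasis ℝ V j))⁻¹ *
      Matrix.of fun i j => B (Module.finBasis ℝ V i) (Module.finBasis ℝ V j))

/-- The trace `tr_Ω ρ = g^{i j̄} ρ_{i j̄}` of a two-form `ρ` with respect to a Hermitian form `Ω`,
where `Ω = √-1 g_{i j̄} θ^i ∧ θ̄^j` and the `(1,1)` part of `ρ` is `√-1 ρ_{i j̄} θ^i ∧ θ̄^j`. In real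
terms it is half of the trace of `ρ(·, J·)` with respect to the metric `g = Ω(·, J·)`; in
particular `tr_Ω Ω` is the complex dimension. -/
def formTrace [FiniteDimensional ℝ V] (J : V → V) (Ω ρ : V → V → ℝ) : ℝ :=
  metricTrace (fun u v => Ω u (J v)) (fun u v => ρ u (J v)) / 2

end LinearAlgebra

section LieAlgebra

variable {L : Type*} [LieRing L] [LieAlgebra ℝ L]

/-- The two-form `p(X,Y) = -¼ tr (J ad [X,Y]) + ¼ tr (ad (J [X,Y]))` on a Lie algebra with an
almost complex structure `J`. -/
def invariantForm (J : L →ₗ[ℝ] L) (X Y : L) : ℝ :=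
  -(1 / 4) * LinearMap.trace ℝ L (J ∘ₗ LieAlgebra.ad ℝ L ⁅X, Y⁆)
    + (1 / 4) * LinearMap.trace ℝ L (LieAlgebra.ad ℝ L (J ⁅X, Y⁆))

/-- `P` is the Chern-Ricci operator of the Hermitian form `Ω`: `p^{(1,1)} = Ω(P·, ·)`. -/
def IsChernRicciOperator (J : L →ₗ[ℝ] L) (Ω : L → L → ℝ) (P : L →ₗ[ℝ] L) : Prop :=
  ∀ X Y, oneOnePart J (invariantForm J) X Y = Ω (P X) Y

end LieAlgebra

/-! ### Tensors, connections and curvature on a manifold -/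

section Manifold

variable {E : Type*} [NormedAddCommGroup E] [NormedSpace ℝ E]

variable (E) in
/-- Fields of endomorphisms of the tangent bundle. -/
abbrev EndField (M : Type*) [TopologicalSpace M] [ChartedSpace E M] :=
  (x : M) → TangentSpace 𝓘(ℝ, E) x →L[ℝ] TangentSpace 𝓘(ℝ, E) x

variable (E) in
/-- Fields of real bilinear forms on the tangent bundle. -/
abbrev FormField (M : Type*) [TopologicalSpace M] [ChartedSpace E M] :=
  (x : M) → TangentSpace 𝓘(ℝ, E) x →L[ℝ] TangentSpace 𝓘(ℝ, E) x →L[ℝ] ℝ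

variable {M : Type*} [TopologicalSpace M] [ChartedSpace E M]

instance finiteDimensional_tangentSpace [FiniteDimensional ℝ E] (x : M) :
    FiniteDimensional ℝ (TangentSpace 𝓘(ℝ, E) x) :=
  inferInstanceAs (FiniteDimensional ℝ E)

/-- Smooth vector fields. -/
def IsSmoothField [IsManifold 𝓘(ℝ, E) ∞ M] (X : (x : M) → TangentSpace 𝓘(ℝ, E) x) : Prop :=
  ContMDiff 𝓘(ℝ, E) (𝓘(ℝ, E).prod 𝓘(ℝ, E)) ∞
    (fun x => (Bundle.TotalSpace.mk' E x (X x) : TangentBundle 𝓘(ℝ, E) M))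

/-- An almost complex structure: a smooth field of endomorphisms with `J² = -1`. -/
structure IsAlmostComplexStructure [IsManifold 𝓘(ℝ, E) ∞ M] (J : EndField E M) : Prop where
  smooth : ContMDiff 𝓘(ℝ, E) (𝓘(ℝ, E).prod 𝓘(ℝ, E →L[ℝ] E)) ∞
    (fun x => Bundle.TotalSpace.mk' (E →L[ℝ] E)
      (E := fun y : M => TangentSpace 𝓘(ℝ, E) y →L[ℝ] TangentSpace 𝓘(ℝ, E) y) x (J x))
  sq : ∀ x u, J x (J x u) = -u

/-- An almost Hermitian metric, given by its fundamental form `Ω(u,v) = g(Ju,v)`: a smooth,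
positive real `(1,1)` form. The Riemannian metric is `g(u,v) = Ω(u,Jv)`. -/
structure IsAlmostHermitian [IsManifold 𝓘(ℝ, E) ∞ M] (J : EndField E M) (Ω : FormField E M) :
    Prop where
  smooth : ContMDiff 𝓘(ℝ, E) (𝓘(ℝ, E).prod 𝓘(ℝ, E →L[ℝ] E →L[ℝ] ℝ)) ∞
    (fun x => Bundle.TotalSpace.mk' (E →L[ℝ] E →L[ℝ] ℝ)
      (E := fun y : M => TangentSpace 𝓘(ℝ, E) y →L[ℝ] TangentSpace 𝓘(ℝ, E) y →L[ℝ] ℝ) x (Ω x))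
  alternating : ∀ x u v, Ω x u v = -Ω x v u
  invariant : ∀ x u v, Ω x (J x u) (J x v) = Ω x u v
  positive : ∀ x u, u ≠ 0 → 0 < Ω x u (J x u)

section Connection

variable [CompleteSpace E] [FiniteDimensional ℝ E] [IsManifold 𝓘(ℝ, E) ∞ M]

/-- `D` is the second canonical (Chern) connection of `(J, Ω)`: a smooth affine connection with
`DJ = 0`, `Dg = 0` and vanishing `(1,1)` part of the torsion. Recall that `D Y x v` is `D_v Y`. -/
structure IsChernConnection (J : EndField E M) (Ω : FormField E M)
    (D : CovariantDerivative 𝓘(ℝ, E) E (TangentSpace 𝓘(ℝ, E) : M → Type _)) : Prop where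
  smooth : D.ContMDiffCovariantDerivative ∞
  parallel_complex : ∀ Y : (x : M) → TangentSpace 𝓘(ℝ, E) x, IsSmoothField Y → ∀ x v,
    D (fun y => J y (Y y)) x v = J x (D Y x v)
  parallel_metric : ∀ Y Z : (x : M) → TangentSpace 𝓘(ℝ, E) x, IsSmoothField Y → IsSmoothField Z →
    ∀ x v, mvfderiv 𝓘(ℝ, E) (fun y => Ω y (Y y) (J y (Z y))) x v =
      Ω x (D Y x v) (J x (Z x)) + Ω x (Y x) (J x (D Z x v))
  torsion : ∀ x u v, D.torsion x u v + D.torsion x (J x u) (J x v) = 0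

/-- `K` is the curvature tensor of the connection `D`:
`K(X,Y)Z = D_X D_Y Z - D_Y D_X Z - D_{[X,Y]} Z`. -/
def IsCurvature (D : CovariantDerivative 𝓘(ℝ, E) E (TangentSpace 𝓘(ℝ, E) : M → Type _))
    (K : (x : M) → TangentSpace 𝓘(ℝ, E) x → TangentSpace 𝓘(ℝ, E) x →
      TangentSpace 𝓘(ℝ, E) x →ₗ[ℝ] TangentSpace 𝓘(ℝ, E) x) : Prop :=
  ∀ X Y Z : (x : M) → TangentSpace 𝓘(ℝ, E) x,
    IsSmoothField X → IsSmoothField Y → IsSmoothField Z → ∀ x,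
      K x (X x) (Y x) (Z x) =
        D (fun y => D Z y (Y y)) x (X x) - D (fun y => D Z y (X y)) x (Y x)
          - D Z x (VectorField.mlieBracket 𝓘(ℝ, E) X Y x)

/-- `ρ` is the Chern-Ricci form of `(J, Ω)`: `ρ(u,v) = √-1 tr_ℂ K(u,v)`, the complex trace of the
curvature of the Chern connection multiplied by `√-1`. -/
def IsChernRicciForm (J : EndField E M) (Ω ρ : FormField E M) : Prop :=
  ∃ D, IsChernConnection J Ω D ∧ ∃ K, IsCurvature D K ∧
    ∀ x u v, (ρ x u v : ℂ) = Complex.I * complexTrace (J x : _ →ₗ[ℝ] _) (K x u v)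

/-- `s` is the Chern scalar curvature `tr_Ω Ric(Ω)` of `(J, Ω)`. -/
def IsChernScalarCurvature (J : EndField E M) (Ω : FormField E M) (s : M → ℝ) : Prop :=
  ∃ ρ, IsChernRicciForm J Ω ρ ∧
    ∀ x, s x = formTrace (J x) (fun u v => Ω x u v) (fun u v => ρ x u v)

/-! ### The flow -/

/-- The times `0 ≤ t < T`, where `T` may be infinite. -/
def timeInterval (T : EReal) : Set ℝ := {t | 0 ≤ t ∧ (t : EReal) < T}

/-- `Ω_t`, `0 ≤ t < T`, is a smooth solution of `∂Ω_t/∂t = -Ric(Ω_t)^{(1,1)}`, `Ω(0) = Ω₀`, through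
almost Hermitian metrics. -/
structure IsFlowSolution (J : EndField E M) (Ω₀ : FormField E M) (T : EReal)
    (Ω : ℝ → FormField E M) : Prop where
  smooth : ContMDiffOn (𝓘(ℝ, ℝ).prod 𝓘(ℝ, E)) (𝓘(ℝ, E).prod 𝓘(ℝ, E →L[ℝ] E →L[ℝ] ℝ)) ∞
    (fun q : ℝ × M => Bundle.TotalSpace.mk' (E →L[ℝ] E →L[ℝ] ℝ)
      (E := fun y : M => TangentSpace 𝓘(ℝ, E) y →L[ℝ] TangentSpace 𝓘(ℝ, E) y →L[ℝ] ℝ)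
      q.2 (Ω q.1 q.2)) (timeInterval T ×ˢ univ)
  hermitian : ∀ t ∈ timeInterval T, IsAlmostHermitian J (Ω t)
  initial : Ω 0 = Ω₀
  evolution : ∀ t ∈ timeInterval T, ∃ ρ, IsChernRicciForm J (Ω t) ρ ∧ ∀ x u v,
    HasDerivWithinAt (fun s => Ω s x u v)
      (-oneOnePart (J x) (fun u v => ρ x u v) u v) (timeInterval T) t

/-- `Ω_t` is the unique maximal solution of the flow and `T` is its maximal existence time: it is a
solution on `[0,T)`, and every solution on an interval `[0,τ)` has `τ ≤ T` and is a restriction of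
it. -/
structure IsMaximalFlowSolution (J : EndField E M) (Ω₀ : FormField E M) (T : EReal)
    (Ω : ℝ → FormField E M) : Prop where
  pos : 0 < T
  solution : IsFlowSolution J Ω₀ T Ω
  maximal : ∀ τ Ω', IsFlowSolution J Ω₀ τ Ω' → τ ≤ T ∧ ∀ t ∈ timeInterval τ, Ω' t = Ω t

end Connection

end Manifold

/-! ### Pullbacks to a Lie group and left invariance -/

section LieGroup

variable {E : Type*} [NormedAddCommGroup E] [NormedSpace ℝ E]
  {M : Type*} [TopologicalSpace M] [ChartedSpace E M]
  {G : Type*} [TopologicalSpace G] [ChartedSpace E G]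

/-- The pullback `π^*Ω` of a bilinear form. -/
def pullbackForm (π : G → M) (Ω : FormField E M) (y : G)
    (u v : TangentSpace 𝓘(ℝ, E) y) : ℝ :=
  Ω (π y) (mfderiv 𝓘(ℝ, E) 𝓘(ℝ, E) π y u) (mfderiv 𝓘(ℝ, E) 𝓘(ℝ, E) π y v)

/-- The pullback `π^*J = (dπ)⁻¹ ∘ J ∘ dπ` of an endomorphism field by a local diffeomorphism. -/
def pullbackEnd (π : G → M) (J : EndField E M) : EndField E G := fun y =>
  (mfderiv 𝓘(ℝ, E) 𝓘(ℝ, E) π y).inverse ∘L J (π y) ∘L mfderiv 𝓘(ℝ, E) 𝓘(ℝ, E) π y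

variable [Group G]

/-- Left invariance of a field of bilinear forms on `G`. -/
def IsLeftInvariantForm (B : (y : G) → TangentSpace 𝓘(ℝ, E) y → TangentSpace 𝓘(ℝ, E) y → ℝ) :
    Prop :=
  ∀ (h y : G) (u v : TangentSpace 𝓘(ℝ, E) y),
    B (h * y) (mfderiv 𝓘(ℝ, E) 𝓘(ℝ, E) (h * ·) y u) (mfderiv 𝓘(ℝ, E) 𝓘(ℝ, E) (h * ·) y v) = B y u v

/-- Left invariance of a field of endomorphisms on `G`. -/
def IsLeftInvariantEnd (A : EndField E G) : Prop :=
  ∀ (h y : G) (u : TangentSpace 𝓘(ℝ, E) y),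
    A (h * y) (mfderiv 𝓘(ℝ, E) 𝓘(ℝ, E) (h * ·) y u) =
      mfderiv 𝓘(ℝ, E) 𝓘(ℝ, E) (h * ·) y (A y u)

instance lieGroup_minSmoothness [LieGroup 𝓘(ℝ, E) ∞ G] :
    LieGroup 𝓘(ℝ, E) (minSmoothness ℝ 3) G :=
  LieGroup.of_le (n := ∞) (by simpa using ENat.LEInfty.out)

end LieGroup

end AlmostComplexFlow

end

/-! The left invariant fields of `G` project locally to frames of `M` in which the bracket, `J` and
`Ω₀` have constant coefficients (`exists_localFrame`, `exists_frameAtlas`). Read a Chern connection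
in such a frame as a connection form `A`. Its `J`-linearity and the torsion condition determine
`A(u) + j A(ju)` from the bracket and `j` alone (`add_comp_eq_chernAnti`), while metric
compatibility gives `tr A = ½ dH`, where `H` is the logarithm of the volume density (`trace_coeff`).
As `A` commutes with `j`, the quadratic part of the curvature drops out of `tr (j K)`. So the
Chern-Ricci form is a fixed algebraic term, equal to `2p`, plus a differential expression of order
two in `H` that vanishes for constant `H` (`ricciForm_apply`, `two_mul_invariantForm`).

Hence every invariant metric has Chern-Ricci form `2p`. On invariant metrics the flow is an ODE with
constant right-hand side, solved by the affine family `Ω₀ - 2t p^{(1,1)}`. In a basis diagonalizing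
`P₀` the metric becomes `diag (1 - 2t p_α)`, which is positive exactly up to `maxTime`. The
Chern-Ricci operator becomes `diag (p_α / (1 - 2t p_α))`, and its trace is the scalar curvature; the
assertions on `R` are then calculus in one variable.

Uniqueness must hold among all smooth solutions, invariant or not. Let `K_s` be the logarithm of the
ratio of the volume forms of a given solution and of the affine one, and `Φ_t = ∫₀ᵗ K_s ds`.
Integrating the flow in time expresses the difference of the two metrics on a pair `(u, ju)` by
second derivatives of `Φ_t` along `u` and `ju` and one first derivative (`formIn_sub_eq_integral`).
At a spatial maximum of `Φ_t` the solution is therefore dominated by the affine metric, so its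
volume is at most that of the affine one and `∂_t Φ = K_t ≤ 0` there. The maximum principle on the
compact `M` gives `Φ ≤ 0` (`integral_nonpos_of_isMax`), and the argument at minima gives `Φ ≥ 0`.
Then `Φ = 0`, every point is both a maximum and a minimum, and the metrics agree
(`isConst_of_isFlowSolution`). A solution living past `maxTime` would by continuity make the
degenerate limit form positive, which is absurd. -/

set_option linter.unusedSectionVars false

noncomputable section

namespace AlmostComplexFlow

/-! ### Linear algebra of Hermitian forms and of the Chern connection -/

section HermitianAlgebra

variable {V : Type*} [AddCommGroup V] [Module ℝ V]

/-- Simultaneous diagonalization of a symmetric form with respect to a positive definite one. -/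
theorem exists_orthonormal_diagonal_basis [FiniteDimensional ℝ V] {m : ℕ}
    (hm : Module.finrank ℝ V = m) (g B : V →ₗ[ℝ] V →ₗ[ℝ] ℝ) (gsymm : ∀ u v, g u v = g v u)
    (gpos : ∀ u, u ≠ 0 → 0 < g u u) (Bsymm : ∀ u v, B u v = B v u) :
    ∃ (e : Module.Basis (Fin m) ℝ V) (p : Fin m → ℝ),
      (∀ i j, g (e i) (e j) = if i = j then 1 else 0) ∧
      (∀ i j, B (e i) (e j) = if i = j then p i else 0) := by
  -- With `g` as inner product, `B` is represented by a symmetric operator, to which the spectral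
  -- theorem applies.
  let core : InnerProductSpace.Core ℝ V :=
    { inner := fun u v => g u v
      conj_inner_symm := fun u v => by simp [gsymm u v]
      re_inner_nonneg := fun u => by
        by_cases h : u = 0
        · simp [h]
        · simpa using (gpos u h).le
      add_left := fun u v w => by simp
      smul_left := fun u v r => by simp
      definite := fun u h => by
        by_contra hu
        exact (gpos u hu).ne' h }
  let _ : NormedAddCommGroup V := core.toNormedAddCommGroup
  let _ : InnerProductSpace ℝ V := InnerProductSpace.ofCore core.toCore
  have hin : ∀ u v : V, inner ℝ u v = g u v := fun u v => rfl
  have hdual : ∀ u, ∃ w, ∀ v, g w v = B u v := fun u =>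
    ⟨(InnerProductSpace.toDual ℝ V).symm (B u).toContinuousLinearMap, fun v => by
      rw [← hin, InnerProductSpace.toDual_symm_apply]; rfl⟩
  have hinj : ∀ w w' : V, (∀ v, g w v = g w' v) → w = w' := fun w w' h => by
    by_contra hne
    have := gpos (w - w') (sub_ne_zero.2 hne)
    simp [h] at this
  choose S hS using hdual
  let T : V →ₗ[ℝ] V :=
    { toFun := S
      map_add' := fun u v => hinj _ _ fun w => by simp [hS]
      map_smul' := fun a u => hinj _ _ fun w => by simp [hS] }
  have hT : T.IsSymmetric := fun u v => by
    change g (S u) v = g u (S v)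
    rw [hS, gsymm u, hS, Bsymm]
  let e := hT.eigenvectorBasis hm
  refine ⟨e.toBasis, hT.eigenvalues hm, fun i j => ?_, fun i j => ?_⟩
  · have := (orthonormal_iff_ite.1 e.orthonormal) i j
    simpa [hin] using this
  · have h1 := (orthonormal_iff_ite.1 e.orthonormal) i j
    rw [hin] at h1
    have h2 : S (e i) = hT.eigenvalues hm i • e i := hT.apply_eigenvectorBasis hm i
    simp only [OrthonormalBasis.coe_toBasis]
    rw [← hS, h2]
    simp [h1]

theorem repr_eq_of_orthonormal {ι : Type*} [Fintype ι] [DecidableEq ι] (g : V →ₗ[ℝ] V →ₗ[ℝ] ℝ)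
    (e : Module.Basis ι ℝ V) (he : ∀ i j, g (e i) (e j) = if i = j then 1 else 0) (v : V) (i : ι) :
    e.repr v i = g v (e i) := by
  have h : g v (e i) = g (∑ k, e.repr v k • e k) (e i) := by rw [e.sum_repr]
  rw [h]
  simp only [map_sum, map_smul, LinearMap.sum_apply, LinearMap.smul_apply, he]
  simp

/-- A linear complex structure `j` together with a positive Hermitian form `Ω`. -/
structure IsHermitianForm (j : V →ₗ[ℝ] V) (Ω : V →ₗ[ℝ] V →ₗ[ℝ] ℝ) : Prop where
  sq : ∀ u, j (j u) = -u
  alternating : ∀ u v, Ω u v = -Ω v u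
  invariant : ∀ u v, Ω (j u) (j v) = Ω u v
  positive : ∀ u, u ≠ 0 → 0 < Ω u (j u)

namespace IsHermitianForm

variable {j : V →ₗ[ℝ] V} {Ω : V →ₗ[ℝ] V →ₗ[ℝ] ℝ}

/-- The bilinear form `Ω(·, j·)`. -/
def _root_.AlmostComplexFlow.metricOf (j : V →ₗ[ℝ] V) (Ω : V →ₗ[ℝ] V →ₗ[ℝ] ℝ) :
    V →ₗ[ℝ] V →ₗ[ℝ] ℝ := Ω.compl₂ j

@[simp] theorem _root_.AlmostComplexFlow.metricOf_apply (u v : V) :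
    metricOf j Ω u v = Ω u (j v) := rfl

theorem metric_symm (h : IsHermitianForm j Ω) (u v : V) : metricOf j Ω u v = metricOf j Ω v u := by
  simp only [metricOf_apply]
  rw [← h.invariant, h.sq, map_neg, h.alternating v]

theorem metric_inj (h : IsHermitianForm j Ω) {w w' : V} (hw : ∀ v, Ω w (j v) = Ω w' (j v)) : w = w' := by
  by_contra hne
  have := h.positive (w - w') (sub_ne_zero.2 hne)
  simp [hw] at this

theorem apply_left (h : IsHermitianForm j Ω) (u v : V) : Ω (j u) v = -Ω u (j v) := by
  rw [← h.invariant u, h.sq, map_neg, neg_neg]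

theorem form_inj (h : IsHermitianForm j Ω) {w w' : V} (hw : ∀ v, Ω w v = Ω w' v) : w = w' :=
  h.metric_inj fun v => hw (j v)

end IsHermitianForm

/-- An endomorphism that is skew for a positive definite symmetric form is traceless. -/
theorem trace_eq_zero_of_skew [FiniteDimensional ℝ V] (g : V →ₗ[ℝ] V →ₗ[ℝ] ℝ)
    (gsymm : ∀ u v, g u v = g v u) (gpos : ∀ u, u ≠ 0 → 0 < g u u) (A : V →ₗ[ℝ] V)
    (hA : ∀ u v, g (A u) v = -g u (A v)) : LinearMap.trace ℝ V A = 0 := by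
  obtain ⟨e, -, he, -⟩ := exists_orthonormal_diagonal_basis rfl g g gsymm gpos gsymm
  have hrepr := repr_eq_of_orthonormal g e he
  rw [LinearMap.trace_eq_matrix_trace ℝ e, Matrix.trace]
  refine Finset.sum_eq_zero fun i _ => ?_
  rw [Matrix.diag_apply, LinearMap.toMatrix_apply, hrepr]
  have := hA (e i) (e i)
  rw [gsymm (e i)] at this
  linarith

/-- The operator `b(u)v = ½([u,v] + [ju,jv] - j[u,jv] + j[ju,v])`, equal to `A(u) + j A(ju)` for
the connection form `A` of any Chern connection in an invariant frame. -/
def chernAnti (c : V →ₗ[ℝ] V →ₗ[ℝ] V) (j : V →ₗ[ℝ] V) : V →ₗ[ℝ] V →ₗ[ℝ] V :=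
  (1 / 2 : ℝ) • LinearMap.mk₂ ℝ
    (fun u v => c u v + c (j u) (j v) - j (c u (j v)) + j (c (j u) v))
    (fun u u' v => by simp only [map_add, LinearMap.add_apply]; abel)
    (fun a u v => by simp only [map_smul, LinearMap.smul_apply]; module)
    (fun u v v' => by simp only [map_add]; abel)
    (fun a u v => by simp only [map_smul]; module)

theorem chernAnti_apply (c : V →ₗ[ℝ] V →ₗ[ℝ] V) (j : V →ₗ[ℝ] V) (u v : V) :
    chernAnti c j u v =
      (1 / 2 : ℝ) • (c u v + c (j u) (j v) - j (c u (j v)) + j (c (j u) v)) := rfl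

/-- Cyclicity of the trace and `j² = -1` merge the four terms into two. For `u` a bracket these are,
up to a factor, the two traces in the definition of `p`. -/
theorem trace_chernAnti [FiniteDimensional ℝ V] (c : V →ₗ[ℝ] V →ₗ[ℝ] V) {j : V →ₗ[ℝ] V}
    (hj : ∀ u, j (j u) = -u) (u : V) :
    LinearMap.trace ℝ V (chernAnti c j (j u)) =
      LinearMap.trace ℝ V (c (j u)) - LinearMap.trace ℝ V (j ∘ₗ c u) := by
  have h : chernAnti c j (j u) =
      (1 / 2 : ℝ) • (c (j u) - c u ∘ₗ j - (j ∘ₗ c (j u)) ∘ₗ j - j ∘ₗ c u) := by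
    ext v
    simp [chernAnti_apply, hj]
    module
  have hjj : j ∘ₗ j = -LinearMap.id := LinearMap.ext fun v => hj v
  have h1 : LinearMap.trace ℝ V (c u ∘ₗ j) = LinearMap.trace ℝ V (j ∘ₗ c u) :=
    LinearMap.trace_comp_comm' _ _
  have h2 : LinearMap.trace ℝ V ((j ∘ₗ c (j u)) ∘ₗ j) = -LinearMap.trace ℝ V (c (j u)) := by
    rw [LinearMap.trace_comp_comm', ← LinearMap.comp_assoc, hjj, LinearMap.neg_comp,
      LinearMap.id_comp, map_neg]
  rw [h, map_smul, map_sub, map_sub, map_sub, h1, h2]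
  simp only [smul_eq_mul]
  ring

/-- The `j`-linearity and torsion equations determine the `(0,1)` part of the connection form. -/
theorem add_comp_eq_chernAnti {c : V →ₗ[ℝ] V →ₗ[ℝ] V} {j : V →ₗ[ℝ] V} (hj : ∀ u, j (j u) = -u)
    {A : V → V →ₗ[ℝ] V} (hadd : ∀ u, A (-u) = -A u) (hAj : ∀ u v, A u (j v) = j (A u v))
    (ht : ∀ u v, A u v - A v u - c u v + (A (j u) (j v) - A (j v) (j u) - c (j u) (j v)) = 0)
    (u v : V) : A u v + j (A (j u) v) = chernAnti c j u v := by
  have h1 := ht u v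
  have h2 := congrArg j (ht u (j v))
  -- The torsion equation at `(u, v)` and `j` times the one at `(u, jv)` contain the unwanted terms
  -- `A(v)u` and `j A(jv)u` in the same combination; the difference eliminates them.
  simp only [hj, hAj, map_add, map_sub, map_neg, LinearMap.neg_apply, hadd, map_zero] at h1 h2
  rw [chernAnti_apply]
  have h3 : c u v + c (j u) (j v) - j (c u (j v)) + j (c (j u) v)
      = (2 : ℝ) • (A u v + j (A (j u) v)) := by
    have e1 : c u v + c (j u) (j v) = A u v - A v u + j (A (j u) v) - j (A (j v) u) := by
      rw [← sub_eq_zero, ← neg_eq_zero, ← h1]; abel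
    have e2 : j (c u (j v)) - j (c (j u) v)
        = -A u v - A v u - j (A (j u) v) - j (A (j v) u) := by
      rw [← sub_eq_zero, ← neg_eq_zero, ← h2]; abel
    have : c u v + c (j u) (j v) - j (c u (j v)) + j (c (j u) v)
      = (c u v + c (j u) (j v)) - (j (c u (j v)) - j (c (j u) v)) := by abel
    rw [this, e1, e2, two_smul]; abel
  rw [h3, smul_smul]; norm_num

/-- The trace of `j A(v)` in terms of `tr A` for the connection form of a Chern connection. -/
theorem trace_comp_eq_of_chern [FiniteDimensional ℝ V] {c : V →ₗ[ℝ] V →ₗ[ℝ] V} {j : V →ₗ[ℝ] V}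
    (hj : ∀ u, j (j u) = -u)
    {A : V → V →ₗ[ℝ] V} (hadd : ∀ u, A (-u) = -A u) (hAj : ∀ u v, A u (j v) = j (A u v))
    (ht : ∀ u v, A u v - A v u - c u v + (A (j u) (j v) - A (j v) (j u) - c (j u) (j v)) = 0)
    (v : V) : LinearMap.trace ℝ V (j ∘ₗ A v) =
      LinearMap.trace ℝ V (A (j v)) - LinearMap.trace ℝ V (chernAnti c j (j v)) := by
  have h : chernAnti c j (j v) = A (j v) - j ∘ₗ A v := LinearMap.ext fun w => by
    rw [← add_comp_eq_chernAnti hj hadd hAj ht]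
    simp [hj, hadd, sub_eq_add_neg]
  rw [h, map_sub]; ring

/-- The connection form of the Chern connection of an invariant Hermitian structure. -/
theorem exists_chern_form [FiniteDimensional ℝ V] {c : V →ₗ[ℝ] V →ₗ[ℝ] V}
    (hc : ∀ u v, c u v = -c v u) {j : V →ₗ[ℝ] V} {Ω : V →ₗ[ℝ] V →ₗ[ℝ] ℝ}
    (h : IsHermitianForm j Ω) :
    ∃ A : V →ₗ[ℝ] V →ₗ[ℝ] V, (∀ u v, A u (j v) = j (A u v)) ∧
      (∀ u v w, Ω (A u v) (j w) = -Ω v (j (A u w))) ∧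
      (∀ u v, A u v - A v u - c u v + (A (j u) (j v) - A (j v) (j u) - c (j u) (j v)) = 0) := by
  obtain ⟨e, -, he, -⟩ := exists_orthonormal_diagonal_basis rfl (metricOf j Ω) (metricOf j Ω)
    h.metric_symm (fun u hu => h.positive u hu) h.metric_symm
  have hsum : ∀ v, ∑ i, Ω v (j (e i)) • e i = v := fun v => by
    conv_rhs => rw [← e.sum_repr v]
    refine Finset.sum_congr rfl fun i _ => ?_
    rw [repr_eq_of_orthonormal _ e he, metricOf_apply]
  set b := chernAnti c j with hb
  have hsymm : ∀ u v, Ω u (j v) = Ω v (j u) := fun u v => h.metric_symm u v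
  have hΩj := h.apply_left
  let bs : V →ₗ[ℝ] V →ₗ[ℝ] V := LinearMap.mk₂ ℝ (fun u v => ∑ i, Ω v (j (b u (e i))) • e i)
    (fun u u' v => by simp [add_smul, Finset.sum_add_distrib])
    (fun a u v => by simp [mul_smul, Finset.smul_sum])
    (fun u v v' => by simp [add_smul, Finset.sum_add_distrib])
    (fun a u v => by simp [mul_smul, Finset.smul_sum])
  have hbs : ∀ u v w, Ω (bs u v) (j w) = Ω v (j (b u w)) := fun u v w => by
    simp only [bs, LinearMap.mk₂_apply, map_sum, map_smul, LinearMap.sum_apply,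
      LinearMap.smul_apply]
    conv_rhs => rw [← hsum w]
    simp only [map_sum, map_smul]
    refine Finset.sum_congr rfl fun i _ => ?_
    rw [hsymm (e i) w]; simp [mul_comm]
  have hbj : ∀ u v, b u (j v) = j (b u v) := fun u v => by
    simp only [hb, chernAnti_apply, h.sq, map_smul, map_add, map_sub, map_neg]
    module
  have hbju : ∀ u v, b (j u) v = -j (b u v) := fun u v => by
    simp only [hb, chernAnti_apply, h.sq, map_smul, map_add, map_sub, map_neg, LinearMap.neg_apply]
    module
  have hbsj : ∀ u v, bs u (j v) = j (bs u v) := fun u v => h.metric_inj fun w => by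
    rw [hbs, hΩj, hΩj, ← hbj, hbs]
  have hbsju : ∀ u v, bs (j u) v = j (bs u v) := fun u v => h.metric_inj fun w => by
    rw [hbs, hΩj, hbju, hbs, hbj]
    simp [h.sq]
  -- `bs u` is the adjoint of `b u`, so half the difference is skew. Since `b(ju) = -j b(u)` and
  -- `bs(ju) = j bs(u)`, the adjoint part cancels in `A(u) + j A(ju)`, which is therefore `b(u)` as
  -- it has to be.
  refine ⟨(1 / 2 : ℝ) • (b - bs), fun u v => ?_, fun u v w => ?_, fun u v => ?_⟩
  · simp [hbj, hbsj]
  · have h1 := hbs u v w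
    have h2 := hbs u w v
    rw [hsymm (bs u w), hsymm w] at h2
    simp only [LinearMap.smul_apply, LinearMap.sub_apply, map_smul, map_sub, h1, h2]
    simp only [smul_eq_mul]
    ring
  · simp only [LinearMap.smul_apply, LinearMap.sub_apply, hbj, hbju, hbsj, hbsju, map_neg, h.sq]
    have h1 : b u v - b v u = c u v + c (j u) (j v) := by
      simp only [hb, chernAnti_apply]
      rw [hc v u, hc (j v) (j u), hc v (j u), hc (j v) u]
      simp only [map_neg]
      module
    have h2 : c u v + c (j u) (j v) - (b u v - b v u) = 0 := by rw [h1, sub_self]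
    rw [← neg_eq_zero, ← h2]
    module

/-- The algebraic uniqueness of the Chern connection. -/
theorem eq_zero_of_chern_difference {j : V →ₗ[ℝ] V} {Ω : V →ₗ[ℝ] V →ₗ[ℝ] ℝ}
    (h : IsHermitianForm j Ω) {A : V →ₗ[ℝ] V →ₗ[ℝ] V} (hAj : ∀ u v, A u (j v) = j (A u v))
    (hg : ∀ u v w, Ω (A u v) (j w) + Ω v (j (A u w)) = 0)
    (ht : ∀ u v, A u v - A v u + (A (j u) (j v) - A (j v) (j u)) = 0) (u v : V) :
    A u v = 0 := by
  have hΩj := h.apply_left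
  have h1 : ∀ u v, A u v + j (A (j u) v) = 0 := fun u v => by
    rw [add_comp_eq_chernAnti (c := 0) h.sq (fun u => map_neg A u) hAj (by simpa using ht)]
    simp [chernAnti_apply]
  have h2 : ∀ u v, A (j u) v = j (A u v) := fun u v => by
    have := h1 (j u) v
    rw [h.sq, map_neg, LinearMap.neg_apply, map_neg] at this
    exact eq_of_sub_eq_zero (by rw [← this]; abel)
  -- `A(u)` and `A(ju) = j A(u)` are both skew, but a skew map commuting with the skew map `j` has
  -- symmetric product with it. So `j A(u)` is symmetric and skew, hence zero.
  refine h.metric_inj fun w => ?_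
  have h3 := hg (j u) (j v) w
  have h4 := hg u v w
  rw [h2, h2, hAj, h.sq, map_neg, LinearMap.neg_apply, h.sq, map_neg, hΩj] at h3
  simp only [map_zero, LinearMap.zero_apply]
  linarith

/-- The Gram matrix of the metric `Ω(·, j·)` in the basis `b`. -/
def gramMatrix {ι : Type*} (j : V →ₗ[ℝ] V) (Ω : V →ₗ[ℝ] V →ₗ[ℝ] ℝ) (b : ι → V) : Matrix ι ι ℝ :=
  Matrix.of fun i k => Ω (b i) (j (b k))

section Gram

variable {ι : Type*} [Fintype ι] [DecidableEq ι] {j : V →ₗ[ℝ] V} {Ω Ω' : V →ₗ[ℝ] V →ₗ[ℝ] ℝ}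

theorem gramMatrix_change (b b' : Module.Basis ι ℝ V) :
    gramMatrix j Ω b' = (b.toMatrix b').transpose * gramMatrix j Ω b * b.toMatrix b' := by
  ext i k
  simp only [gramMatrix, Matrix.of_apply, Matrix.mul_apply, Matrix.transpose_apply,
    Module.Basis.toMatrix_apply]
  conv_lhs => rw [← b.sum_repr (b' i), ← b.sum_repr (b' k)]
  simp only [map_sum, map_smul, LinearMap.sum_apply, LinearMap.smul_apply, smul_eq_mul,
    Finset.sum_mul, Finset.mul_sum]
  refine Finset.sum_congr rfl fun x _ => Finset.sum_congr rfl fun y _ => ?_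
  ring

theorem det_gramMatrix_change (b b' : Module.Basis ι ℝ V) :
    (gramMatrix j Ω b').det = (b.toMatrix b').det ^ 2 * (gramMatrix j Ω b).det := by
  rw [gramMatrix_change b b', Matrix.det_mul, Matrix.det_mul, Matrix.det_transpose]
  ring

theorem det_toMatrix_ne_zero (b b' : Module.Basis ι ℝ V) : (b.toMatrix b').det ≠ 0 := fun h0 => by
  have := congrArg Matrix.det (b.toMatrix_mul_toMatrix_flip b')
  rw [Matrix.det_mul, h0, Matrix.det_one, zero_mul] at this
  exact zero_ne_one this

/-- The logarithm of the ratio of the volume densities of two Hermitian forms. -/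
theorem log_det_gramMatrix_sub_change (h : ∀ b : Module.Basis ι ℝ V, 0 < (gramMatrix j Ω b).det)
    (h' : ∀ b : Module.Basis ι ℝ V, 0 < (gramMatrix j Ω' b).det) (b b' : Module.Basis ι ℝ V) :
    Real.log (gramMatrix j Ω' b').det - Real.log (gramMatrix j Ω b').det =
      Real.log (gramMatrix j Ω' b).det - Real.log (gramMatrix j Ω b).det := by
  have hd := det_toMatrix_ne_zero b b'
  rw [det_gramMatrix_change b b', det_gramMatrix_change b b', Real.log_mul (pow_ne_zero 2 hd)
    (h' b).ne', Real.log_mul (pow_ne_zero 2 hd) (h b).ne']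
  ring

theorem IsHermitianForm.exists_simultaneous (h : IsHermitianForm j Ω) (h' : IsHermitianForm j Ω')
    (b : Module.Basis ι ℝ V) : ∃ (b' : Module.Basis ι ℝ V) (q : ι → ℝ),
      gramMatrix j Ω b' = 1 ∧ gramMatrix j Ω' b' = Matrix.diagonal q := by
  have : FiniteDimensional ℝ V := b.finiteDimensional_of_finite
  obtain ⟨e, q, he, hq⟩ := exists_orthonormal_diagonal_basis rfl (metricOf j Ω) (metricOf j Ω')
    h.metric_symm h.positive h'.metric_symm
  let σ : Fin (Module.finrank ℝ V) ≃ ι := e.indexEquiv b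
  refine ⟨e.reindex σ, q ∘ σ.symm, ?_, ?_⟩
  · ext i k
    have := he (σ.symm i) (σ.symm k)
    simp only [metricOf_apply] at this
    simp [gramMatrix, this, Matrix.one_apply]
  · ext i k
    have := hq (σ.symm i) (σ.symm k)
    simp only [metricOf_apply] at this
    simp [gramMatrix, this, Matrix.diagonal_apply]

theorem IsHermitianForm.det_gramMatrix_pos (h : IsHermitianForm j Ω) (b : Module.Basis ι ℝ V) :
    0 < (gramMatrix j Ω b).det := by
  obtain ⟨b', q, h1, -⟩ := h.exists_simultaneous h b
  rw [det_gramMatrix_change b' b, h1, Matrix.det_one, mul_one]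
  exact even_two.pow_pos (det_toMatrix_ne_zero b' b)

/-- In a basis orthonormal for `Ω` and diagonal for `Ω'`, the diagonal entries of `Ω'` lie in `(0,
1]`. This turns the comparison of metrics at an extremum into a sign of the relative volume. -/
theorem IsHermitianForm.log_det_gramMatrix_le (h : IsHermitianForm j Ω)
    (h' : IsHermitianForm j Ω') (hle : ∀ u, Ω' u (j u) ≤ Ω u (j u)) (b : Module.Basis ι ℝ V) :
    Real.log (gramMatrix j Ω' b).det ≤ Real.log (gramMatrix j Ω b).det := by
  obtain ⟨b', q, h1, h2⟩ := h.exists_simultaneous h' b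
  rw [← sub_nonpos, log_det_gramMatrix_sub_change h.det_gramMatrix_pos h'.det_gramMatrix_pos b' b,
    h1, h2, Matrix.det_one, Real.log_one, sub_zero, Matrix.det_diagonal]
  have hq : ∀ i, 0 < q i ∧ q i ≤ 1 := fun i => by
    have e1 : Ω (b' i) (j (b' i)) = 1 := by
      simpa [gramMatrix] using congrFun (congrFun h1 i) i
    have e2 : Ω' (b' i) (j (b' i)) = q i := by
      simpa [gramMatrix] using congrFun (congrFun h2 i) i
    rw [← e2, ← e1]
    exact ⟨h'.positive _ (b'.ne_zero i), hle _⟩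
  exact Real.log_nonpos (Finset.prod_nonneg fun i _ => (hq i).1.le)
    (Finset.prod_le_one (fun i _ => (hq i).1.le) fun i _ => (hq i).2)

end Gram

/-- The metric trace of `g(S·,·)` is the trace of `S`. -/
theorem metricTrace_eq_trace [FiniteDimensional ℝ V] (g : V →ₗ[ℝ] V →ₗ[ℝ] ℝ) (gpos : ∀ u, u ≠ 0 → 0 < g u u) (S : V →ₗ[ℝ] V) :
    metricTrace (fun u v => g u v) (fun u v => g (S u) v) = LinearMap.trace ℝ V S := by
  set b := Module.finBasis ℝ V
  set G : Matrix _ _ ℝ := Matrix.of fun i k => g (b i) (b k) with hG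
  have hB : (Matrix.of fun i k => g (S (b i)) (b k)) = (LinearMap.toMatrix b b S).transpose * G := by
    ext i k
    simp only [hG, Matrix.of_apply, Matrix.mul_apply, Matrix.transpose_apply,
      LinearMap.toMatrix_apply]
    have h : g (S (b i)) (b k) = g (∑ l, b.repr (S (b i)) l • b l) (b k) := by rw [b.sum_repr]
    rw [h]
    simp only [map_sum, map_smul, LinearMap.sum_apply, LinearMap.smul_apply, smul_eq_mul]
  have hdet : IsUnit G.det := by
    rw [isUnit_iff_ne_zero]
    intro h0
    obtain ⟨v, hv, hGv⟩ := Matrix.exists_mulVec_eq_zero_iff.2 h0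
    have hne : ∑ i, v i • b i ≠ 0 := fun h => hv (funext fun i => by
      simpa using Fintype.linearIndependent_iff.1 b.linearIndependent v h i)
    have := gpos _ hne
    have h1 : ∀ i, g (b i) (∑ k, v k • b k) = 0 := fun i => by
      have := congrFun hGv i
      simpa [Matrix.mulVec, dotProduct, hG, mul_comm] using this
    have h2 : ∀ w, (∀ i, g (b i) w = 0) → g (∑ i, v i • b i) w = 0 := fun w hw => by
      simp only [map_sum, map_smul, LinearMap.sum_apply, LinearMap.smul_apply, hw]
      simp
    exact this.ne' (h2 _ h1)
  rw [metricTrace]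
  change Matrix.trace (G⁻¹ * _) = _
  rw [hB, Matrix.trace_mul_comm, Matrix.mul_assoc, Matrix.mul_nonsing_inv _ hdet, Matrix.mul_one,
    Matrix.trace_transpose, LinearMap.trace_eq_matrix_trace ℝ b]

end HermitianAlgebra

/-! ### The maximal time and the scalar curvature function -/

section RealAnalysis

variable {m : ℕ} (p : Fin m → ℝ)

/-- The maximal existence time in terms of the eigenvalues of the Chern-Ricci operator. -/
def maxTime : EReal :=
  open Classical in if ∀ α, p α ≤ 0 then ⊤ else ((1 / (2 * ⨆ α, p α) : ℝ) : EReal)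

/-- The scalar curvature in terms of the eigenvalues of the Chern-Ricci operator. -/
def scalarFun (t : ℝ) : ℝ := ∑ α, p α / (1 - 2 * t * p α)

variable {p}

theorem maxTime_eq_top (h : ∀ α, p α ≤ 0) : maxTime p = ⊤ := by
  rw [maxTime, if_pos h]

theorem exists_maxTime_eq (h : ¬ ∀ α, p α ≤ 0) :
    ∃ α₀, 0 < p α₀ ∧ (∀ α, p α ≤ p α₀) ∧ maxTime p = ((1 / (2 * p α₀) : ℝ) : EReal) := by
  have h' := h
  push Not at h
  obtain ⟨α₁, h₁⟩ := h
  have : Nonempty (Fin m) := ⟨α₁⟩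
  obtain ⟨α₀, h₀⟩ := Finite.exists_max p
  have hs : ⨆ α, p α = p α₀ := le_antisymm (ciSup_le h₀) (le_ciSup (Finite.bddAbove_range p) α₀)
  refine ⟨α₀, h₁.trans_le (h₀ α₁), h₀, ?_⟩
  rw [maxTime, if_neg h', hs]

/-- Only the largest eigenvalue can make a factor vanish, and none does if all are nonpositive. This
replaces the case distinction on `maxTime` by positivity of every factor. -/
theorem mem_timeInterval_maxTime {t : ℝ} :
    t ∈ timeInterval (maxTime p) ↔ 0 ≤ t ∧ ∀ α, 0 < 1 - 2 * t * p α := by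
  by_cases h : ∀ α, p α ≤ 0
  · rw [timeInterval, maxTime_eq_top h]
    refine ⟨fun ht => ⟨ht.1, fun α => ?_⟩, fun ht => ⟨ht.1, EReal.coe_lt_top t⟩⟩
    nlinarith [mul_nonneg ht.1 (neg_nonneg.2 (h α))]
  · obtain ⟨α₀, h0, hmax, hT⟩ := exists_maxTime_eq h
    rw [timeInterval, hT]
    simp only [mem_ofPred_eq, EReal.coe_lt_coe_iff]
    rw [lt_div_iff₀ (by positivity)]
    refine ⟨fun ht => ⟨ht.1, fun α => ?_⟩, fun ht => ⟨ht.1, by linarith [ht.2 α₀]⟩⟩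
    nlinarith [mul_le_mul_of_nonneg_left (hmax α) ht.1]

theorem maxTime_pos : 0 < maxTime p := by
  have := (mem_timeInterval_maxTime (p := p) (t := 0)).2 (by simp)
  simpa using this.2

theorem hasDerivAt_scalarFun {t : ℝ} (ht : ∀ α, 0 < 1 - 2 * t * p α) :
    HasDerivAt (scalarFun p) (∑ α, 2 * p α ^ 2 / (1 - 2 * t * p α) ^ 2) t := by
  unfold scalarFun
  refine HasDerivAt.fun_sum fun α _ => ?_
  have h1 : HasDerivAt (fun t => 1 - 2 * t * p α) (-(2 * p α)) t := by
    simpa using (((hasDerivAt_id t).const_mul 2).mul_const (p α)).const_sub 1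
  refine ((hasDerivAt_const t (p α)).div h1 (ht α).ne').congr_deriv ?_
  congr 1
  ring

theorem div_sub_div_eq {a s t : ℝ} (hs : 0 < 1 - 2 * s * a) (ht : 0 < 1 - 2 * t * a) :
    a / (1 - 2 * t * a) - a / (1 - 2 * s * a) =
      2 * a ^ 2 * (t - s) / ((1 - 2 * t * a) * (1 - 2 * s * a)) := by
  rw [div_sub_div _ _ ht.ne' hs.ne']
  congr 1
  ring

theorem monotoneOn_scalarFun : MonotoneOn (scalarFun p) (timeInterval (maxTime p)) := by
  intro s hs t ht hst
  rw [mem_timeInterval_maxTime] at hs ht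
  refine Finset.sum_le_sum fun α _ => ?_
  rw [← sub_nonneg, div_sub_div_eq (hs.2 α) (ht.2 α)]
  have := hs.2 α
  have := ht.2 α
  have := sub_nonneg.2 hst
  positivity

theorem strictMonoOn_scalarFun (hp : p ≠ 0) :
    StrictMonoOn (scalarFun p) (timeInterval (maxTime p)) := by
  intro s hs t ht hst
  rw [mem_timeInterval_maxTime] at hs ht
  obtain ⟨α₀, h0⟩ := Function.ne_iff.1 hp
  have h0' : 0 < p α₀ ^ 2 := even_two.pow_pos h0
  refine Finset.sum_lt_sum (fun α _ => ?_) ⟨α₀, Finset.mem_univ _, ?_⟩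
  · rw [← sub_nonneg, div_sub_div_eq (hs.2 α) (ht.2 α)]
    have := hs.2 α
    have := ht.2 α
    have := sub_nonneg.2 hst.le
    positivity
  · rw [← sub_pos, div_sub_div_eq (hs.2 α₀) (ht.2 α₀)]
    have := hs.2 α₀
    have := ht.2 α₀
    have := sub_pos.2 hst
    positivity

theorem scalarFun_nonpos (hT : maxTime p = ⊤) {t : ℝ} (ht : t ∈ timeInterval (maxTime p)) :
    scalarFun p t ≤ 0 := by
  have h : ∀ α, p α ≤ 0 := by
    by_contra h
    obtain ⟨α₀, -, -, h'⟩ := exists_maxTime_eq h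
    rw [h'] at hT
    exact EReal.coe_ne_top _ hT
  rw [mem_timeInterval_maxTime] at ht
  exact Finset.sum_nonpos fun α _ => div_nonpos_of_nonpos_of_nonneg (h α) (ht.2 α).le

theorem exists_maxTime_eq_of_real {T' : ℝ} (hT : maxTime p = (T' : EReal)) :
    ∃ α₀, 0 < p α₀ ∧ (∀ α, p α ≤ p α₀) ∧ T' = 1 / (2 * p α₀) := by
  by_cases h : ∀ α, p α ≤ 0
  · rw [maxTime_eq_top h] at hT
    exact absurd hT.symm (EReal.coe_ne_top _)
  · obtain ⟨α₀, h0, hmax, h'⟩ := exists_maxTime_eq h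
    exact ⟨α₀, h0, hmax, by exact_mod_cast (hT.symm.trans h')⟩

theorem scalarFun_le {T' : ℝ} (hT : maxTime p = (T' : EReal)) :
    ∃ C : ℝ, 0 < C ∧ ∀ t ∈ timeInterval (maxTime p), scalarFun p t ≤ C / (T' - t) := by
  obtain ⟨α₀, h0, hmax, hT'⟩ := exists_maxTime_eq_of_real hT
  -- Each term is at most `(1/2) / (T' - t)`: for `p α > 0`, clearing denominators leaves `2 T' p α
  -- ≤ 1`, which holds because `T' = 1 / (2 p α₀)`. The extra `1` only makes the constant visibly
  -- positive.
  refine ⟨∑ _α : Fin m, 1 / 2 + 1, by positivity, fun t ht => ?_⟩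
  have ht' : 0 < T' - t := by
    have := ht.2
    rw [hT] at this
    exact sub_pos.2 (by exact_mod_cast this)
  rw [mem_timeInterval_maxTime] at ht
  have hterm : ∀ α, p α / (1 - 2 * t * p α) ≤ 1 / 2 / (T' - t) := fun α => by
    rcases le_or_gt (p α) 0 with h | h
    · exact (div_nonpos_of_nonpos_of_nonneg h (ht.2 α).le).trans (by positivity)
    · rw [div_le_div_iff₀ (ht.2 α) ht']
      have h1 : T' * (2 * p α₀) = 1 := by rw [hT']; field_simp
      have h2 : 0 ≤ T' := by rw [hT']; positivity
      nlinarith [mul_le_mul_of_nonneg_left (hmax α) h2]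
  calc scalarFun p t ≤ ∑ _α : Fin m, 1 / 2 / (T' - t) := Finset.sum_le_sum fun α _ => hterm α
    _ = (∑ _α : Fin m, 1 / 2) / (T' - t) := by rw [Finset.sum_div]
    _ ≤ _ := by gcongr; linarith

theorem tendsto_integral_scalarFun {T' : ℝ} (hT : maxTime p = (T' : EReal)) :
    Tendsto (fun s => ∫ t in (0 : ℝ)..s, scalarFun p t) (𝓝[<] T') atTop := by
  obtain ⟨α₀, h0, hmax, hT'⟩ := exists_maxTime_eq_of_real hT
  have hT0 : 0 < T' := by rw [hT']; positivity
  have hmem : ∀ s, 0 ≤ s → s < T' → ∀ α, 0 < 1 - 2 * s * p α := fun s h1 h2 =>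
    (mem_timeInterval_maxTime.1 (show s ∈ timeInterval (maxTime p) from
      ⟨h1, by rw [hT]; exact_mod_cast h2⟩)).2
  have hint : ∀ s, 0 ≤ s → s < T' → ∫ t in (0 : ℝ)..s, scalarFun p t =
      ∑ α, -(1 / 2) * Real.log (1 - 2 * s * p α) := fun s h1 h2 => by
    have hpos : ∀ x ∈ uIcc 0 s, ∀ α, 0 < 1 - 2 * x * p α := fun x hx => by
      rw [uIcc_of_le h1] at hx
      exact hmem x hx.1 (hx.2.trans_lt h2)
    have hF : ∀ x ∈ uIcc 0 s, HasDerivAt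
        (fun x => ∑ α, -(1 / 2) * Real.log (1 - 2 * x * p α)) (scalarFun p x) x := fun x hx => by
      refine HasDerivAt.fun_sum fun α _ => ?_
      have e1 : HasDerivAt (fun t => 1 - 2 * t * p α) (-(2 * p α)) x := by
        simpa using (((hasDerivAt_id x).const_mul 2).mul_const (p α)).const_sub 1
      refine ((e1.log (hpos x hx α).ne').const_mul _).congr_deriv ?_
      have := (hpos x hx α).ne'
      field_simp
    rw [intervalIntegral.integral_eq_sub_of_hasDerivAt hF]
    · simp
    · refine ContinuousOn.intervalIntegrable fun x hx => ?_
      exact (hasDerivAt_scalarFun (hpos x hx)).continuousAt.continuousWithinAt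
  -- The term of the largest eigenvalue tends to `+∞`. The subtracted constant bounds the
  -- contribution of all terms from below, since `1 - 2 s p α ≤ 1 + 2 T' |p α|` on `[0, T')`.
  have hlim : Tendsto (fun s => -(1 / 2) * Real.log (1 - 2 * s * p α₀)
      - ∑ α, 1 / 2 * Real.log (1 + 2 * T' * |p α|)) (𝓝[<] T') atTop := by
    refine tendsto_atTop_add_const_right _ _ ?_
    refine Tendsto.const_mul_atBot_of_neg (by norm_num) (Real.tendsto_log_nhdsGT_zero.comp ?_)
    refine tendsto_nhdsWithin_iff.2 ⟨?_, ?_⟩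
    · have : Tendsto (fun s : ℝ => 1 - 2 * s * p α₀) (𝓝 T') (𝓝 (1 - 2 * T' * p α₀)) :=
        Continuous.tendsto (by fun_prop) _
      rw [show 1 - 2 * T' * p α₀ = 0 by rw [hT']; field_simp; ring] at this
      exact this.mono_left nhdsWithin_le_nhds
    · filter_upwards [Ioo_mem_nhdsLT hT0] with s hs
      exact hmem s hs.1.le hs.2 α₀
  refine tendsto_atTop_mono' _ ?_ hlim
  filter_upwards [Ioo_mem_nhdsLT hT0] with s hs
  rw [hint s hs.1.le hs.2, sub_le_iff_le_add, ← Finset.sum_add_distrib]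
  have hlog : ∀ α, Real.log (1 - 2 * s * p α) ≤ Real.log (1 + 2 * T' * |p α|) := fun α => by
    refine Real.log_le_log (hmem s hs.1.le hs.2 α) ?_
    nlinarith [neg_abs_le (p α), mul_le_mul_of_nonneg_right hs.2.le (abs_nonneg (p α)),
      mul_le_mul_of_nonneg_left (neg_abs_le (p α)) hs.1.le]
  have h1 : -(1 / 2) * Real.log (1 - 2 * s * p α₀) ≤
      -(1 / 2) * Real.log (1 - 2 * s * p α₀) + 1 / 2 * Real.log (1 + 2 * T' * |p α₀|) := by
    have : 0 ≤ Real.log (1 + 2 * T' * |p α₀|) := Real.log_nonneg (by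
      have := abs_nonneg (p α₀); nlinarith [mul_nonneg hT0.le this])
    linarith
  -- After adding its constant to each term all summands are nonnegative, so the sum dominates the
  -- one at `α₀`.
  refine h1.trans (Finset.single_le_sum (f := fun α => -(1 / 2) * Real.log (1 - 2 * s * p α) +
    1 / 2 * Real.log (1 + 2 * T' * |p α|)) (fun α _ => ?_) (Finset.mem_univ α₀))
  have := hlog α
  linarith

end RealAnalysis

/-! ### The linear algebra of the flow -/

section FlowAlgebra

variable {V : Type*} [AddCommGroup V] [Module ℝ V] {m : ℕ}
  {j : V →ₗ[ℝ] V} {Ω β : V →ₗ[ℝ] V →ₗ[ℝ] ℝ}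

/-- The operator `P` with `β = Ω(P·,·)` for a `(1,1)` form `β`, and its diagonalization. -/
theorem IsHermitianForm.exists_diagonal [FiniteDimensional ℝ V] (h : IsHermitianForm j Ω)
    (hm : Module.finrank ℝ V = m) (βalt : ∀ u v, β u v = -β v u)
    (βinv : ∀ u v, β (j u) (j v) = β u v) :
    ∃ (P : V →ₗ[ℝ] V) (e : Module.Basis (Fin m) ℝ V) (p : Fin m → ℝ),
      (∀ u v, β u v = Ω (P u) v) ∧
      (∀ i k, Ω (e i) (j (e k)) = if i = k then 1 else 0) ∧ (∀ i, P (e i) = p i • e i) := by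
  obtain ⟨e, p, he, hp⟩ := exists_orthonormal_diagonal_basis hm (metricOf j Ω) (metricOf j β)
    h.metric_symm h.positive (fun u v => by
      simp only [metricOf_apply]
      rw [← βinv, h.sq, map_neg, βalt v])
  simp only [metricOf_apply] at he hp
  let P := e.constr ℝ fun i => p i • e i
  have hP : ∀ i, P (e i) = p i • e i := fun i => e.constr_basis ℝ _ i
  refine ⟨P, e, p, fun u v => ?_, he, hP⟩
  have h1 : metricOf j β = (metricOf j Ω).comp P := by
    refine e.ext fun i => e.ext fun k => ?_
    simp [hP, he, hp]
  -- The identity is known for the forms composed with `j` in the second slot; inserting `-j v`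
  -- undoes the `j`.
  have h2 := LinearMap.congr_fun (LinearMap.congr_fun h1 u) (-j v)
  simpa [h.sq] using h2

variable {P : V →ₗ[ℝ] V} {e : Module.Basis (Fin m) ℝ V} {p : Fin m → ℝ}

/-- In the coordinates of `e` the quadratic form of the new metric is `∑ (1 - 2 t p_i) x_i²`. -/
theorem IsHermitianForm.flow (h : IsHermitianForm j Ω) (βalt : ∀ u v, β u v = -β v u)
    (βinv : ∀ u v, β (j u) (j v) = β u v) (hβ : ∀ u v, β u v = Ω (P u) v)
    (he : ∀ i k, Ω (e i) (j (e k)) = if i = k then 1 else 0) (hP : ∀ i, P (e i) = p i • e i)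
    {t : ℝ} (ht : ∀ α, 0 < 1 - 2 * t * p α) : IsHermitianForm j (Ω - (2 * t) • β) where
  sq := h.sq
  alternating u v := by simp [h.alternating u, βalt u]; ring
  invariant u v := by simp [h.invariant, βinv]
  positive u hu := by
    have key : (Ω - (2 * t) • β) u (j u) = ∑ i, (1 - 2 * t * p i) * e.repr u i ^ 2 := by
      have h1 : (Ω - (2 * t) • β) u (j u) = Ω (u - (2 * t) • P u) (j u) := by
        simp [hβ]
      have h2 : u - (2 * t) • P u = ∑ i, ((1 - 2 * t * p i) * e.repr u i) • e i := by
        conv_lhs => rw [← e.sum_repr u]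
        simp only [map_sum, map_smul, hP, Finset.smul_sum, ← Finset.sum_sub_distrib]
        refine Finset.sum_congr rfl fun i _ => ?_
        module
      have h3 : ∀ i, Ω (e i) (j u) = e.repr u i := fun i => by
        rw [repr_eq_of_orthonormal (metricOf j Ω) e he, h.metric_symm]; rfl
      rw [h1, h2]
      simp only [map_sum, map_smul, LinearMap.sum_apply, LinearMap.smul_apply, h3, smul_eq_mul]
      refine Finset.sum_congr rfl fun i _ => ?_
      ring
    rw [key]
    have hne : ∃ i, e.repr u i ≠ 0 := by
      by_contra hall
      push Not at hall
      exact hu (e.repr.map_eq_zero_iff.1 (Finsupp.ext hall))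
    obtain ⟨i₀, hi₀⟩ := hne
    refine Finset.sum_pos' (fun i _ => mul_nonneg (ht i).le (sq_nonneg _))
      ⟨i₀, Finset.mem_univ _, mul_pos (ht i₀) (even_two.pow_pos hi₀)⟩

theorem isUnit_flow (hP : ∀ i, P (e i) = p i • e i) {t : ℝ} (ht : ∀ α, 0 < 1 - 2 * t * p α) :
    IsUnit (1 - (2 * t) • P) := by
  let Q := e.constr ℝ fun i => (1 - 2 * t * p i)⁻¹ • e i
  have hQ : ∀ i, Q (e i) = (1 - 2 * t * p i)⁻¹ • e i := fun i => e.constr_basis ℝ _ i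
  have h0 : ∀ i, (1 - (2 * t) • P) (e i) = (1 - 2 * t * p i) • e i := fun i => by
    simp only [LinearMap.sub_apply, Module.End.one_apply, LinearMap.smul_apply, hP]; module
  refine ⟨⟨1 - (2 * t) • P, Q, ?_, ?_⟩, rfl⟩ <;> refine e.ext fun i => ?_
  · rw [Module.End.mul_apply, hQ, map_smul, h0, smul_smul, inv_mul_cancel₀ (ht i).ne']; simp
  · rw [Module.End.mul_apply, h0, map_smul, hQ, smul_smul, mul_inv_cancel₀ (ht i).ne']; simp

/-- Expressing both sides through `Ω` and using nondegeneracy, the condition on `Q` becomes `P = (1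
- 2tP) Q`. -/
theorem IsHermitianForm.operator_flow (h : IsHermitianForm j Ω) (hβ : ∀ u v, β u v = Ω (P u) v)
    {t : ℝ} (hu : IsUnit (1 - (2 * t) • P)) (Q : V →ₗ[ℝ] V) :
    (∀ u v, β u v = (Ω - (2 * t) • β) (Q u) v) ↔ Q = Ring.inverse (1 - (2 * t) • P) * P := by
  have h1 : (∀ u v, β u v = (Ω - (2 * t) • β) (Q u) v) ↔ P = (1 - (2 * t) • P) * Q := by
    constructor
    · intro hQ
      refine LinearMap.ext fun u => h.form_inj fun v => ?_
      rw [← hβ, hQ]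
      simp [hβ]
    · intro hQ u v
      rw [hβ, hQ]
      simp [hβ]
  rw [h1]
  constructor
  · intro hQ
    have h2 := congrArg (Ring.inverse (1 - (2 * t) • P) * ·) hQ
    simp only [← mul_assoc, Ring.inverse_mul_cancel _ hu, one_mul] at h2
    exact h2.symm
  · rintro rfl
    rw [← mul_assoc, Ring.mul_inverse_cancel _ hu, one_mul]

/-- The trace of a two-form with respect to a Hermitian form only depends on its `(1,1)` part. -/
theorem IsHermitianForm.formTrace_eq [FiniteDimensional ℝ V] (h : IsHermitianForm j Ω)
    (ρ : V →ₗ[ℝ] V →ₗ[ℝ] ℝ)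
    {Q : V →ₗ[ℝ] V} (hQ : ∀ u v, oneOnePart j (fun u v => ρ u v) u v = Ω (Q u) v) :
    formTrace j (fun u v => Ω u v) (fun u v => ρ u v) = LinearMap.trace ℝ V Q / 2 := by
  obtain ⟨b, -, hb, -⟩ := exists_orthonormal_diagonal_basis rfl (metricOf j Ω) (metricOf j Ω)
    h.metric_symm h.positive h.metric_symm
  let S := b.constr ℝ fun i => ∑ k, metricOf j ρ (b i) (b k) • b k
  have hS : ∀ u v, Ω (S u) (j v) = ρ u (j v) := by
    have : (metricOf j Ω).comp S = metricOf j ρ := by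
      refine b.ext fun i => b.ext fun k => ?_
      simp only [LinearMap.comp_apply, S, b.constr_basis, map_sum, map_smul, LinearMap.sum_apply,
        LinearMap.smul_apply, hb]
      simp
    exact fun u v => LinearMap.congr_fun (LinearMap.congr_fun this u) v
  -- `S` represents the whole form, `Q` its `(1,1)` part. Taking the `(1,1)` part averages `S` with
  -- its conjugate by `j`, which does not change the trace.
  have hQS : Q = (1 / 2 : ℝ) • (S - (j ∘ₗ S) ∘ₗ j) := by
    refine LinearMap.ext fun u => h.metric_inj fun v => ?_
    rw [← hQ, oneOnePart]
    simp only [LinearMap.smul_apply, LinearMap.sub_apply, LinearMap.comp_apply, map_smul, map_sub]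
    rw [h.apply_left, hS, hS]
    simp
    ring
  have hjj : j ∘ₗ j = -LinearMap.id := LinearMap.ext fun v => h.sq v
  have htr : LinearMap.trace ℝ V Q = LinearMap.trace ℝ V S := by
    rw [hQS, map_smul, map_sub, LinearMap.trace_comp_comm', ← LinearMap.comp_assoc, hjj,
      LinearMap.neg_comp, LinearMap.id_comp, map_neg]
    simp only [smul_eq_mul]
    ring
  rw [formTrace, htr, ← metricTrace_eq_trace (metricOf j Ω) h.positive S]
  simp only [metricOf_apply, hS]

theorem trace_operator_flow (hP : ∀ i, P (e i) = p i • e i) {t : ℝ}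
    (ht : ∀ α, 0 < 1 - 2 * t * p α) :
    LinearMap.trace ℝ V (Ring.inverse (1 - (2 * t) • P) * P) = scalarFun p t := by
  have hu := isUnit_flow hP ht
  have h0 : ∀ i, (Ring.inverse (1 - (2 * t) • P) * P) (e i) =
      (p i / (1 - 2 * t * p i)) • e i := fun i => by
    have h1 : (1 - (2 * t) • P) (e i) = (1 - 2 * t * p i) • e i := by
      simp only [LinearMap.sub_apply, Module.End.one_apply, LinearMap.smul_apply, hP]; module
    have h2 : Ring.inverse (1 - (2 * t) • P) (e i) = (1 - 2 * t * p i)⁻¹ • e i := by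
      have h3 := LinearMap.congr_fun (Ring.inverse_mul_cancel _ hu) (e i)
      rw [Module.End.mul_apply, h1, map_smul] at h3
      rw [eq_inv_smul_iff₀ (ht i).ne', h3, Module.End.one_apply]
    rw [Module.End.mul_apply, hP, map_smul, h2, smul_smul, div_eq_mul_inv]
  rw [LinearMap.trace_eq_matrix_trace ℝ e, Matrix.trace, scalarFun]
  refine Finset.sum_congr rfl fun i _ => ?_
  rw [Matrix.diag_apply, LinearMap.toMatrix_apply, h0]
  simp

end FlowAlgebra

/-! ### Smooth fields and forms, and directional derivatives -/

theorem mvfderiv_congr {E : Type*} [NormedAddCommGroup E] [NormedSpace ℝ E]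
    {M : Type*} [TopologicalSpace M] [ChartedSpace E M] {F : Type*} [NormedAddCommGroup F] [NormedSpace ℝ F]
    {f g : M → F} {x : M} (h : f =ᶠ[𝓝 x] g) :
    ∀ v, mvfderiv 𝓘(ℝ, E) f x v = mvfderiv 𝓘(ℝ, E) g x v := by
  intro v
  simp only [mvfderiv, ContinuousLinearMap.comp_apply]
  rw [h.mfderiv_eq]
  rfl

section Smoothness

variable {E : Type*} [NormedAddCommGroup E] [NormedSpace ℝ E]
  {M : Type*} [TopologicalSpace M] [ChartedSpace E M] [IsManifold 𝓘(ℝ, E) ∞ M]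

open Bundle

/-- Smoothness of a vector field at a point. -/
abbrev IsSmoothFieldAt (X : (x : M) → TangentSpace 𝓘(ℝ, E) x) (x : M) : Prop :=
  ContMDiffAt 𝓘(ℝ, E) (𝓘(ℝ, E).prod 𝓘(ℝ, E)) ∞
    (fun x => (Bundle.TotalSpace.mk' E x (X x) : TangentBundle 𝓘(ℝ, E) M)) x

/-- Smoothness of a field of bilinear forms at a point. -/
abbrev IsSmoothFormAt (Ω : FormField E M) (x : M) : Prop :=
  ContMDiffAt 𝓘(ℝ, E) (𝓘(ℝ, E).prod 𝓘(ℝ, E →L[ℝ] E →L[ℝ] ℝ)) ∞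
    (fun x => Bundle.TotalSpace.mk' (E →L[ℝ] E →L[ℝ] ℝ)
      (E := fun y : M => TangentSpace 𝓘(ℝ, E) y →L[ℝ] TangentSpace 𝓘(ℝ, E) y →L[ℝ] ℝ) x (Ω x)) x

theorem contMDiffAt_clm_of_forall_apply {F : Type*} [NormedAddCommGroup F] [NormedSpace ℝ F]
    [FiniteDimensional ℝ E] {Φ : M → E →L[ℝ] F} {x : M}
    (h : ∀ e, ContMDiffAt 𝓘(ℝ, E) 𝓘(ℝ, F) ∞ (fun z => Φ z e) x) :
    ContMDiffAt 𝓘(ℝ, E) 𝓘(ℝ, E →L[ℝ] F) ∞ Φ x := by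
  let b := Module.finBasis ℝ E
  have key : Φ = fun z => ∑ i, ContinuousLinearMap.smulRightL ℝ E F
      (LinearMap.toContinuousLinearMap (b.coord i)) (Φ z (b i)) := by
    funext z
    ext v
    conv_lhs => rw [← b.sum_repr v, map_sum]
    simp
  rw [key]
  refine ContMDiffAt.sum fun i _ => ?_
  exact (ContinuousLinearMap.contMDiff _).contMDiffAt.comp x (h (b i))

/-- It suffices to test on the fields that are constant in a trivialization at `x`: they give the
columns of the coordinate expression. In this way tensors and connections are shown smooth without
computing in charts. -/
theorem contMDiffAt_hom_of_forall_field {F : Type*} [NormedAddCommGroup F] [NormedSpace ℝ F]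
    [FiniteDimensional ℝ E]
    {V : M → Type*} [TopologicalSpace (TotalSpace F V)] [∀ x, AddCommGroup (V x)]
    [∀ x, Module ℝ (V x)] [∀ x : M, TopologicalSpace (V x)] [∀ x, IsTopologicalAddGroup (V x)]
    [∀ x, ContinuousSMul ℝ (V x)] [FiberBundle F V] [VectorBundle ℝ F V]
    {Φ : (z : M) → TangentSpace 𝓘(ℝ, E) z →L[ℝ] V z} {x : M}
    (h : ∀ Y : (z : M) → TangentSpace 𝓘(ℝ, E) z, IsSmoothFieldAt Y x →
      ContMDiffAt 𝓘(ℝ, E) (𝓘(ℝ, E).prod 𝓘(ℝ, F)) ∞ (fun z => TotalSpace.mk' F z (Φ z (Y z))) x) :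
    ContMDiffAt 𝓘(ℝ, E) (𝓘(ℝ, E).prod 𝓘(ℝ, E →L[ℝ] F)) ∞
      (fun z => TotalSpace.mk' (E →L[ℝ] F)
        (E := fun y : M => TangentSpace 𝓘(ℝ, E) y →L[ℝ] V y) z (Φ z)) x := by
  rw [contMDiffAt_hom_bundle]
  refine ⟨contMDiffAt_id, contMDiffAt_clm_of_forall_apply fun e => ?_⟩
  let t := trivializationAt E (TangentSpace 𝓘(ℝ, E) : M → Type _) x
  have hx : x ∈ t.baseSet := mem_baseSet_trivializationAt E _ x
  have hY : IsSmoothFieldAt (fun z => t.symmL ℝ z e) x :=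
    ContMDiffAt.clm_bundle_apply (F₁ := E) (E₁ := Bundle.Trivial M E) (b := fun z => z)
      (v := fun _ => e) (x := x) (IM := 𝓘(ℝ, E)) (IB := 𝓘(ℝ, E))
      (t.contMDiffAt_symmL (n := ∞) (IB := 𝓘(ℝ, E)) hx)
      (contMDiffAt_section _ |>.2 contMDiffAt_const)
  refine ((contMDiffAt_section _).1 (h _ hY)).congr_of_eventuallyEq ?_
  filter_upwards [(trivializationAt F V x).open_baseSet.mem_nhds
    (mem_baseSet_trivializationAt F V x)] with z hz
  simp [ContinuousLinearMap.inCoordinates, t, Trivialization.coe_linearMapAt_of_mem _ hz]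

theorem contMDiffAt_form_of_forall_field [FiniteDimensional ℝ E] {Ω : FormField E M} {x : M}
    (h : ∀ Y Z : (z : M) → TangentSpace 𝓘(ℝ, E) z, IsSmoothFieldAt Y x → IsSmoothFieldAt Z x →
      ContMDiffAt 𝓘(ℝ, E) 𝓘(ℝ, ℝ) ∞ (fun z => Ω z (Y z) (Z z)) x) : IsSmoothFormAt Ω x := by
  refine contMDiffAt_hom_of_forall_field (F := E →L[ℝ] ℝ)
    (V := fun y : M => TangentSpace 𝓘(ℝ, E) y →L[ℝ] ℝ) fun Y hY => ?_
  refine contMDiffAt_hom_of_forall_field (F := ℝ) (V := Bundle.Trivial M ℝ)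
    (Φ := fun z => Ω z (Y z)) fun Z hZ => ?_
  exact (contMDiffAt_section _).2 (h Y Z hY hZ)

/-- A smooth form applied to smooth fields along a map. -/
theorem contMDiffWithinAt_form_apply
    {E' : Type*} [NormedAddCommGroup E'] [NormedSpace ℝ E'] {H' : Type*} [TopologicalSpace H']
    {I' : ModelWithCorners ℝ E' H'} {N : Type*} [TopologicalSpace N] [ChartedSpace H' N]
    {b : N → M} {Ω : (n : N) → TangentSpace 𝓘(ℝ, E) (b n) →L[ℝ] TangentSpace 𝓘(ℝ, E) (b n) →L[ℝ] ℝ}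
    {Y Z : (n : N) → TangentSpace 𝓘(ℝ, E) (b n)} {s : Set N} {x : N}
    (hΩ : ContMDiffWithinAt I' (𝓘(ℝ, E).prod 𝓘(ℝ, E →L[ℝ] E →L[ℝ] ℝ)) ∞
      (fun n => Bundle.TotalSpace.mk' (E →L[ℝ] E →L[ℝ] ℝ)
        (E := fun y : M => TangentSpace 𝓘(ℝ, E) y →L[ℝ] TangentSpace 𝓘(ℝ, E) y →L[ℝ] ℝ)
        (b n) (Ω n)) s x)
    (hY : ContMDiffWithinAt I' (𝓘(ℝ, E).prod 𝓘(ℝ, E)) ∞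
      (fun n => (Bundle.TotalSpace.mk' E (b n) (Y n) : TangentBundle 𝓘(ℝ, E) M)) s x)
    (hZ : ContMDiffWithinAt I' (𝓘(ℝ, E).prod 𝓘(ℝ, E)) ∞
      (fun n => (Bundle.TotalSpace.mk' E (b n) (Z n) : TangentBundle 𝓘(ℝ, E) M)) s x) :
    ContMDiffWithinAt I' 𝓘(ℝ, ℝ) ∞ (fun n => Ω n (Y n) (Z n)) s x := by
  have : ContMDiffWithinAt I' (𝓘(ℝ, E).prod 𝓘(ℝ)) ∞
      (fun m ↦ TotalSpace.mk' ℝ (E := Bundle.Trivial M ℝ) (b m) (Ω m (Y m) (Z m))) s x :=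
    ContMDiffWithinAt.clm_bundle_apply₂ (F₁ := E) (F₂ := E) hΩ hY hZ
  simp only [contMDiffWithinAt_totalSpace] at this
  exact this.2

theorem contMDiffAt_form_apply {Ω : FormField E M} {Y Z : (z : M) → TangentSpace 𝓘(ℝ, E) z}
    {x : M} (hΩ : IsSmoothFormAt Ω x) (hY : IsSmoothFieldAt Y x) (hZ : IsSmoothFieldAt Z x) :
    ContMDiffAt 𝓘(ℝ, E) 𝓘(ℝ, ℝ) ∞ (fun n => Ω n (Y n) (Z n)) x :=
  contMDiffWithinAt_form_apply hΩ hY hZ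

theorem isSmoothFieldAt_end_apply {A : EndField E M} {Y : (z : M) → TangentSpace 𝓘(ℝ, E) z} {x : M}
    (hA : ContMDiffAt 𝓘(ℝ, E) (𝓘(ℝ, E).prod 𝓘(ℝ, E →L[ℝ] E)) ∞
      (fun x => Bundle.TotalSpace.mk' (E →L[ℝ] E)
      (E := fun y : M => TangentSpace 𝓘(ℝ, E) y →L[ℝ] TangentSpace 𝓘(ℝ, E) y) x (A x)) x)
    (hY : IsSmoothFieldAt Y x) : IsSmoothFieldAt (fun z => A z (Y z)) x :=
  ContMDiffAt.clm_bundle_apply (F₁ := E) hA hY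

/-- The derivative, in the space variables, of a smooth function along a smooth field. -/
theorem contMDiffWithinAt_mvfderiv_apply
    {E' : Type*} [NormedAddCommGroup E'] [NormedSpace ℝ E'] {H' : Type*} [TopologicalSpace H']
    {I' : ModelWithCorners ℝ E' H'} {N : Type*} [TopologicalSpace N] [ChartedSpace H' N]
    [IsManifold I' 1 N] {F : Type*} [NormedAddCommGroup F] [NormedSpace ℝ F]
    {g : N → M} {f : N → M → F} {Y : (n : N) → TangentSpace 𝓘(ℝ, E) (g n)} {t : Set N} {x : N}
    (hx : x ∈ t)
    (hf : ContMDiffWithinAt (I'.prod 𝓘(ℝ, E)) 𝓘(ℝ, F) ∞ (Function.uncurry f) (t ×ˢ univ) (x, g x))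
    (hg : ContMDiffWithinAt I' 𝓘(ℝ, E) ∞ g t x)
    (hY : ContMDiffWithinAt I' (𝓘(ℝ, E).prod 𝓘(ℝ, E)) ∞
      (fun n => (Bundle.TotalSpace.mk' E (g n) (Y n) : TangentBundle 𝓘(ℝ, E) M)) t x) :
    ContMDiffWithinAt I' 𝓘(ℝ, F) ∞ (fun n => mvfderiv 𝓘(ℝ, E) (f n) (g n) (Y n)) t x := by
  have h1 := ContMDiffWithinAt.mfderivWithin (m := ∞) hf hg hx (mapsTo_univ _ _) (by simp)
    uniqueMDiffOn_univ
  have hb : ContMDiffWithinAt I' 𝓘(ℝ, F) ∞ (fun n => f n (g n)) t x :=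
    ContMDiffWithinAt.comp (g := Function.uncurry f) (f := fun n => (n, g n)) (t := t ×ˢ univ) x hf
      (contMDiffWithinAt_id.prodMk hg) (fun n hn => (⟨hn, mem_univ _⟩ : n ∈ t ∧ g n ∈ univ))
  have h2 := ContMDiffWithinAt.clm_apply_of_inCoordinates h1 hY hb
  rw [contMDiffWithinAt_totalSpace] at h2
  refine h2.2.congr_of_eventuallyEq_of_mem ?_ hx
  filter_upwards with n
  simp [mvfderiv, mfderivWithin_univ]
  rfl

theorem contMDiffAt_mvfderiv_apply {F : Type*} [NormedAddCommGroup F] [NormedSpace ℝ F]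
    {f : M → F} {Y : (z : M) → TangentSpace 𝓘(ℝ, E) z} {x : M}
    (hf : ContMDiffAt 𝓘(ℝ, E) 𝓘(ℝ, F) ∞ f x) (hY : IsSmoothFieldAt Y x) :
    ContMDiffAt 𝓘(ℝ, E) 𝓘(ℝ, F) ∞ (fun z => mvfderiv 𝓘(ℝ, E) f z (Y z)) x := by
  refine contMDiffWithinAt_mvfderiv_apply (t := univ) (g := fun z : M => z) (f := fun _ => f)
    (mem_univ x) ?_ contMDiffWithinAt_id hY
  exact (hf.comp (x, x) contMDiffAt_snd).contMDiffWithinAt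

theorem contMDiffOn_mvfderiv_apply {F : Type*} [NormedAddCommGroup F] [NormedSpace ℝ F]
    {f : ℝ → M → F} {I : Set ℝ} {Y : (z : M) → TangentSpace 𝓘(ℝ, E) z}
    (hf : ContMDiffOn (𝓘(ℝ, ℝ).prod 𝓘(ℝ, E)) 𝓘(ℝ, F) ∞ (Function.uncurry f) (I ×ˢ univ))
    (hY : IsSmoothField Y) :
    ContMDiffOn (𝓘(ℝ, ℝ).prod 𝓘(ℝ, E)) 𝓘(ℝ, F) ∞
      (Function.uncurry fun s z => mvfderiv 𝓘(ℝ, E) (f s) z (Y z)) (I ×ˢ univ) := by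
  rintro ⟨s, z⟩ hsz
  refine contMDiffWithinAt_mvfderiv_apply (g := fun q : ℝ × M => q.2) (f := fun q => f q.1)
    (Y := fun q => Y q.2) hsz ?_ contMDiffWithinAt_snd
    (hY.contMDiffAt.comp_contMDiffWithinAt _ contMDiffWithinAt_snd)
  refine (hf (s, z) hsz).comp ((s, z), z) (f := fun q : (ℝ × M) × M => (q.1.1, q.2))
    (contMDiffWithinAt_fst.fst.prodMk contMDiffWithinAt_snd) ?_
  exact fun q hq => ⟨hq.1.1, mem_univ _⟩

theorem IsSmoothFieldAt.smul {f : M → ℝ} {X : (z : M) → TangentSpace 𝓘(ℝ, E) z} {x : M}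
    (hf : ContMDiffAt 𝓘(ℝ, E) 𝓘(ℝ, ℝ) ∞ f x) (hX : IsSmoothFieldAt X x) :
    IsSmoothFieldAt (fun z => f z • X z) x :=
  ContMDiffAt.smul_section hf hX

theorem IsSmoothFieldAt.sum {ι : Type*} {s : Finset ι}
    {X : ι → (z : M) → TangentSpace 𝓘(ℝ, E) z} {x : M}
    (hX : ∀ i ∈ s, IsSmoothFieldAt (X i) x) :
    IsSmoothFieldAt (fun z => ∑ i ∈ s, X i z) x :=
  ContMDiffAt.sum_section hX

theorem IsSmoothFieldAt.congr {X Y : (z : M) → TangentSpace 𝓘(ℝ, E) z} {x : M}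
    (hX : IsSmoothFieldAt X x) (h : ∀ᶠ z in 𝓝 x, Y z = X z) : IsSmoothFieldAt Y x :=
  ContMDiffAt.congr_of_eventuallyEq hX (h.mono fun z hz => by simp only [hz])

theorem IsSmoothFieldAt.mdifferentiableAt {X : (z : M) → TangentSpace 𝓘(ℝ, E) z} {x : M}
    (hX : IsSmoothFieldAt X x) : MDifferentiableAt 𝓘(ℝ, E) (𝓘(ℝ, E).prod 𝓘(ℝ, E))
    (fun x => (Bundle.TotalSpace.mk' E x (X x) : TangentBundle 𝓘(ℝ, E) M)) x :=
  ContMDiffAt.mdifferentiableAt hX (by simp)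

end Smoothness

/-! ### Lie brackets of vector fields -/

section FieldCalculus

variable {E : Type*} [NormedAddCommGroup E] [NormedSpace ℝ E]
  {M : Type*} [TopologicalSpace M] [ChartedSpace E M]

open VectorField

theorem mvfderiv_clm_comp {F F' : Type*} [NormedAddCommGroup F] [NormedSpace ℝ F]
    [NormedAddCommGroup F'] [NormedSpace ℝ F'] (ℓ : F →L[ℝ] F') {f : M → F} {x : M}
    (hf : MDifferentiableAt 𝓘(ℝ, E) 𝓘(ℝ, F) f x) (v : TangentSpace 𝓘(ℝ, E) x) :
    mvfderiv 𝓘(ℝ, E) (fun z => ℓ (f z)) x v = ℓ (mvfderiv 𝓘(ℝ, E) f x v) := by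
  have h := mfderiv_comp x (ℓ.mdifferentiableAt (x := f x)) hf
  have h2 : mfderiv 𝓘(ℝ, E) 𝓘(ℝ, F') (fun z => ℓ (f z)) x =
      (mfderiv 𝓘(ℝ, F) 𝓘(ℝ, F') ℓ (f x)).comp (mfderiv 𝓘(ℝ, E) 𝓘(ℝ, F) f x) := h
  simp only [mvfderiv, ContinuousLinearMap.comp_apply, h2, ContinuousLinearMap.mfderiv_eq]
  rfl

variable [CompleteSpace E] [IsManifold 𝓘(ℝ, E) ∞ M]

instance isManifold_minSmoothness : IsManifold 𝓘(ℝ, E) (minSmoothness ℝ 3) M :=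
  IsManifold.of_le (n := ∞) (by simpa using ENat.LEInfty.out)

theorem mlieBracket_sum_right {ι : Type*} (s : Finset ι) (W : (z : M) → TangentSpace 𝓘(ℝ, E) z)
    {Z : ι → (z : M) → TangentSpace 𝓘(ℝ, E) z} {x : M} (hZ : ∀ i, IsSmoothFieldAt (Z i) x) :
    mlieBracket 𝓘(ℝ, E) W (fun z => ∑ i ∈ s, Z i z) x = ∑ i ∈ s, mlieBracket 𝓘(ℝ, E) W (Z i) x := by
  classical
  induction s using Finset.induction_on with
  | empty =>
    simp only [Finset.sum_empty]
    exact congrFun mlieBracket_zero_right x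
  | insert i s hi ih =>
    simp only [Finset.sum_insert hi]
    rw [← ih]
    exact mlieBracket_add_right (hZ i).mdifferentiableAt
      (IsSmoothFieldAt.sum fun i _ => hZ i).mdifferentiableAt

theorem IsSmoothField.mlieBracket {Y Z : (z : M) → TangentSpace 𝓘(ℝ, E) z}
    (hY : IsSmoothField Y) (hZ : IsSmoothField Z) : IsSmoothField (mlieBracket 𝓘(ℝ, E) Y Z) := by
  -- The bracket loses one derivative, so order `n` is derived from order `n + 1` of the fields.
  rw [IsSmoothField, contMDiff_infty]
  intro n
  have : IsManifold 𝓘(ℝ, E) ((((n + 1 : ℕ) : ℕ∞) : WithTop ℕ∞) + 1) M :=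
    IsManifold.of_le (n := ∞) (by exact_mod_cast (ENat.LEInfty.out (m := (((n + 1 + 1 : ℕ) : ℕ∞) : WithTop ℕ∞))))
  refine ContDiff.mlieBracket_vectorField (m := n) (n := (n + 1 : ℕ))
    (hY.of_le (by exact_mod_cast le_top)) (hZ.of_le (by exact_mod_cast le_top)) (by simp)

/-- Apply the Jacobi identity to `Y`, `Z` and `f • W` and expand by the Leibniz rule. Everything
cancels against the Jacobi identity for `W` except the multiple of `W x` by the defect of the
asserted equation, which is why some `W` with `W x ≠ 0` is needed. -/
theorem mvfderiv_mlieBracket {Y Z W : (z : M) → TangentSpace 𝓘(ℝ, E) z} {f : M → ℝ} {x : M}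
    (hY : IsSmoothField Y) (hZ : IsSmoothField Z) (hW : IsSmoothField W)
    (hf : ContMDiff 𝓘(ℝ, E) 𝓘(ℝ, ℝ) ∞ f) (hWx : W x ≠ 0) :
    mvfderiv 𝓘(ℝ, E) (fun z => mvfderiv 𝓘(ℝ, E) f z (Z z)) x (Y x) -
      mvfderiv 𝓘(ℝ, E) (fun z => mvfderiv 𝓘(ℝ, E) f z (Y z)) x (Z x) =
      mvfderiv 𝓘(ℝ, E) f x (mlieBracket 𝓘(ℝ, E) Y Z x) := by
  have hd : ∀ {V : (z : M) → TangentSpace 𝓘(ℝ, E) z} (hV : IsSmoothField V) (y),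
      MDifferentiableAt 𝓘(ℝ, E) 𝓘(ℝ, ℝ) (fun z => mvfderiv 𝓘(ℝ, E) f z (V z)) y :=
    fun hV y => (contMDiffAt_mvfderiv_apply hf.contMDiffAt (hV y)).mdifferentiableAt (by simp)
  have hfd : ∀ y, MDifferentiableAt 𝓘(ℝ, E) 𝓘(ℝ, ℝ) f y :=
    fun y => hf.contMDiffAt.mdifferentiableAt (by simp)
  have hsm : ∀ {V : (z : M) → TangentSpace 𝓘(ℝ, E) z} (hV : IsSmoothField V) (y),
      IsSmoothFieldAt V y := fun hV y => hV y
  -- the bracket with `f • W`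
  have h1 : ∀ {V : (z : M) → TangentSpace 𝓘(ℝ, E) z}, mlieBracket 𝓘(ℝ, E) V (f • W) =
      (fun z => mvfderiv 𝓘(ℝ, E) f z (V z)) • W + f • mlieBracket 𝓘(ℝ, E) V W := by
    intro V
    funext z
    exact mlieBracket_smul_right (hfd z) (hsm hW z).mdifferentiableAt
  have h2 : ∀ {V V' : (z : M) → TangentSpace 𝓘(ℝ, E) z}, IsSmoothField V' →
      mlieBracket 𝓘(ℝ, E) V (mlieBracket 𝓘(ℝ, E) V' (f • W)) x =
      mvfderiv 𝓘(ℝ, E) (fun z => mvfderiv 𝓘(ℝ, E) f z (V' z)) x (V x) • W x +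
        mvfderiv 𝓘(ℝ, E) f x (V' x) • mlieBracket 𝓘(ℝ, E) V W x +
        (mvfderiv 𝓘(ℝ, E) f x (V x) • mlieBracket 𝓘(ℝ, E) V' W x +
        f x • mlieBracket 𝓘(ℝ, E) V (mlieBracket 𝓘(ℝ, E) V' W) x) := by
    intro V V' hV'
    have hb := (hsm (hV'.mlieBracket hW) x)
    rw [h1, mlieBracket_add_right, mlieBracket_smul_right (hd hV' x) (hsm hW x).mdifferentiableAt,
      mlieBracket_smul_right (hfd x) hb.mdifferentiableAt]
    · exact (IsSmoothFieldAt.smul (contMDiffAt_mvfderiv_apply hf.contMDiffAt (hV' x))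
        (hW x)).mdifferentiableAt
    · exact (IsSmoothFieldAt.smul hf.contMDiffAt hb).mdifferentiableAt
  have hle : minSmoothness ℝ 2 ≤ ∞ := by simpa using ENat.LEInfty.out
  have hfW : IsSmoothFieldAt (f • W) x := IsSmoothFieldAt.smul hf.contMDiffAt (hW x)
  have j1 := leibniz_identity_mlieBracket_apply (U := Y) (V := Z) (W := f • W) (x := x)
    ((hY x).of_le hle) ((hZ x).of_le hle) (hfW.of_le hle)
  have j2 := leibniz_identity_mlieBracket_apply (U := Y) (V := Z) (W := W) (x := x)
    ((hY x).of_le hle) ((hZ x).of_le hle) ((hW x).of_le hle)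
  rw [h2 hZ, h2 hY, h1, j2] at j1
  simp only [Pi.add_apply, Pi.smul_apply'] at j1
  rw [← sub_eq_zero]
  refine (smul_eq_zero.1 ?_).resolve_right hWx
  rw [← sub_eq_zero] at j1
  rw [← j1]
  module

end FieldCalculus

/-! ### Local frames with constant structure functions -/

section Frames

variable {E : Type*} [NormedAddCommGroup E] [NormedSpace ℝ E]
  {M : Type*} [TopologicalSpace M] [ChartedSpace E M] [IsManifold 𝓘(ℝ, E) ∞ M]
  {L : Type*} [NormedAddCommGroup L] [NormedSpace ℝ L]

open VectorField

/-- A frame of the tangent bundle over the open set `U`, modelled on the vector space `L`, with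
constant structure functions `c` and constant complex structure `j`. The fields `X · u` and the
coordinates `θ` are globally defined and smooth, and mutually inverse over `U`. -/
structure LocalFrame (J : EndField E M) (c : L →ₗ[ℝ] L →ₗ[ℝ] L) (j : L →ₗ[ℝ] L) (U : Set M) where
  X : (z : M) → L →ₗ[ℝ] TangentSpace 𝓘(ℝ, E) z
  θ : (z : M) → TangentSpace 𝓘(ℝ, E) z →ₗ[ℝ] L
  isOpen : IsOpen U
  smooth_X : ∀ u, IsSmoothField fun z => X z u
  smooth_θ : ∀ (Y : (z : M) → TangentSpace 𝓘(ℝ, E) z) (x : M), IsSmoothFieldAt Y x →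
    ContMDiffAt 𝓘(ℝ, E) 𝓘(ℝ, L) ∞ (fun z => θ z (Y z)) x
  θ_X : ∀ z ∈ U, ∀ u, θ z (X z u) = u
  X_θ : ∀ z ∈ U, ∀ w, X z (θ z w) = w
  bracket : ∀ z ∈ U, ∀ u v,
    mlieBracket 𝓘(ℝ, E) (fun y => X y u) (fun y => X y v) z = X z (c u v)
  complex : ∀ z ∈ U, ∀ u, J z (X z u) = X z (j u)

namespace LocalFrame

variable {J : EndField E M} {c : L →ₗ[ℝ] L →ₗ[ℝ] L} {j : L →ₗ[ℝ] L} {U : Set M}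

theorem eventually_mem (φ : LocalFrame J c j U) {x : M} (hx : x ∈ U) : ∀ᶠ z in 𝓝 x, z ∈ U := φ.isOpen.mem_nhds hx

variable (φ : LocalFrame J c j U)

theorem smooth_coord {Y : (z : M) → TangentSpace 𝓘(ℝ, E) z} (hY : IsSmoothField Y) :
    ContMDiff 𝓘(ℝ, E) 𝓘(ℝ, L) ∞ (fun z => φ.θ z (Y z)) := fun x => φ.smooth_θ Y x (hY x)

theorem mdifferentiableAt_coord {Y : (z : M) → TangentSpace 𝓘(ℝ, E) z} (hY : IsSmoothField Y)
    (x : M) : MDifferentiableAt 𝓘(ℝ, E) 𝓘(ℝ, L) (fun z => φ.θ z (Y z)) x :=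
  (φ.smooth_coord hY).contMDiffAt.mdifferentiableAt (by simp)

theorem bracket_swap (φ : LocalFrame J c j U) {z : M} (hz : z ∈ U) (u v : L) : c u v = -c v u := by
  have h := mlieBracket_swap_apply (I := 𝓘(ℝ, E)) (V := fun y => φ.X y u) (W := fun y => φ.X y v)
    (x := z)
  rw [φ.bracket z hz, φ.bracket z hz] at h
  have h2 := congrArg (φ.θ z) h
  rwa [map_neg, φ.θ_X z hz, φ.θ_X z hz] at h2

theorem θ_complex {z : M} (hz : z ∈ U) (w) : φ.θ z (J z w) = j (φ.θ z w) := by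
  conv_lhs => rw [← φ.X_θ z hz w, φ.complex z hz, φ.θ_X z hz]

theorem mvfderiv_θ_X {x : M} (hx : x ∈ U) (u : L) (v : TangentSpace 𝓘(ℝ, E) x) :
    mvfderiv 𝓘(ℝ, E) (fun z => φ.θ z (φ.X z u)) x v = 0 := by
  rw [mvfderiv_congr (g := fun _ => u)
    ((φ.eventually_mem hx).mono fun z hz => φ.θ_X z hz u), mvfderiv_const]
  rfl

variable [FiniteDimensional ℝ L] [CompleteSpace E]

/-- The Leibniz rule for `Z` expanded in the frame. Since `W` is arbitrary, a second application
with the slots exchanged computes the bracket of two general fields. -/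
theorem mlieBracket_eq_add_sum {x : M} (hx : x ∈ U) {ι : Type*} [Fintype ι]
    (b : Module.Basis ι ℝ L) (W : (z : M) → TangentSpace 𝓘(ℝ, E) z)
    {Z : (z : M) → TangentSpace 𝓘(ℝ, E) z} (hZ : IsSmoothField Z) :
    mlieBracket 𝓘(ℝ, E) W Z x = φ.X x (mvfderiv 𝓘(ℝ, E) (fun z => φ.θ z (Z z)) x (W x)) +
      ∑ i, b.repr (φ.θ x (Z x)) i • mlieBracket 𝓘(ℝ, E) W (fun z => φ.X z (b i)) x := by
  let ℓ : ι → L →L[ℝ] ℝ := fun i => LinearMap.toContinuousLinearMap (b.coord i)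
  have hℓ : ∀ i u, ℓ i u = b.repr u i := fun i u => rfl
  have hs : ∀ i, ContMDiff 𝓘(ℝ, E) 𝓘(ℝ, ℝ) ∞ (fun z => ℓ i (φ.θ z (Z z))) := fun i =>
    (ℓ i).contMDiff.comp (φ.smooth_coord hZ)
  have hX : ∀ i, IsSmoothFieldAt (fun z => φ.X z (b i)) x := fun i => φ.smooth_X (b i) x
  have h1 : Z =ᶠ[𝓝 x] fun z => ∑ i, ℓ i (φ.θ z (Z z)) • φ.X z (b i) := by
    filter_upwards [φ.eventually_mem hx] with z hz
    conv_lhs => rw [← φ.X_θ z hz (Z z), ← b.sum_repr (φ.θ z (Z z)), map_sum]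
    exact Finset.sum_congr rfl fun i _ => by rw [map_smul]; rfl
  have h2 : ∀ i, mlieBracket 𝓘(ℝ, E) W (fun z => ℓ i (φ.θ z (Z z)) • φ.X z (b i)) x =
      ℓ i (mvfderiv 𝓘(ℝ, E) (fun z => φ.θ z (Z z)) x (W x)) • φ.X x (b i) +
      ℓ i (φ.θ x (Z x)) • mlieBracket 𝓘(ℝ, E) W (fun z => φ.X z (b i)) x := by
    intro i
    have := mlieBracket_smul_right (I := 𝓘(ℝ, E)) (V := W) (W := fun z => φ.X z (b i)) (x := x)
      ((hs i).contMDiffAt.mdifferentiableAt (by simp)) (hX i).mdifferentiableAt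
    rw [mvfderiv_clm_comp (ℓ i) (φ.mdifferentiableAt_coord hZ x)] at this
    exact this
  refine ((EventuallyEq.mlieBracket_vectorField_eq (EventuallyEq.refl _ W) h1).trans
    (mlieBracket_sum_right (Z := fun i z => ℓ i (φ.θ z (Z z)) • φ.X z (b i)) _ _
      fun i => IsSmoothFieldAt.smul (hs i).contMDiffAt (hX i))).trans ?_
  simp only [h2, Finset.sum_add_distrib]
  congr 1
  conv_rhs => rw [← b.sum_repr (mvfderiv 𝓘(ℝ, E) (fun z => φ.θ z (Z z)) x (W x)), map_sum]
  exact Finset.sum_congr rfl fun i _ => by rw [map_smul]; rfl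

theorem θ_mlieBracket {x : M} (hx : x ∈ U) {Y Z : (z : M) → TangentSpace 𝓘(ℝ, E) z}
    (hY : IsSmoothField Y) (hZ : IsSmoothField Z) :
    φ.θ x (mlieBracket 𝓘(ℝ, E) Y Z x) =
      mvfderiv 𝓘(ℝ, E) (fun z => φ.θ z (Z z)) x (Y x) -
      mvfderiv 𝓘(ℝ, E) (fun z => φ.θ z (Y z)) x (Z x) + c (φ.θ x (Y x)) (φ.θ x (Z x)) := by
  let b := Module.finBasis ℝ L
  have h1 : ∀ u, φ.θ x (mlieBracket 𝓘(ℝ, E) (fun z => φ.X z u) Y x) =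
      mvfderiv 𝓘(ℝ, E) (fun z => φ.θ z (Y z)) x (φ.X x u) + c u (φ.θ x (Y x)) := by
    intro u
    rw [φ.mlieBracket_eq_add_sum hx b _ hY, map_add, φ.θ_X x hx, map_sum]
    congr 1
    conv_rhs => rw [← b.sum_repr (φ.θ x (Y x)), map_sum]
    refine Finset.sum_congr rfl fun i _ => ?_
    rw [map_smul, map_smul, φ.bracket x hx, φ.θ_X x hx]
  rw [φ.mlieBracket_eq_add_sum hx b _ hZ, map_add, φ.θ_X x hx, map_sum]
  have h2 : ∀ i, φ.θ x (b.repr (φ.θ x (Z x)) i •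
      mlieBracket 𝓘(ℝ, E) Y (fun z => φ.X z (b i)) x) = -(b.repr (φ.θ x (Z x)) i •
      (mvfderiv 𝓘(ℝ, E) (fun z => φ.θ z (Y z)) x (φ.X x (b i)) + c (b i) (φ.θ x (Y x)))) := by
    intro i
    rw [mlieBracket_swap_apply, smul_neg, map_neg, map_smul, h1]
  simp only [h2, Finset.sum_neg_distrib, smul_add, Finset.sum_add_distrib]
  have h3 : ∑ i, b.repr (φ.θ x (Z x)) i •
      mvfderiv 𝓘(ℝ, E) (fun z => φ.θ z (Y z)) x (φ.X x (b i)) =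
      mvfderiv 𝓘(ℝ, E) (fun z => φ.θ z (Y z)) x (Z x) := by
    conv_rhs => rw [← φ.X_θ x hx (Z x), ← b.sum_repr (φ.θ x (Z x)), map_sum, map_sum]
    exact Finset.sum_congr rfl fun i _ => by rw [map_smul, map_smul]
  have h4 : ∑ i, b.repr (φ.θ x (Z x)) i • c (b i) (φ.θ x (Y x)) = c (φ.θ x (Z x)) (φ.θ x (Y x)) := by
    conv_rhs => rw [← b.sum_repr (φ.θ x (Z x)), map_sum, LinearMap.sum_apply]
    exact Finset.sum_congr rfl fun i _ => by rw [map_smul, LinearMap.smul_apply]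
  rw [h3, h4, φ.bracket_swap hx (φ.θ x (Y x))]
  abel

/-- `d_Y d_Z f - d_Z d_Y f = d_{[Y,Z]} f` for vector-valued functions. -/
theorem mvfderiv_mlieBracket_vector (φ : LocalFrame J c j U) {F : Type*} [NormedAddCommGroup F] [NormedSpace ℝ F]
    [FiniteDimensional ℝ F] {x : M} (hx : x ∈ U) {Y Z : (z : M) → TangentSpace 𝓘(ℝ, E) z}
    {f : M → F} (hY : IsSmoothField Y) (hZ : IsSmoothField Z)
    (hf : ContMDiff 𝓘(ℝ, E) 𝓘(ℝ, F) ∞ f) :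
    mvfderiv 𝓘(ℝ, E) (fun z => mvfderiv 𝓘(ℝ, E) f z (Z z)) x (Y x) -
      mvfderiv 𝓘(ℝ, E) (fun z => mvfderiv 𝓘(ℝ, E) f z (Y z)) x (Z x) =
      mvfderiv 𝓘(ℝ, E) f x (mlieBracket 𝓘(ℝ, E) Y Z x) := by
  -- A nonzero frame field serves as the auxiliary field; if there is none, the tangent space at `x`
  -- is zero and the claim is trivial.
  rcases subsingleton_or_nontrivial L with hL | hL
  · have h0 : ∀ v : TangentSpace 𝓘(ℝ, E) x, v = 0 := fun v => by
      rw [← φ.X_θ x hx v, Subsingleton.elim (φ.θ x v) 0, map_zero]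
    rw [h0 (Y x), h0 (Z x), h0 (mlieBracket 𝓘(ℝ, E) Y Z x)]
    simp
  obtain ⟨w, hw⟩ := exists_ne (0 : L)
  have hwx : φ.X x w ≠ 0 := fun h => hw (by rw [← φ.θ_X x hx w, h, map_zero])
  let b := Module.finBasis ℝ F
  refine b.ext_elem fun i => ?_
  let ℓ : F →L[ℝ] ℝ := LinearMap.toContinuousLinearMap (b.coord i)
  change ℓ _ = ℓ _
  have hfd : ∀ z, MDifferentiableAt 𝓘(ℝ, E) 𝓘(ℝ, F) f z :=
    fun z => hf.contMDiffAt.mdifferentiableAt (by simp)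
  have hd : ∀ {V : (z : M) → TangentSpace 𝓘(ℝ, E) z} (hV : IsSmoothField V),
      MDifferentiableAt 𝓘(ℝ, E) 𝓘(ℝ, F) (fun z => mvfderiv 𝓘(ℝ, E) f z (V z)) x :=
    fun hV => (contMDiffAt_mvfderiv_apply hf.contMDiffAt (hV x)).mdifferentiableAt (by simp)
  have := mvfderiv_mlieBracket hY hZ (φ.smooth_X w) (ℓ.contMDiff.comp hf) hwx
  simp only [Function.comp_def] at this
  rw [mvfderiv_clm_comp ℓ (hfd x)] at this
  simp only [mvfderiv_clm_comp ℓ (hfd _)] at this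
  rw [mvfderiv_clm_comp ℓ (hd hY), mvfderiv_clm_comp ℓ (hd hZ)] at this
  rw [map_sub, this]

end LocalFrame

end Frames

/-! ### Derivatives of determinants -/

section LogDet

variable {ι : Type*} [Fintype ι] [DecidableEq ι]

theorem differentiable_det : Differentiable ℝ fun m : ι → ι → ℝ => (Matrix.of m).det := by
  simp only [Matrix.det_apply', Matrix.of_apply]
  fun_prop

/-- `det (1 + sB)` is `1 + s tr B` plus `s²` times a polynomial in `s`, and the last term has zero
derivative at `0`. -/
theorem hasDerivAt_det_one_add_smul (B : Matrix ι ι ℝ) :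
    HasDerivAt (fun s : ℝ => (1 + s • B).det) B.trace 0 := by
  have h1 : HasDerivAt (fun s : ℝ => 1 + B.trace * s) B.trace 0 := by
    simpa using ((hasDerivAt_id (0 : ℝ)).const_mul B.trace).const_add 1
  have h2 : ∀ q : Polynomial ℝ, HasDerivAt (fun s : ℝ => q.eval s * s ^ 2) 0 0 := fun q => by
    have := (Polynomial.hasDerivAt q (0 : ℝ)).fun_mul (hasDerivAt_pow 2 (0 : ℝ))
    simpa using! this
  have h3 := h1.add (h2 (Matrix.det (1 + (Polynomial.X : Polynomial ℝ) •
    B.map Polynomial.C)).divX.divX)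
  rw [add_zero] at h3
  refine h3.congr_of_eventuallyEq (Eventually.of_forall fun s => ?_)
  exact Matrix.det_one_add_smul s B

/-- The entries of a matrix. -/
def entries (A : Matrix ι ι ℝ) : ι → ι → ℝ := fun i k => A i k

theorem hasDerivAt_det_line {G H : Matrix ι ι ℝ} {a : ℝ}
    (h : HasDerivAt (fun s : ℝ => (G + s • H).det) a 0) :
    fderiv ℝ (fun m : ι → ι → ℝ => (Matrix.of m).det) (entries G) (entries H) = a := by
  have h1 : HasDerivAt (fun s : ℝ => entries G + s • entries H) (entries H) 0 := by
    simpa using ((hasDerivAt_id (0 : ℝ)).smul_const (entries H)).const_add (entries G)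
  have h2 := HasFDerivAt.comp_hasDerivAt_of_eq (0 : ℝ)
    (differentiable_det (entries G)).hasFDerivAt h1 (by simp)
  exact h2.unique h

/-- Along the line `G + s BG` the determinant factors as `det (1 + sB) det G`, so no adjugate is
needed. -/
theorem fderiv_det_mul_left (G B : Matrix ι ι ℝ) :
    fderiv ℝ (fun m : ι → ι → ℝ => (Matrix.of m).det) (entries G) (entries (B * G)) =
      B.trace * G.det := by
  refine hasDerivAt_det_line (((hasDerivAt_det_one_add_smul B).mul_const G.det).congr_of_eventuallyEq
    (Eventually.of_forall fun s => ?_))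
  simp only
  rw [← Matrix.det_mul, add_mul, one_mul, smul_mul_assoc]

theorem fderiv_det_mul_right (G B : Matrix ι ι ℝ) :
    fderiv ℝ (fun m : ι → ι → ℝ => (Matrix.of m).det) (entries G) (entries (G * B)) =
      B.trace * G.det := by
  refine hasDerivAt_det_line (((hasDerivAt_det_one_add_smul B).mul_const G.det).congr_of_eventuallyEq
    (Eventually.of_forall fun s => ?_))
  simp only
  rw [mul_comm (Matrix.det _), ← Matrix.det_mul, mul_add, mul_one, mul_smul_comm]

variable {E : Type*} [NormedAddCommGroup E] [NormedSpace ℝ E]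
  {M : Type*} [TopologicalSpace M] [ChartedSpace E M]

theorem mvfderiv_comp_differentiableAt {F F' : Type*} [NormedAddCommGroup F] [NormedSpace ℝ F]
    [NormedAddCommGroup F'] [NormedSpace ℝ F'] {g : F → F'} {f : M → F} {x : M}
    (hg : DifferentiableAt ℝ g (f x))
    (hf : MDifferentiableAt 𝓘(ℝ, E) 𝓘(ℝ, F) f x) (v : TangentSpace 𝓘(ℝ, E) x) :
    mvfderiv 𝓘(ℝ, E) (fun z => g (f z)) x v = fderiv ℝ g (f x) (mvfderiv 𝓘(ℝ, E) f x v) := by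
  have h := mfderiv_comp x hg.mdifferentiableAt hf
  have h2 : mfderiv 𝓘(ℝ, E) 𝓘(ℝ, F') (fun z => g (f z)) x =
      (mfderiv 𝓘(ℝ, F) 𝓘(ℝ, F') g (f x)).comp (mfderiv 𝓘(ℝ, E) 𝓘(ℝ, F) f x) := h
  simp only [mvfderiv, ContinuousLinearMap.comp_apply, h2, mfderiv_eq_fderiv]
  rfl

/-- Logarithmic derivative of a determinant `det G` for a matrix with `dG = Bᵀ G + G B`. -/
theorem mvfderiv_log_det {f : M → Matrix ι ι ℝ} {x : M} (v : TangentSpace 𝓘(ℝ, E) x)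
    (hf : ∀ i k, ContMDiffAt 𝓘(ℝ, E) 𝓘(ℝ, ℝ) ∞ (fun z => f z i k) x)
    (hdet : 0 < (f x).det) {B : Matrix ι ι ℝ}
    (hB : ∀ i k, mvfderiv 𝓘(ℝ, E) (fun z => f z i k) x v = (B.transpose * f x + f x * B) i k) :
    mvfderiv 𝓘(ℝ, E) (fun z => Real.log (f z).det) x v = 2 * B.trace := by
  have hs : ContMDiffAt 𝓘(ℝ, E) 𝓘(ℝ, ι → ι → ℝ) ∞ (fun z => entries (f z)) x :=
    contMDiffAt_pi_space.2 fun i => contMDiffAt_pi_space.2 fun k => hf i k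
  have hs' : MDifferentiableAt 𝓘(ℝ, E) 𝓘(ℝ, ι → ι → ℝ) (fun z => entries (f z)) x :=
    hs.mdifferentiableAt (by simp)
  have hd : mvfderiv 𝓘(ℝ, E) (fun z => entries (f z)) x v =
      entries (B.transpose * f x) + entries (f x * B) := by
    funext i k
    refine Eq.trans ?_ (hB i k)
    exact (mvfderiv_clm_comp ((ContinuousLinearMap.proj (R := ℝ) (φ := fun _ : ι => ℝ) k).comp
      (ContinuousLinearMap.proj (R := ℝ) (φ := fun _ : ι => ι → ℝ) i)) hs' v).symm
  have hlog : DifferentiableAt ℝ (fun m : ι → ι → ℝ => Real.log (Matrix.of m).det)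
      (entries (f x)) := (differentiable_det _).log hdet.ne'
  refine (mvfderiv_comp_differentiableAt (f := fun z => entries (f z)) hlog hs' v).trans ?_
  have hl := ((differentiable_det (entries (f x))).hasFDerivAt.log hdet.ne').fderiv
  rw [hd, hl, _root_.smul_apply, map_add,
    fderiv_det_mul_left, fderiv_det_mul_right, Matrix.trace_transpose, smul_eq_mul]
  change (f x).det⁻¹ * _ = _
  field_simp [hdet.ne']
  ring

end LogDet

/-! ### Connections and their curvature in a frame -/

section Connections

variable {E : Type*} [NormedAddCommGroup E] [NormedSpace ℝ E]
  {M : Type*} [TopologicalSpace M] [ChartedSpace E M] [IsManifold 𝓘(ℝ, E) ∞ M]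
  {L : Type*} [NormedAddCommGroup L] [NormedSpace ℝ L]
  (D : CovariantDerivative 𝓘(ℝ, E) E (TangentSpace 𝓘(ℝ, E) : M → Type _))

open VectorField

theorem covariantDerivative_congr {Y Z : (z : M) → TangentSpace 𝓘(ℝ, E) z} {x : M}
    (hY : IsSmoothFieldAt Y x) (h : ∀ᶠ z in 𝓝 x, Y z = Z z) : D Y x = D Z x :=
  D.isCovariantDerivativeOnUniv.congr_of_eventuallyEq hY.mdifferentiableAt
    (hY.congr (h.mono fun _ h => h.symm)).mdifferentiableAt univ_mem h

theorem covariantDerivative_add {Y Z : (z : M) → TangentSpace 𝓘(ℝ, E) z} {x : M}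
    (hY : IsSmoothFieldAt Y x) (hZ : IsSmoothFieldAt Z x) :
    D (fun z => Y z + Z z) x = D Y x + D Z x :=
  D.isCovariantDerivativeOnUniv.add hY.mdifferentiableAt hZ.mdifferentiableAt

theorem covariantDerivative_smul {f : M → ℝ} {Y : (z : M) → TangentSpace 𝓘(ℝ, E) z} {x : M}
    (hf : ContMDiffAt 𝓘(ℝ, E) 𝓘(ℝ, ℝ) ∞ f x) (hY : IsSmoothFieldAt Y x)
    (v : TangentSpace 𝓘(ℝ, E) x) :
    D (fun z => f z • Y z) x v = f x • D Y x v + mvfderiv 𝓘(ℝ, E) f x v • Y x := by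
  have := D.isCovariantDerivativeOnUniv.leibniz hY.mdifferentiableAt
    (hf.mdifferentiableAt (by simp))
  exact congrArg (fun A : TangentSpace 𝓘(ℝ, E) x →L[ℝ] TangentSpace 𝓘(ℝ, E) x => A v) this

theorem covariantDerivative_const_smul (a : ℝ) {Y : (z : M) → TangentSpace 𝓘(ℝ, E) z} {x : M}
    (hY : IsSmoothFieldAt Y x) : D (fun z => a • Y z) x = a • D Y x :=
  D.isCovariantDerivativeOnUniv.smul_const a hY.mdifferentiableAt

theorem covariantDerivative_sum {ι : Type*} (s : Finset ι)
    {Z : ι → (z : M) → TangentSpace 𝓘(ℝ, E) z} {x : M} (hZ : ∀ i, IsSmoothFieldAt (Z i) x) :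
    D (fun z => ∑ i ∈ s, Z i z) x = ∑ i ∈ s, D (Z i) x := by
  classical
  induction s using Finset.induction_on with
  | empty =>
    simp only [Finset.sum_empty]
    exact congrFun D.zero x
  | insert i s hi ih =>
    simp only [Finset.sum_insert hi]
    rw [← ih]
    exact covariantDerivative_add D (hZ i) (IsSmoothFieldAt.sum fun i _ => hZ i)

theorem isSmoothField_covariantDerivative_apply (hD : D.ContMDiffCovariantDerivative ∞)
    {Y Z : (z : M) → TangentSpace 𝓘(ℝ, E) z} (hY : IsSmoothField Y) (hZ : IsSmoothField Z) :
    IsSmoothField fun z => D Y z (Z z) := by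
  have h := hD.contMDiff.contMDiff (σ := Y) (by
    rw [contMDiffOn_univ]; exact hY)
  rw [contMDiffOn_univ] at h
  exact ContMDiff.clm_bundle_apply (F₁ := E) h hZ

theorem mvfderiv_sum_apply {F : Type*} [NormedAddCommGroup F] [NormedSpace ℝ F] {ι : Type*}
    (s : Finset ι) {f : ι → M → F} {x : M}
    (hf : ∀ i, MDifferentiableAt 𝓘(ℝ, E) 𝓘(ℝ, F) (f i) x) (v : TangentSpace 𝓘(ℝ, E) x) :
    MDifferentiableAt 𝓘(ℝ, E) 𝓘(ℝ, F) (fun z => ∑ i ∈ s, f i z) x ∧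
    mvfderiv 𝓘(ℝ, E) (fun z => ∑ i ∈ s, f i z) x v = ∑ i ∈ s, mvfderiv 𝓘(ℝ, E) (f i) x v := by
  classical
  induction s using Finset.induction_on with
  | empty =>
    simp only [Finset.sum_empty]
    exact ⟨mdifferentiableAt_const, by rw [mvfderiv_const]; rfl⟩
  | insert i s hi ih =>
    simp only [Finset.sum_insert hi]
    refine ⟨(hf i).add ih.1, ?_⟩
    rw [← ih.2, mvfderiv_fun_add (hf i) ih.1]
    rfl

namespace LocalFrame

variable {J : EndField E M} {c : L →ₗ[ℝ] L →ₗ[ℝ] L} {j : L →ₗ[ℝ] L} {U : Set M}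
  (φ : LocalFrame J c j U)

/-- The connection coefficients `θ(D_{X u} (X v))` of a connection in a frame. -/
def coeff (z : M) : L →ₗ[ℝ] L →ₗ[ℝ] L :=
  LinearMap.mk₂ ℝ (fun u v => φ.θ z (D (fun y => φ.X y v) z (φ.X z u)))
    (fun u u' v => by simp only [map_add])
    (fun a u v => by simp only [map_smul])
    (fun u v v' => by
      have := covariantDerivative_add D (φ.smooth_X v z) (φ.smooth_X v' z)
      simp only [map_add, this]
      exact map_add (φ.θ z) _ _)
    (fun a u v => by
      have := covariantDerivative_const_smul D a (φ.smooth_X v z)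
      simp only [map_smul, this]
      exact map_smul (φ.θ z) _ _)

theorem coeff_apply (z : M) (u v : L) :
    φ.coeff D z u v = φ.θ z (D (fun y => φ.X y v) z (φ.X z u)) := rfl

theorem covariantDerivative_X {x : M} (hx : x ∈ U) (w : L) (v : TangentSpace 𝓘(ℝ, E) x) :
    D (fun y => φ.X y w) x v = φ.X x (φ.coeff D x (φ.θ x v) w) := by
  rw [coeff_apply, φ.X_θ x hx, φ.X_θ x hx]

theorem smooth_coeff (hD : D.ContMDiffCovariantDerivative ∞) (u v : L) :
    ContMDiff 𝓘(ℝ, E) 𝓘(ℝ, L) ∞ (fun z => φ.coeff D z u v) :=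
  φ.smooth_coord (isSmoothField_covariantDerivative_apply D hD (φ.smooth_X v) (φ.smooth_X u))

/-- The Leibniz rule applied to the expansion of `Y` in the frame; the expansion holds only near
`x`, which suffices by locality of the connection. -/
theorem θ_covariantDerivative [FiniteDimensional ℝ L] {x : M} (hx : x ∈ U)
    {Y : (z : M) → TangentSpace 𝓘(ℝ, E) z} (hY : IsSmoothField Y) (v : TangentSpace 𝓘(ℝ, E) x) :
    φ.θ x (D Y x v) = mvfderiv 𝓘(ℝ, E) (fun z => φ.θ z (Y z)) x v +
      φ.coeff D x (φ.θ x v) (φ.θ x (Y x)) := by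
  let b := Module.finBasis ℝ L
  let ℓ := fun i => LinearMap.toContinuousLinearMap (b.coord i)
  have hs : ∀ i, ContMDiff 𝓘(ℝ, E) 𝓘(ℝ, ℝ) ∞ (fun z => ℓ i (φ.θ z (Y z))) := fun i =>
    (ℓ i).contMDiff.comp (φ.smooth_coord hY)
  have hX : ∀ i, IsSmoothFieldAt (fun z => φ.X z (b i)) x := fun i => φ.smooth_X (b i) x
  have h1 : ∀ᶠ z in 𝓝 x, Y z = ∑ i, ℓ i (φ.θ z (Y z)) • φ.X z (b i) := by
    filter_upwards [φ.eventually_mem hx] with z hz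
    conv_lhs => rw [← φ.X_θ z hz (Y z), ← b.sum_repr (φ.θ z (Y z)), map_sum]
    exact Finset.sum_congr rfl fun i _ => by rw [map_smul]; rfl
  have h2 : ∀ i, φ.θ x (D (fun z => ℓ i (φ.θ z (Y z)) • φ.X z (b i)) x v) =
      ℓ i (φ.θ x (Y x)) • φ.coeff D x (φ.θ x v) (b i) +
      ℓ i (mvfderiv 𝓘(ℝ, E) (fun z => φ.θ z (Y z)) x v) • b i := by
    intro i
    rw [covariantDerivative_smul D (hs i).contMDiffAt (hX i), φ.covariantDerivative_X D hx,
      mvfderiv_clm_comp (ℓ i) (φ.mdifferentiableAt_coord hY x), map_add, map_smul, map_smul,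
      φ.θ_X x hx, φ.θ_X x hx]
  have h3 : D Y x v = ∑ i, D (fun z => ℓ i (φ.θ z (Y z)) • φ.X z (b i)) x v := by
    rw [covariantDerivative_congr D (hY x) h1]
    have := covariantDerivative_sum D (Finset.univ) (x := x)
      (Z := fun i z => ℓ i (φ.θ z (Y z)) • φ.X z (b i))
      fun i => IsSmoothFieldAt.smul (hs i).contMDiffAt (hX i)
    have h4 := congrArg (fun A : TangentSpace 𝓘(ℝ, E) x →L[ℝ] TangentSpace 𝓘(ℝ, E) x => A v) this
    exact h4.trans (_root_.sum_apply _ _ _)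
  rw [h3, map_sum]
  simp only [h2, Finset.sum_add_distrib]
  rw [add_comm]
  congr 1
  · exact b.sum_repr _
  · conv_rhs => rw [← b.sum_repr (φ.θ x (Y x)), map_sum]
    exact Finset.sum_congr rfl fun i _ => by rw [map_smul]; rfl

/-- The frame as a linear isomorphism. -/
def equiv {x : M} (hx : x ∈ U) : TangentSpace 𝓘(ℝ, E) x ≃ₗ[ℝ] L :=
  LinearEquiv.ofLinearMap (φ.θ x) (φ.X x) (LinearMap.ext fun u => φ.θ_X x hx u)
    (LinearMap.ext fun w => φ.X_θ x hx w)

/-- The structure equation `dA + A ∧ A`, evaluated on frame fields, where the term in `c` comes from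
their bracket. -/
theorem θ_curvature [CompleteSpace E] [FiniteDimensional ℝ L]
    (hD : D.ContMDiffCovariantDerivative ∞)
    {K : (x : M) → TangentSpace 𝓘(ℝ, E) x → TangentSpace 𝓘(ℝ, E) x →
      TangentSpace 𝓘(ℝ, E) x →ₗ[ℝ] TangentSpace 𝓘(ℝ, E) x}
    (hK : ∀ X Y Z : (x : M) → TangentSpace 𝓘(ℝ, E) x,
      IsSmoothField X → IsSmoothField Y → IsSmoothField Z → ∀ x,
      K x (X x) (Y x) (Z x) =
        D (fun y => D Z y (Y y)) x (X x) - D (fun y => D Z y (X y)) x (Y x)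
          - D Z x (VectorField.mlieBracket 𝓘(ℝ, E) X Y x)) {x : M} (hx : x ∈ U) (u v w : L) :
    φ.θ x (K x (φ.X x u) (φ.X x v) (φ.X x w)) =
      mvfderiv 𝓘(ℝ, E) (fun z => φ.coeff D z v w) x (φ.X x u) -
      mvfderiv 𝓘(ℝ, E) (fun z => φ.coeff D z u w) x (φ.X x v) +
      (φ.coeff D x u (φ.coeff D x v w) - φ.coeff D x v (φ.coeff D x u w)) -
      φ.coeff D x (c u v) w := by
  have h1 : ∀ a, IsSmoothField (fun y => D (fun z => φ.X z w) y (φ.X y a)) := fun a =>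
    isSmoothField_covariantDerivative_apply D hD (φ.smooth_X w) (φ.smooth_X a)
  rw [hK _ _ _ (φ.smooth_X u) (φ.smooth_X v) (φ.smooth_X w), map_sub, map_sub,
    φ.θ_covariantDerivative D hx (h1 v), φ.θ_covariantDerivative D hx (h1 u), φ.bracket x hx]
  simp only [φ.θ_X x hx, ← coeff_apply]
  abel

end LocalFrame

end Connections

/-! ### The Chern-Ricci form through the volume density -/

section RicciFormula

variable {E : Type*} [NormedAddCommGroup E] [NormedSpace ℝ E] [CompleteSpace E]
  [FiniteDimensional ℝ E]
  {M : Type*} [TopologicalSpace M] [ChartedSpace E M] [IsManifold 𝓘(ℝ, E) ∞ M]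
  {L : Type*} [NormedAddCommGroup L] [NormedSpace ℝ L]

open VectorField

/-- The conditions on the Chern connection, without smoothness of the connection. -/
structure IsPreChern (J : EndField E M) (Ω : FormField E M)
    (D : CovariantDerivative 𝓘(ℝ, E) E (TangentSpace 𝓘(ℝ, E) : M → Type _)) : Prop where
  parallel_complex : ∀ Y : (x : M) → TangentSpace 𝓘(ℝ, E) x, IsSmoothField Y → ∀ x v,
    D (fun y => J y (Y y)) x v = J x (D Y x v)
  parallel_metric : ∀ Y Z : (x : M) → TangentSpace 𝓘(ℝ, E) x, IsSmoothField Y → IsSmoothField Z →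
    ∀ x v, mvfderiv 𝓘(ℝ, E) (fun y => Ω y (Y y) (J y (Z y))) x v =
      Ω x (D Y x v) (J x (Z x)) + Ω x (Y x) (J x (D Z x v))
  torsion : ∀ x u v, D.torsion x u v + D.torsion x (J x u) (J x v) = 0

theorem IsChernConnection.isPreChern {J : EndField E M} {Ω : FormField E M}
    {D : CovariantDerivative 𝓘(ℝ, E) E (TangentSpace 𝓘(ℝ, E) : M → Type _)}
    (h : IsChernConnection J Ω D) : IsPreChern J Ω D :=
  ⟨h.parallel_complex, h.parallel_metric, h.torsion⟩

namespace LocalFrame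

variable {J : EndField E M} {c : L →ₗ[ℝ] L →ₗ[ℝ] L} {j : L →ₗ[ℝ] L} {U : Set M}
  (φ : LocalFrame J c j U) {Ω : FormField E M}
  {D : CovariantDerivative 𝓘(ℝ, E) E (TangentSpace 𝓘(ℝ, E) : M → Type _)}

/-- A bilinear form read in a frame. -/
def formIn (Ω : FormField E M) (z : M) : L →ₗ[ℝ] L →ₗ[ℝ] ℝ :=
  LinearMap.mk₂ ℝ (fun u v => Ω z (φ.X z u) (φ.X z v))
    (fun u u' v => by simp only [map_add]; rfl)
    (fun a u v => by simp only [map_smul]; rfl)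
    (fun u v v' => by simp only [map_add])
    (fun a u v => by simp only [map_smul])

theorem formIn_apply (Ω : FormField E M) (z : M) (u v : L) :
    φ.formIn Ω z u v = Ω z (φ.X z u) (φ.X z v) := rfl

theorem smooth_formIn (hΩ : ∀ z, IsSmoothFormAt Ω z) (u v : L) :
    ContMDiff 𝓘(ℝ, E) 𝓘(ℝ, ℝ) ∞ (fun z => φ.formIn Ω z u v) := fun z =>
  contMDiffAt_form_apply (hΩ z) (φ.smooth_X u z) (φ.smooth_X v z)

theorem isHermitianForm (hj : ∀ u, j (j u) = -u) (hΩ : IsAlmostHermitian J Ω) {z : M}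
    (hz : z ∈ U) : IsHermitianForm j (φ.formIn Ω z) where
  sq := hj
  alternating u v := hΩ.alternating z _ _
  invariant u v := by
    rw [formIn_apply, ← φ.complex z hz, ← φ.complex z hz, hΩ.invariant, formIn_apply]
  positive u hu := by
    rw [formIn_apply, ← φ.complex z hz]
    refine hΩ.positive z _ fun h => hu ?_
    rw [← φ.θ_X z hz u, h, map_zero]

theorem coeff_complex (hD : IsPreChern J Ω D) {z : M} (hz : z ∈ U) (u v : L) :
    φ.coeff D z u (j v) = j (φ.coeff D z u v) := by
  rw [coeff_apply, coeff_apply, ← φ.θ_complex hz, ← hD.parallel_complex _ (φ.smooth_X v)]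
  rw [covariantDerivative_congr D (φ.smooth_X (j v) z) (Z := fun y => J y (φ.X y v))
    ((φ.eventually_mem hz).mono fun y hy => (φ.complex y hy v).symm)]

theorem coeff_torsion (hD : IsPreChern J Ω D) {z : M} (hz : z ∈ U) (u v : L) :
    φ.coeff D z u v - φ.coeff D z v u - c u v +
      (φ.coeff D z (j u) (j v) - φ.coeff D z (j v) (j u) - c (j u) (j v)) = 0 := by
  have h : ∀ u v, φ.θ z (D.torsion z (φ.X z u) (φ.X z v)) =
      φ.coeff D z u v - φ.coeff D z v u - c u v := by
    intro u v
    rw [D.torsion_apply (X := fun y => φ.X y u) (Y := fun y => φ.X y v)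
      (IsSmoothFieldAt.mdifferentiableAt (φ.smooth_X u z))
      (IsSmoothFieldAt.mdifferentiableAt (φ.smooth_X v z)), map_sub, map_sub, φ.bracket z hz,
      φ.θ_X z hz]
    rfl
  rw [← h, ← h, ← map_add, ← φ.complex z hz, ← φ.complex z hz, hD.torsion, map_zero]

theorem coeff_metric (hD : IsPreChern J Ω D) {z : M} (hz : z ∈ U) (a b v : L) :
    mvfderiv 𝓘(ℝ, E) (fun y => φ.formIn Ω y a (j b)) z (φ.X z v) =
      φ.formIn Ω z (φ.coeff D z v a) (j b) + φ.formIn Ω z a (j (φ.coeff D z v b)) := by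
  rw [mvfderiv_congr (g := fun y => Ω y (φ.X y a) (J y (φ.X y b)))
    ((φ.eventually_mem hz).mono fun y hy => by
      simp only [formIn_apply]; rw [φ.complex y hy]),
    hD.parallel_metric _ _ (φ.smooth_X a) (φ.smooth_X b), φ.covariantDerivative_X D hz,
    φ.covariantDerivative_X D hz, φ.complex z hz, φ.complex z hz, φ.θ_X z hz]
  rfl

variable [FiniteDimensional ℝ L]

/-- Metric compatibility says that the Gram matrix `G` satisfies `dG = Bᵀ G + G B`, with `B` the
matrix of the connection form, so `d log det G = 2 tr B`. The constant `r` leaves the normalization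
of the density free, so that `H` can be the volume relative to a reference. -/
theorem trace_coeff (hj : ∀ u, j (j u) = -u) (hΩ : IsAlmostHermitian J Ω) (hD : IsPreChern J Ω D)
    {ι : Type*} [Fintype ι] [DecidableEq ι] (b : Module.Basis ι ℝ L) {H : M → ℝ} {r : ℝ}
    (hH : ∀ z ∈ U, H z = Real.log (gramMatrix j (φ.formIn Ω z) b).det + r)
    {z : M} (hz : z ∈ U) (v : L) :
    LinearMap.trace ℝ L (φ.coeff D z v) = (1 / 2) * mvfderiv 𝓘(ℝ, E) H z (φ.X z v) := by
  set B := LinearMap.toMatrix b b (φ.coeff D z v) with hBdef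
  have hpos := (φ.isHermitianForm hj hΩ hz).det_gramMatrix_pos b
  have hs : ∀ i k, ContMDiffAt 𝓘(ℝ, E) 𝓘(ℝ, ℝ) ∞
      (fun z => gramMatrix j (φ.formIn Ω z) b i k) z := fun i k =>
    (φ.smooth_formIn (fun z => hΩ.smooth z) (b i) (j (b k))).contMDiffAt
  have hsum : ∀ i, φ.coeff D z v (b i) = ∑ l, B l i • b l := fun i => by
    rw [hBdef]
    simp only [LinearMap.toMatrix_apply]
    exact (b.sum_repr _).symm
  have key := mvfderiv_log_det (f := fun z => gramMatrix j (φ.formIn Ω z) b) (φ.X z v) hs hpos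
    (B := B) (fun i k => by
      refine (φ.coeff_metric hD hz (b i) (b k) v).trans ?_
      rw [hsum, hsum]
      simp only [map_sum, map_smul, LinearMap.sum_apply, LinearMap.smul_apply, smul_eq_mul,
        Matrix.add_apply, Matrix.mul_apply, Matrix.transpose_apply, gramMatrix, Matrix.of_apply]
      congr 1
      exact Finset.sum_congr rfl fun l _ => mul_comm _ _)
  have h2 : mvfderiv 𝓘(ℝ, E) H z (φ.X z v) =
      mvfderiv 𝓘(ℝ, E) (fun z => Real.log (gramMatrix j (φ.formIn Ω z) b).det) z (φ.X z v) := by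
    have hd : MDifferentiableAt 𝓘(ℝ, E) 𝓘(ℝ, ℝ)
        (fun z => Real.log (gramMatrix j (φ.formIn Ω z) b).det) z := by
      have hs' : ContMDiffAt 𝓘(ℝ, E) 𝓘(ℝ, ι → ι → ℝ) ∞
          (fun z => entries (gramMatrix j (φ.formIn Ω z) b)) z :=
        contMDiffAt_pi_space.2 fun i => contMDiffAt_pi_space.2 fun k => hs i k
      have hlog : DifferentiableAt ℝ (fun m : ι → ι → ℝ => Real.log (Matrix.of m).det)
        (entries (gramMatrix j (φ.formIn Ω z) b)) := (differentiable_det _).log hpos.ne'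
      exact hlog.mdifferentiableAt.comp z (hs'.mdifferentiableAt (by simp))
    rw [mvfderiv_congr ((φ.eventually_mem hz).mono hH), mvfderiv_fun_add hd mdifferentiableAt_const,
      mvfderiv_const, add_zero]
  rw [h2, key, LinearMap.trace_eq_matrix_trace ℝ b]
  ring

/-- The trace of `J K(X_u, X_v)` for the curvature of the Chern connection, in terms of the
structure constants of a frame and of the volume density `exp H`. -/
theorem trace_curvature (hj : ∀ u, j (j u) = -u) (hΩ : IsAlmostHermitian J Ω)
    (hD : IsChernConnection J Ω D)
    {K : (x : M) → TangentSpace 𝓘(ℝ, E) x → TangentSpace 𝓘(ℝ, E) x →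
      TangentSpace 𝓘(ℝ, E) x →ₗ[ℝ] TangentSpace 𝓘(ℝ, E) x}
    (hK : IsCurvature D K) {ι : Type*} [Fintype ι] [DecidableEq ι] (b : Module.Basis ι ℝ L)
    {H : M → ℝ} {r : ℝ} (hHs : ContMDiff 𝓘(ℝ, E) 𝓘(ℝ, ℝ) ∞ H)
    (hH : ∀ z ∈ U, H z = Real.log (gramMatrix j (φ.formIn Ω z) b).det + r)
    {x : M} (hx : x ∈ U) (u v : L) :
    LinearMap.trace ℝ (TangentSpace 𝓘(ℝ, E) x)
      ((J x : _ →ₗ[ℝ] _) ∘ₗ K x (φ.X x u) (φ.X x v)) =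
      LinearMap.trace ℝ L (chernAnti c j (j (c u v))) + (1 / 2) *
      (mvfderiv 𝓘(ℝ, E) (fun z => mvfderiv 𝓘(ℝ, E) H z (φ.X z (j v))) x (φ.X x u) -
        mvfderiv 𝓘(ℝ, E) (fun z => mvfderiv 𝓘(ℝ, E) H z (φ.X z (j u))) x (φ.X x v) -
        mvfderiv 𝓘(ℝ, E) H x (φ.X x (j (c u v)))) := by
  have hpre := hD.isPreChern
  -- the trace of `j` composed with the coefficients
  have hσ : ∀ z ∈ U, ∀ v, LinearMap.trace ℝ L (j ∘ₗ φ.coeff D z v) =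
      (1 / 2) * mvfderiv 𝓘(ℝ, E) H z (φ.X z (j v)) -
        LinearMap.trace ℝ L (chernAnti c j (j v)) := fun z hz v => by
    rw [trace_comp_eq_of_chern hj (fun u => map_neg _ u) (φ.coeff_complex hpre hz)
      (φ.coeff_torsion hpre hz), φ.trace_coeff hj hΩ hpre b hH hz]
  have hdH : ∀ v, MDifferentiableAt 𝓘(ℝ, E) 𝓘(ℝ, ℝ)
      (fun z => mvfderiv 𝓘(ℝ, E) H z (φ.X z v)) x := fun v =>
    (contMDiffAt_mvfderiv_apply hHs.contMDiffAt (φ.smooth_X v x)).mdifferentiableAt (by simp)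
  have hdσ : ∀ v w, mvfderiv 𝓘(ℝ, E) (fun z => LinearMap.trace ℝ L (j ∘ₗ φ.coeff D z v)) x w =
      (1 / 2) * mvfderiv 𝓘(ℝ, E) (fun z => mvfderiv 𝓘(ℝ, E) H z (φ.X z (j v))) x w := fun v w => by
    have hd : MDifferentiableAt 𝓘(ℝ, E) 𝓘(ℝ, ℝ)
        (fun z => (1 / 2) * mvfderiv 𝓘(ℝ, E) H z (φ.X z (j v))) x :=
      mdifferentiableAt_const.mul (hdH (j v))
    rw [mvfderiv_congr ((φ.eventually_mem hx).mono fun z hz => hσ z hz v),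
      mvfderiv_fun_sub hd mdifferentiableAt_const,
      mvfderiv_const, sub_zero, mvfderiv_fun_mul mdifferentiableAt_const (hdH (j v)),
      mvfderiv_const]
    simp
  -- reduction to the model space
  have h1 : LinearMap.trace ℝ (TangentSpace 𝓘(ℝ, E) x)
      ((J x : _ →ₗ[ℝ] _) ∘ₗ K x (φ.X x u) (φ.X x v)) = LinearMap.trace ℝ L
      (j ∘ₗ (φ.θ x ∘ₗ K x (φ.X x u) (φ.X x v) ∘ₗ φ.X x)) := by
    rw [← LinearMap.trace_conj' _ (φ.equiv hx)]
    congr 1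
    ext w
    change φ.θ x (J x (K x (φ.X x u) (φ.X x v) (φ.X x w))) = _
    rw [φ.θ_complex hx]
    rfl
  rw [h1]
  let ℓ : ι → L →L[ℝ] ℝ := fun i => LinearMap.toContinuousLinearMap (b.coord i ∘ₗ j)
  have htr : ∀ A : L →ₗ[ℝ] L, LinearMap.trace ℝ L (j ∘ₗ A) = ∑ i, ℓ i (A (b i)) := fun A => by
    rw [LinearMap.trace_eq_matrix_trace ℝ b, Matrix.trace]
    exact Finset.sum_congr rfl fun i _ => by
      rw [Matrix.diag_apply, LinearMap.toMatrix_apply]; rfl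
  have hcd : ∀ v w, MDifferentiableAt 𝓘(ℝ, E) 𝓘(ℝ, L) (fun z => φ.coeff D z v w) x := fun v w =>
    (φ.smooth_coeff D hD.smooth v w).contMDiffAt.mdifferentiableAt (by simp)
  have hdtr : ∀ v w, mvfderiv 𝓘(ℝ, E) (fun z => LinearMap.trace ℝ L (j ∘ₗ φ.coeff D z v)) x w =
      ∑ i, ℓ i (mvfderiv 𝓘(ℝ, E) (fun z => φ.coeff D z v (b i)) x w) := fun v w => by
    simp only [htr]
    rw [(mvfderiv_sum_apply Finset.univ (f := fun i z => ℓ i (φ.coeff D z v (b i)))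
      (fun i => (ℓ i).mdifferentiableAt.comp x (hcd v (b i))) w).2]
    exact Finset.sum_congr rfl fun i _ => mvfderiv_clm_comp (ℓ i) (hcd v (b i)) w
  -- The commutator term contributes nothing, because the coefficients commute with `j` and the
  -- trace is cyclic.
  have hcomm : LinearMap.trace ℝ L (j ∘ₗ (φ.coeff D x u ∘ₗ φ.coeff D x v)) =
      LinearMap.trace ℝ L (j ∘ₗ (φ.coeff D x v ∘ₗ φ.coeff D x u)) := by
    have e1 : j ∘ₗ (φ.coeff D x u ∘ₗ φ.coeff D x v) = φ.coeff D x u ∘ₗ (j ∘ₗ φ.coeff D x v) :=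
      LinearMap.ext fun w => (φ.coeff_complex hpre hx u _).symm
    rw [e1, LinearMap.trace_comp_comm', LinearMap.comp_assoc]
  rw [htr] at hcomm
  rw [htr] at hcomm
  have hcσ := hσ x hx (c u v)
  rw [htr] at hcσ
  rw [htr]
  have h2 : ∀ w, (φ.θ x ∘ₗ K x (φ.X x u) (φ.X x v) ∘ₗ φ.X x) w =
      mvfderiv 𝓘(ℝ, E) (fun z => φ.coeff D z v w) x (φ.X x u) -
      mvfderiv 𝓘(ℝ, E) (fun z => φ.coeff D z u w) x (φ.X x v) +
      (φ.coeff D x u (φ.coeff D x v w) - φ.coeff D x v (φ.coeff D x u w)) -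
      φ.coeff D x (c u v) w := φ.θ_curvature D hD.smooth hK hx u v
  simp only [h2, map_add, map_sub, Finset.sum_add_distrib, Finset.sum_sub_distrib]
  rw [← hdtr, ← hdtr, hdσ, hdσ, hcσ]
  simp only [LinearMap.comp_apply] at hcomm
  rw [hcomm]
  ring

/-- Comparison of real and imaginary parts. The imaginary part is a genuine condition: exhibiting a
real Ricci form requires showing that the curvature has zero real trace. -/
theorem _root_.AlmostComplexFlow.eq_trace_of_complexTrace {V : Type*} [AddCommGroup V] [Module ℝ V] {j A : V →ₗ[ℝ] V} {r : ℝ} :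
    (r : ℂ) = Complex.I * complexTrace j A ↔
      r = LinearMap.trace ℝ V (j ∘ₗ A) / 2 ∧ LinearMap.trace ℝ V A = 0 := by
  rw [Complex.ext_iff, complexTrace]
  simp
  constructor
  · rintro ⟨h1, h2⟩
    exact ⟨by linarith, by linarith⟩
  · rintro ⟨h1, h2⟩
    exact ⟨by linarith, by linarith⟩

/-- The Chern-Ricci form in a frame. -/
theorem ricciForm_apply (hj : ∀ u, j (j u) = -u) (hΩ : IsAlmostHermitian J Ω) {ρ : FormField E M}
    (hρ : IsChernRicciForm J Ω ρ) {ι : Type*} [Fintype ι] [DecidableEq ι] (b : Module.Basis ι ℝ L)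
    {H : M → ℝ} {r : ℝ} (hHs : ContMDiff 𝓘(ℝ, E) 𝓘(ℝ, ℝ) ∞ H)
    (hH : ∀ z ∈ U, H z = Real.log (gramMatrix j (φ.formIn Ω z) b).det + r)
    {x : M} (hx : x ∈ U) (u v : L) :
    ρ x (φ.X x u) (φ.X x v) = (1 / 2) * LinearMap.trace ℝ L (chernAnti c j (j (c u v))) + (1 / 4) *
      (mvfderiv 𝓘(ℝ, E) (fun z => mvfderiv 𝓘(ℝ, E) H z (φ.X z (j v))) x (φ.X x u) -
        mvfderiv 𝓘(ℝ, E) (fun z => mvfderiv 𝓘(ℝ, E) H z (φ.X z (j u))) x (φ.X x v) -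
        mvfderiv 𝓘(ℝ, E) H x (φ.X x (j (c u v)))) := by
  obtain ⟨D, hD, K, hK, h⟩ := hρ
  rw [(eq_trace_of_complexTrace.1 (h x (φ.X x u) (φ.X x v))).1,
    φ.trace_curvature hj hΩ hD hK b hHs hH hx]
  ring

end LocalFrame

end RicciFormula

/-! ### The product rule for bilinear maps -/

section Bilinear

variable {E : Type*} [NormedAddCommGroup E] [NormedSpace ℝ E]
  {M : Type*} [TopologicalSpace M] [ChartedSpace E M]
  {L : Type*} [NormedAddCommGroup L] [NormedSpace ℝ L] [FiniteDimensional ℝ L]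
  {F : Type*} [NormedAddCommGroup F] [NormedSpace ℝ F]

/-- A bilinear map on a finite-dimensional space as a continuous one. -/
def toContinuousBilinear (B : L →ₗ[ℝ] L →ₗ[ℝ] F) : L →L[ℝ] L →L[ℝ] F :=
  LinearMap.toContinuousLinearMap
    ((LinearMap.toContinuousLinearMap : (L →ₗ[ℝ] F) ≃ₗ[ℝ] (L →L[ℝ] F)).toLinearMap ∘ₗ B)

theorem contMDiffAt_bilinear (B : L →ₗ[ℝ] L →ₗ[ℝ] F) {f g : M → L} {x : M}
    (hf : ContMDiffAt 𝓘(ℝ, E) 𝓘(ℝ, L) ∞ f x) (hg : ContMDiffAt 𝓘(ℝ, E) 𝓘(ℝ, L) ∞ g x) :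
    ContMDiffAt 𝓘(ℝ, E) 𝓘(ℝ, F) ∞ (fun z => B (f z) (g z)) x :=
  (((toContinuousBilinear B).contMDiff.contMDiffAt.comp x hf).clm_apply hg)

theorem mvfderiv_bilinear (B : L →ₗ[ℝ] L →ₗ[ℝ] F) {f g : M → L} {x : M}
    (hf : MDifferentiableAt 𝓘(ℝ, E) 𝓘(ℝ, L) f x) (hg : MDifferentiableAt 𝓘(ℝ, E) 𝓘(ℝ, L) g x)
    (v : TangentSpace 𝓘(ℝ, E) x) :
    mvfderiv 𝓘(ℝ, E) (fun z => B (f z) (g z)) x v =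
      B (mvfderiv 𝓘(ℝ, E) f x v) (g x) + B (f x) (mvfderiv 𝓘(ℝ, E) g x v) := by
  have hb := ((toContinuousBilinear B).isBoundedBilinearMap).hasFDerivAt (f x, g x)
  have hp : MDifferentiableAt 𝓘(ℝ, E) 𝓘(ℝ, L × L) (fun z => (f z, g z)) x :=
    hf.prodMk_space hg
  refine (mvfderiv_comp_differentiableAt (f := fun z => (f z, g z)) hb.differentiableAt hp v).trans ?_
  have h1 := mvfderiv_clm_comp (ContinuousLinearMap.fst ℝ L L) hp v
  have h2 := mvfderiv_clm_comp (ContinuousLinearMap.snd ℝ L L) hp v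
  rw [hb.fderiv, IsBoundedBilinearMap.deriv_apply, add_comm]
  change B _ _ + B _ _ = _
  have h1' : (mvfderiv 𝓘(ℝ, E) (fun z => (f z, g z)) x v).1 = mvfderiv 𝓘(ℝ, E) f x v := h1.symm
  have h2' : (mvfderiv 𝓘(ℝ, E) (fun z => (f z, g z)) x v).2 = mvfderiv 𝓘(ℝ, E) g x v := h2.symm
  rw [h1', h2']

end Bilinear

/-! ### Connections with constant coefficients in a frame -/

section Existence

variable {E : Type*} [NormedAddCommGroup E] [NormedSpace ℝ E] [CompleteSpace E]
  [FiniteDimensional ℝ E]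
  {M : Type*} [TopologicalSpace M] [ChartedSpace E M] [IsManifold 𝓘(ℝ, E) ∞ M]
  {L : Type*} [NormedAddCommGroup L] [NormedSpace ℝ L] [FiniteDimensional ℝ L]

open VectorField

instance t2Space_tangentSpace (x : M) : T2Space (TangentSpace 𝓘(ℝ, E) x) :=
  inferInstanceAs (T2Space E)

namespace LocalFrame

variable {J : EndField E M} {c : L →ₗ[ℝ] L →ₗ[ℝ] L} {j : L →ₗ[ℝ] L} {U : Set M}
  (φ : LocalFrame J c j U)

/-- The axioms of a covariant derivative involve fields that are merely differentiable, while the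
frame controls coordinates of smooth ones. Testing on smooth fields makes `θ` a smooth section of a
bundle of homomorphisms, which may then be applied to a differentiable field. -/
theorem mdifferentiableAt_θ {Y : (z : M) → TangentSpace 𝓘(ℝ, E) z} {x : M}
    (hY : MDifferentiableAt 𝓘(ℝ, E) (𝓘(ℝ, E).prod 𝓘(ℝ, E))
    (fun x => (Bundle.TotalSpace.mk' E x (Y x) : TangentBundle 𝓘(ℝ, E) M)) x) :
    MDifferentiableAt 𝓘(ℝ, E) 𝓘(ℝ, L) (fun z => φ.θ z (Y z)) x := by
  have h1 := contMDiffAt_hom_of_forall_field (F := L) (V := Bundle.Trivial M L) (x := x)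
    (Φ := fun z => LinearMap.toContinuousLinearMap (φ.θ z)) fun Z hZ =>
      (Bundle.contMDiffAt_section _).2 (φ.smooth_θ Z x hZ)
  have h2 : MDifferentiableAt 𝓘(ℝ, E) (𝓘(ℝ, E).prod 𝓘(ℝ, L))
      (fun m => Bundle.TotalSpace.mk' L (E := Bundle.Trivial M L) m (φ.θ m (Y m))) x :=
    MDifferentiableAt.clm_bundle_apply (F₁ := E) (h1.mdifferentiableAt (by simp)) hY
  exact (mdifferentiableAt_totalSpace _ _ |>.1 h2).2

theorem isSmoothFieldAt_X {w : M → L} {x : M} (hw : ContMDiffAt 𝓘(ℝ, E) 𝓘(ℝ, L) ∞ w x) :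
    IsSmoothFieldAt (fun z => φ.X z (w z)) x := by
  let b := Module.finBasis ℝ L
  let ℓ := fun i => LinearMap.toContinuousLinearMap (b.coord i)
  have h1 : ∀ z, φ.X z (w z) = ∑ i, ℓ i (w z) • φ.X z (b i) := fun z => by
    conv_lhs => rw [← b.sum_repr (w z), map_sum]
    exact Finset.sum_congr rfl fun i _ => by rw [map_smul]; rfl
  refine IsSmoothFieldAt.congr (IsSmoothFieldAt.sum (s := Finset.univ)
    (X := fun i z => ℓ i (w z) • φ.X z (b i)) fun i _ => ?_) (Eventually.of_forall h1)
  exact IsSmoothFieldAt.smul ((ℓ i).contMDiff.contMDiffAt.comp x hw) (φ.smooth_X (b i) x)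

/-- The value at `z` of the connection with coefficients `Γ` in the frame. -/
def connectionAt (Γ : L →ₗ[ℝ] L →ₗ[ℝ] L) (Y : (z : M) → TangentSpace 𝓘(ℝ, E) z) (z : M) :
    TangentSpace 𝓘(ℝ, E) z →L[ℝ] TangentSpace 𝓘(ℝ, E) z :=
  LinearMap.toContinuousLinearMap (φ.X z ∘ₗ
    ((mvfderiv 𝓘(ℝ, E) (fun y => φ.θ y (Y y)) z).toLinearMap + Γ.flip (φ.θ z (Y z)) ∘ₗ φ.θ z))

theorem connectionAt_apply (Γ : L →ₗ[ℝ] L →ₗ[ℝ] L) (Y : (z : M) → TangentSpace 𝓘(ℝ, E) z) (z : M)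
    (v : TangentSpace 𝓘(ℝ, E) z) :
    φ.connectionAt Γ Y z v = φ.X z (mvfderiv 𝓘(ℝ, E) (fun y => φ.θ y (Y y)) z v +
      Γ (φ.θ z v) (φ.θ z (Y z))) := rfl

/-- A constant bilinear form in a frame. -/
def formOf (β : L →ₗ[ℝ] L →ₗ[ℝ] ℝ) (z : M) :
    TangentSpace 𝓘(ℝ, E) z →L[ℝ] TangentSpace 𝓘(ℝ, E) z →L[ℝ] ℝ :=
  LinearMap.toContinuousLinearMap
    ((LinearMap.toContinuousLinearMap :
      (TangentSpace 𝓘(ℝ, E) z →ₗ[ℝ] ℝ) ≃ₗ[ℝ] _).toLinearMap ∘ₗ β.compl₁₂ (φ.θ z) (φ.θ z))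

theorem formOf_apply (β : L →ₗ[ℝ] L →ₗ[ℝ] ℝ) (z : M) (u v : TangentSpace 𝓘(ℝ, E) z) :
    φ.formOf β z u v = β (φ.θ z u) (φ.θ z v) := rfl

end LocalFrame

/-- A covering by local frames with the same structure functions. -/
structure FrameAtlas (J : EndField E M) (c : L →ₗ[ℝ] L →ₗ[ℝ] L) (j : L →ₗ[ℝ] L) where
  U : M → Set M
  mem : ∀ x, x ∈ U x
  frame : ∀ x, LocalFrame J c j (U x)

namespace FrameAtlas

variable {J : EndField E M} {c : L →ₗ[ℝ] L →ₗ[ℝ] L} {j : L →ₗ[ℝ] L} (𝒜 : FrameAtlas J c j)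
  {Ω : FormField E M} {β : L →ₗ[ℝ] L →ₗ[ℝ] ℝ}

/-- The form `Ω` has the constant coefficients `β` in the frames of the atlas. -/
def IsConst (Ω : FormField E M) (β : L →ₗ[ℝ] L →ₗ[ℝ] ℝ) : Prop :=
  ∀ a, ∀ z ∈ 𝒜.U a, ∀ u v, Ω z ((𝒜.frame a).X z u) ((𝒜.frame a).X z v) = β u v

/-- The connection with coefficients `Γ` in the frames picked out by `S`. -/
def connection (Γ : L →ₗ[ℝ] L →ₗ[ℝ] L) (S : M → M) (hS : ∀ z, z ∈ 𝒜.U (S z)) :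
    CovariantDerivative 𝓘(ℝ, E) E (TangentSpace 𝓘(ℝ, E) : M → Type _) where
  toFun Y z := (𝒜.frame (S z)).connectionAt Γ Y z
  -- Each axiom concerns a single point `x` and is checked in the frame `S x`, so no compatibility
  -- between the frames at different points is required.
  isCovariantDerivativeOnUniv :=
    { add := by
        intro Y Z x hY hZ _
        have e : mvfderiv 𝓘(ℝ, E) (fun y => (𝒜.frame (S x)).θ y ((Y + Z) y)) x =
            mvfderiv 𝓘(ℝ, E) (fun y => (𝒜.frame (S x)).θ y (Y y)) x +
            mvfderiv 𝓘(ℝ, E) (fun y => (𝒜.frame (S x)).θ y (Z y)) x := by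
          rw [← mvfderiv_fun_add ((𝒜.frame (S x)).mdifferentiableAt_θ hY)
            ((𝒜.frame (S x)).mdifferentiableAt_θ hZ)]
          simp only [Pi.add_apply, map_add]
        ext v
        change (𝒜.frame (S x)).connectionAt Γ (Y + Z) x v =
          (𝒜.frame (S x)).connectionAt Γ Y x v + (𝒜.frame (S x)).connectionAt Γ Z x v
        have e2 : (𝒜.frame (S x)).θ x ((Y + Z) x) =
          (𝒜.frame (S x)).θ x (Y x) + (𝒜.frame (S x)).θ x (Z x) := map_add _ _ _
        rw [LocalFrame.connectionAt_apply, LocalFrame.connectionAt_apply,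
          LocalFrame.connectionAt_apply, e, e2,
          ← map_add ((𝒜.frame (S x)).X x), add_apply, map_add (Γ _)]
        congr 1
        abel
      leibniz := by
        intro Y f x hY hf _
        have e : mvfderiv 𝓘(ℝ, E) (fun y => (𝒜.frame (S x)).θ y ((f • Y) y)) x =
            f x • mvfderiv 𝓘(ℝ, E) (fun y => (𝒜.frame (S x)).θ y (Y y)) x +
            (mvfderiv 𝓘(ℝ, E) f x).smulRight ((𝒜.frame (S x)).θ x (Y x)) := by
          rw [← mvfderiv_fun_smul hf ((𝒜.frame (S x)).mdifferentiableAt_θ hY)]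
          simp only [Pi.smul_apply', map_smul]
        ext v
        change (𝒜.frame (S x)).connectionAt Γ (f • Y) x v =
          f x • (𝒜.frame (S x)).connectionAt Γ Y x v + mvfderiv 𝓘(ℝ, E) f x v • Y x
        rw [LocalFrame.connectionAt_apply, LocalFrame.connectionAt_apply, e]
        conv_rhs => rw [← (𝒜.frame (S x)).X_θ x (hS x) (Y x)]
        rw [← map_smul, ← map_smul, ← map_add, Pi.smul_apply', map_smul, map_smul,
          (𝒜.frame (S x)).θ_X x (hS x)]
        congr 1
        change f x • mvfderiv 𝓘(ℝ, E) (fun y => (𝒜.frame (S x)).θ y (Y y)) x v +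
          mvfderiv 𝓘(ℝ, E) f x v • (𝒜.frame (S x)).θ x (Y x) + _ = _
        rw [smul_add]
        abel }

theorem connection_apply (Γ : L →ₗ[ℝ] L →ₗ[ℝ] L) (S : M → M) (hS : ∀ z, z ∈ 𝒜.U (S z))
    (Y : (z : M) → TangentSpace 𝓘(ℝ, E) z) (z : M) (v : TangentSpace 𝓘(ℝ, E) z) :
    𝒜.connection Γ S hS Y z v = (𝒜.frame (S z)).X z
      (mvfderiv 𝓘(ℝ, E) (fun y => (𝒜.frame (S z)).θ y (Y y)) z v +
      Γ ((𝒜.frame (S z)).θ z v) ((𝒜.frame (S z)).θ z (Y z))) := rfl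

end FrameAtlas

end Existence

/-! ### Existence and uniqueness of the Chern connection for invariant structures -/

section ChernExistence

variable {E : Type*} [NormedAddCommGroup E] [NormedSpace ℝ E] [CompleteSpace E]
  [FiniteDimensional ℝ E]
  {M : Type*} [TopologicalSpace M] [ChartedSpace E M] [IsManifold 𝓘(ℝ, E) ∞ M]
  {L : Type*} [NormedAddCommGroup L] [NormedSpace ℝ L] [FiniteDimensional ℝ L]

open VectorField

namespace LocalFrame

variable {J : EndField E M} {c : L →ₗ[ℝ] L →ₗ[ℝ] L} {j : L →ₗ[ℝ] L} {U : Set M}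
  (φ : LocalFrame J c j U) {Ω : FormField E M}
  {D D' : CovariantDerivative 𝓘(ℝ, E) E (TangentSpace 𝓘(ℝ, E) : M → Type _)}

/-- Uniqueness of the Chern connection. -/
theorem coeff_unique (hj : ∀ u, j (j u) = -u) (hΩ : IsAlmostHermitian J Ω) (hD : IsPreChern J Ω D)
    (hD' : IsPreChern J Ω D') {z : M} (hz : z ∈ U) : φ.coeff D z = φ.coeff D' z := by
  refine sub_eq_zero.1 (LinearMap.ext₂ fun u v => ?_)
  refine eq_zero_of_chern_difference (φ.isHermitianForm hj hΩ hz) ?_ ?_ ?_ u v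
  · intro u v
    simp only [LinearMap.sub_apply, φ.coeff_complex hD hz, φ.coeff_complex hD' hz, map_sub]
  · intro u v w
    have h1 := φ.coeff_metric hD hz v w u
    rw [φ.coeff_metric hD' hz v w u] at h1
    simp only [LinearMap.sub_apply, map_sub]
    linarith
  · intro u v
    have h1 := φ.coeff_torsion hD hz u v
    rw [← φ.coeff_torsion hD' hz u v] at h1
    simp only [LinearMap.sub_apply]
    rw [← sub_eq_zero] at h1
    rw [← h1]
    abel

theorem smooth_X_θ_bilinear {B : L →ₗ[ℝ] L →ₗ[ℝ] ℝ} {Y Z : (z : M) → TangentSpace 𝓘(ℝ, E) z}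
    {x : M} (hY : IsSmoothFieldAt Y x) (hZ : IsSmoothFieldAt Z x) :
    ContMDiffAt 𝓘(ℝ, E) 𝓘(ℝ, ℝ) ∞ (fun z => B (φ.θ z (Y z)) (φ.θ z (Z z))) x :=
  contMDiffAt_bilinear B (φ.smooth_θ Y x hY) (φ.smooth_θ Z x hZ)

end LocalFrame

namespace FrameAtlas

variable {J : EndField E M} {c : L →ₗ[ℝ] L →ₗ[ℝ] L} {j : L →ₗ[ℝ] L} (𝒜 : FrameAtlas J c j)
  {Ω : FormField E M} {β : L →ₗ[ℝ] L →ₗ[ℝ] ℝ}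

variable {𝒜} in
theorem IsConst.apply (h : 𝒜.IsConst Ω β) {a z : M} (hz : z ∈ 𝒜.U a)
    (u v : TangentSpace 𝓘(ℝ, E) z) : Ω z u v = β ((𝒜.frame a).θ z u) ((𝒜.frame a).θ z v) := by
  rw [← h a z hz, (𝒜.frame a).X_θ z hz, (𝒜.frame a).X_θ z hz]

variable {𝒜} in
theorem IsConst.formIn (h : 𝒜.IsConst Ω β) {a z : M} (hz : z ∈ 𝒜.U a) :
    (𝒜.frame a).formIn Ω z = β := LinearMap.ext₂ fun u v => h a z hz u v

variable {𝒜} in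
theorem IsConst.smooth (h : 𝒜.IsConst Ω β) (x : M) : IsSmoothFormAt Ω x := by
  refine contMDiffAt_form_of_forall_field fun Y Z hY hZ => ?_
  refine ((𝒜.frame x).smooth_X_θ_bilinear (B := β) hY hZ).congr_of_eventuallyEq ?_
  filter_upwards [(𝒜.frame x).eventually_mem (𝒜.mem x)] with z hz
  exact h.apply hz _ _

theorem IsConst.ext {Ω' : FormField E M} (h : 𝒜.IsConst Ω β) (h' : 𝒜.IsConst Ω' β) : Ω = Ω' := by
  funext x
  ext u v
  rw [h.apply (𝒜.mem x), h'.apply (𝒜.mem x)]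

variable {𝒜} in
theorem IsConst.isAlmostHermitian (h : 𝒜.IsConst Ω β) (hβ : IsHermitianForm j β) :
    IsAlmostHermitian J Ω where
  smooth := h.smooth
  alternating x u v := by rw [h.apply (𝒜.mem x), h.apply (𝒜.mem x), hβ.alternating]
  invariant x u v := by
    rw [h.apply (𝒜.mem x), h.apply (𝒜.mem x), (𝒜.frame x).θ_complex (𝒜.mem x),
      (𝒜.frame x).θ_complex (𝒜.mem x), hβ.invariant]
  positive x u hu := by
    rw [h.apply (𝒜.mem x), (𝒜.frame x).θ_complex (𝒜.mem x)]
    refine hβ.positive _ fun h0 => hu ?_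
    rw [← (𝒜.frame x).X_θ x (𝒜.mem x) u, h0, map_zero]

section Connection

variable {Γ : L →ₗ[ℝ] L →ₗ[ℝ] L} {S : M → M} {hS : ∀ z, z ∈ 𝒜.U (S z)}

theorem θ_connection (Y : (z : M) → TangentSpace 𝓘(ℝ, E) z) (z : M)
    (v : TangentSpace 𝓘(ℝ, E) z) :
    (𝒜.frame (S z)).θ z (𝒜.connection Γ S hS Y z v) =
      mvfderiv 𝓘(ℝ, E) (fun y => (𝒜.frame (S z)).θ y (Y y)) z v +
      Γ ((𝒜.frame (S z)).θ z v) ((𝒜.frame (S z)).θ z (Y z)) := by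
  rw [connection_apply, (𝒜.frame (S z)).θ_X z (hS z)]

/-- `J` and `Ω` are constant in the frame, so the derivative terms match on both sides and what
remains are the three algebraic identities for `Γ`. -/
theorem isPreChern_connection (hΩ : 𝒜.IsConst Ω β) (hΓj : ∀ u v, Γ u (j v) = j (Γ u v))
    (hΓβ : ∀ u v w, β (Γ u v) (j w) = -β v (j (Γ u w)))
    (hΓt : ∀ u v, Γ u v - Γ v u - c u v + (Γ (j u) (j v) - Γ (j v) (j u) - c (j u) (j v)) = 0) :
    IsPreChern J Ω (𝒜.connection Γ S hS) where
  parallel_complex Y hY x v := by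
    set φ := 𝒜.frame (S x) with hφ
    have hx := hS x
    have hd : mvfderiv 𝓘(ℝ, E) (fun y => φ.θ y (J y (Y y))) x v =
        j (mvfderiv 𝓘(ℝ, E) (fun y => φ.θ y (Y y)) x v) := by
      rw [mvfderiv_congr ((φ.eventually_mem hx).mono fun y hy => φ.θ_complex hy (Y y))]
      exact mvfderiv_clm_comp (LinearMap.toContinuousLinearMap j) (φ.mdifferentiableAt_coord hY x) v
    rw [connection_apply, connection_apply, ← hφ, hd, φ.θ_complex hx, hΓj, ← map_add,
      φ.complex x hx]
  parallel_metric Y Z hY hZ x v := by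
    set φ := 𝒜.frame (S x) with hφ
    have hx := hS x
    rw [mvfderiv_congr (g := fun y => β.compl₂ j (φ.θ y (Y y)) (φ.θ y (Z y)))
      ((φ.eventually_mem hx).mono fun y hy => by
        simp only [LinearMap.compl₂_apply]
        rw [hΩ.apply hy, φ.θ_complex hy]),
      mvfderiv_bilinear _ (φ.mdifferentiableAt_coord hY x) (φ.mdifferentiableAt_coord hZ x),
      hΩ.apply hx, hΩ.apply hx, φ.θ_complex hx, φ.θ_complex hx, 𝒜.θ_connection, 𝒜.θ_connection]
    simp only [LinearMap.compl₂_apply, map_add, LinearMap.add_apply]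
    rw [hΓβ]
    ring
  torsion x u v := by
    set φ := 𝒜.frame (S x) with hφ
    have hx := hS x
    have h : ∀ u v, (𝒜.connection Γ S hS).torsion x (φ.X x u) (φ.X x v) =
        φ.X x (Γ u v - Γ v u - c u v) := by
      intro u v
      rw [CovariantDerivative.torsion_apply _ (X := fun y => φ.X y u) (Y := fun y => φ.X y v)
        (IsSmoothFieldAt.mdifferentiableAt (φ.smooth_X u x))
        (IsSmoothFieldAt.mdifferentiableAt (φ.smooth_X v x)), φ.bracket x hx, connection_apply,
        connection_apply, ← hφ, φ.mvfderiv_θ_X hx, φ.mvfderiv_θ_X hx, φ.θ_X x hx, φ.θ_X x hx,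
        zero_add, zero_add, map_sub, map_sub]
    rw [← φ.X_θ x hx u, ← φ.X_θ x hx v, φ.complex x hx, φ.complex x hx, h, h, ← map_add, hΓt,
      map_zero]

theorem coeff_connection {a : M} {z : M} (hz : z ∈ 𝒜.U a) (ha : S z = a) :
    (𝒜.frame a).coeff (𝒜.connection Γ S hS) z = Γ := by
  subst ha
  ext u v
  rw [LocalFrame.coeff_apply, 𝒜.θ_connection, (𝒜.frame (S z)).mvfderiv_θ_X hz,
    (𝒜.frame (S z)).θ_X z hz, (𝒜.frame (S z)).θ_X z hz, zero_add]

end Connection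

/-- The Ricci form of an invariant almost Hermitian structure, on the model space. -/
def modelRicci (c : L →ₗ[ℝ] L →ₗ[ℝ] L) (j : L →ₗ[ℝ] L) : L →ₗ[ℝ] L →ₗ[ℝ] ℝ :=
  (1 / 2 : ℝ) • c.compr₂ (LinearMap.trace ℝ L ∘ₗ chernAnti c j ∘ₗ j)

theorem modelRicci_apply (u v : L) :
    modelRicci c j u v = 1 / 2 * LinearMap.trace ℝ L (chernAnti c j (j (c u v))) := rfl

/-- The Chern-Ricci form of an invariant almost Hermitian structure is `modelRicci`. -/
theorem isConst_of_isChernRicciForm (hj : ∀ u, j (j u) = -u) (hΩ : 𝒜.IsConst Ω β)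
    (hβ : IsHermitianForm j β) {ρ : FormField E M} (hρ : IsChernRicciForm J Ω ρ) :
    𝒜.IsConst ρ (modelRicci c j) := by
  intro a z hz u v
  have hHs : ContMDiff 𝓘(ℝ, E) 𝓘(ℝ, ℝ) ∞ (fun _ : M => (0 : ℝ)) := contMDiff_const
  rw [(𝒜.frame a).ricciForm_apply hj (hΩ.isAlmostHermitian hβ) hρ (Module.finBasis ℝ L) hHs
    (r := -Real.log (gramMatrix j β (Module.finBasis ℝ L)).det)
    (fun z hz => by rw [hΩ.formIn hz, add_neg_cancel]) hz, modelRicci_apply]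
  simp [mvfderiv_const]

/-- The algebraic solution `Γ` gives a connection point by point, each point using its own frame.
Uniqueness of the Chern connection shows that it has the same coefficients `Γ` in every frame of the
atlas, throughout its domain; smoothness and the curvature formula follow from this local
description. -/
theorem exists_isChernRicciForm [Nonempty M] (hj : ∀ u, j (j u) = -u) (hΩ : 𝒜.IsConst Ω β)
    (hβ : IsHermitianForm j β) :
    ∃ ρ, IsChernRicciForm J Ω ρ := by
  obtain ⟨x₀⟩ := ‹Nonempty M›
  have hc : ∀ u v, c u v = -c v u := (𝒜.frame x₀).bracket_swap (𝒜.mem x₀)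
  obtain ⟨Γ, hΓj, hΓβ, hΓt⟩ := exists_chern_form hc hβ
  have hH := hΩ.isAlmostHermitian hβ
  set D := 𝒜.connection Γ id 𝒜.mem with hD
  have hpre : IsPreChern J Ω D := 𝒜.isPreChern_connection hΩ hΓj hΓβ hΓt
  have hcoeff : ∀ a, ∀ z ∈ 𝒜.U a, (𝒜.frame a).coeff D z = Γ := by
    classical
    intro a z hz
    -- This selection uses the single frame `a` on all of its domain. The resulting connection is
    -- also Chern, so by uniqueness it has the same coefficients as `D`.
    let S : M → M := fun y => if y ∈ 𝒜.U a then a else y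
    have hS : ∀ y, y ∈ 𝒜.U (S y) := fun y => by
      by_cases hy : y ∈ 𝒜.U a
      · simp only [S, if_pos hy]; exact hy
      · simp only [S, if_neg hy]; exact 𝒜.mem y
    rw [(𝒜.frame a).coeff_unique hj hH hpre
      (𝒜.isPreChern_connection (S := S) (hS := hS) hΩ hΓj hΓβ hΓt) hz]
    exact 𝒜.coeff_connection hz (if_pos hz)
  have happ : ∀ (Y : (z : M) → TangentSpace 𝓘(ℝ, E) z), IsSmoothField Y → ∀ a, ∀ z ∈ 𝒜.U a, ∀ v,
      (𝒜.frame a).θ z (D Y z v) = mvfderiv 𝓘(ℝ, E) (fun y => (𝒜.frame a).θ y (Y y)) z v +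
        Γ ((𝒜.frame a).θ z v) ((𝒜.frame a).θ z (Y z)) := fun Y hY a z hz v => by
    rw [(𝒜.frame a).θ_covariantDerivative D hz hY, hcoeff a z hz]
  have hsmooth : D.ContMDiffCovariantDerivative ∞ := by
    refine ⟨⟨fun {Y} hY => ?_⟩⟩
    rw [contMDiffOn_univ] at hY ⊢
    have hY' : IsSmoothField Y := hY
    intro x
    refine contMDiffAt_hom_of_forall_field (F := E)
      (V := (TangentSpace 𝓘(ℝ, E) : M → Type _)) fun Z hZ => ?_
    set φ := 𝒜.frame x with hφ
    have hsm : ContMDiffAt 𝓘(ℝ, E) 𝓘(ℝ, L) ∞ (fun z =>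
        mvfderiv 𝓘(ℝ, E) (fun y => φ.θ y (Y y)) z (Z z) + Γ (φ.θ z (Z z)) (φ.θ z (Y z))) x :=
      (contMDiffAt_mvfderiv_apply (φ.smooth_coord hY').contMDiffAt hZ).add
        (contMDiffAt_bilinear Γ (φ.smooth_θ Z x hZ) (φ.smooth_θ Y x (hY' x)))
    refine IsSmoothFieldAt.congr (φ.isSmoothFieldAt_X hsm) ?_
    filter_upwards [φ.eventually_mem (𝒜.mem x)] with z hz
    rw [← happ Y hY' x z hz, φ.X_θ z hz]
  have hChern : IsChernConnection J Ω D :=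
    ⟨hsmooth, hpre.parallel_complex, hpre.parallel_metric, hpre.torsion⟩
  -- the curvature
  let R : L → L → L →ₗ[ℝ] L := fun u v => Γ u ∘ₗ Γ v - Γ v ∘ₗ Γ u - Γ (c u v)
  let K : (x : M) → TangentSpace 𝓘(ℝ, E) x → TangentSpace 𝓘(ℝ, E) x →
      TangentSpace 𝓘(ℝ, E) x →ₗ[ℝ] TangentSpace 𝓘(ℝ, E) x := fun x u v =>
    (𝒜.frame x).X x ∘ₗ R ((𝒜.frame x).θ x u) ((𝒜.frame x).θ x v) ∘ₗ (𝒜.frame x).θ x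
  have hK : IsCurvature D K := by
    intro X Y Z hX hY hZ x
    set φ := 𝒜.frame x with hφ
    have hx := 𝒜.mem x
    have hDs : ∀ {W : (z : M) → TangentSpace 𝓘(ℝ, E) z}, IsSmoothField W →
      IsSmoothField (fun y => D Z y (W y)) := fun hW =>
        isSmoothField_covariantDerivative_apply D hsmooth hZ hW
    have hθD : ∀ {V W : (z : M) → TangentSpace 𝓘(ℝ, E) z}, IsSmoothField W →
        φ.θ x (D (fun y => D Z y (W y)) x (V x)) =
        mvfderiv 𝓘(ℝ, E) (fun z => mvfderiv 𝓘(ℝ, E) (fun y => φ.θ y (Z y)) z (W z)) x (V x) +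
        (Γ (mvfderiv 𝓘(ℝ, E) (fun y => φ.θ y (W y)) x (V x)) (φ.θ x (Z x)) +
        Γ (φ.θ x (W x)) (mvfderiv 𝓘(ℝ, E) (fun y => φ.θ y (Z y)) x (V x))) +
        Γ (φ.θ x (V x)) (mvfderiv 𝓘(ℝ, E) (fun y => φ.θ y (Z y)) x (W x) +
        Γ (φ.θ x (W x)) (φ.θ x (Z x))) := by
      intro V W hW
      have hd1 : MDifferentiableAt 𝓘(ℝ, E) 𝓘(ℝ, L)
          (fun z => mvfderiv 𝓘(ℝ, E) (fun y => φ.θ y (Z y)) z (W z)) x :=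
        (contMDiffAt_mvfderiv_apply (φ.smooth_coord hZ).contMDiffAt (hW x)).mdifferentiableAt
          (by simp)
      have hd2 : MDifferentiableAt 𝓘(ℝ, E) 𝓘(ℝ, L)
          (fun z => Γ (φ.θ z (W z)) (φ.θ z (Z z))) x :=
        (contMDiffAt_bilinear Γ (φ.smooth_θ W x (hW x)) (φ.smooth_θ Z x (hZ x))).mdifferentiableAt
          (by simp)
      rw [happ _ (hDs hW) x x hx, ← hφ, happ Z hZ x x hx, ← hφ,
        mvfderiv_congr ((φ.eventually_mem hx).mono fun z hz => happ Z hZ x z hz (W z)), ← hφ,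
        mvfderiv_fun_add hd1 hd2, add_apply,
        mvfderiv_bilinear Γ (φ.mdifferentiableAt_coord hW x) (φ.mdifferentiableAt_coord hZ x)]
    have hθ : φ.θ x (D (fun y => D Z y (Y y)) x (X x) - D (fun y => D Z y (X y)) x (Y x)
          - D Z x (VectorField.mlieBracket 𝓘(ℝ, E) X Y x)) =
        R (φ.θ x (X x)) (φ.θ x (Y x)) (φ.θ x (Z x)) := by
      rw [map_sub, map_sub, hθD hY, hθD hX, happ Z hZ x x hx, ← hφ, φ.θ_mlieBracket hx hX hY,
        ← φ.mvfderiv_mlieBracket_vector hx hX hY (φ.smooth_coord hZ)]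
      simp only [R, map_add, map_sub, LinearMap.add_apply, LinearMap.sub_apply,
        LinearMap.comp_apply]
      abel
    rw [← φ.X_θ x hx (D (fun y => D Z y (Y y)) x (X x) - D (fun y => D Z y (X y)) x (Y x)
          - D Z x (VectorField.mlieBracket 𝓘(ℝ, E) X Y x)), hθ]
    rfl
  -- the trace of the curvature
  have htrΓ : ∀ u, LinearMap.trace ℝ L (Γ u) = 0 := fun u =>
    trace_eq_zero_of_skew (metricOf j β) hβ.metric_symm hβ.positive (Γ u) fun v w => by
      rw [metricOf_apply, metricOf_apply, hΓβ]
  -- Connection forms are skew, hence traceless, and commutators are traceless; this is what makes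
  -- the Ricci form real.
  have htrR : ∀ u v, LinearMap.trace ℝ L (R u v) = 0 := fun u v => by
    simp only [R, map_sub, htrΓ, sub_zero]
    rw [LinearMap.trace_comp_comm', sub_self]
  refine ⟨fun x => (𝒜.frame x).formOf (modelRicci c j) x, D, hChern, K, hK, fun x u v => ?_⟩
  set φ := 𝒜.frame x with hφ
  have hx := 𝒜.mem x
  rw [eq_trace_of_complexTrace]
  constructor
  · have hHs : ContMDiff 𝓘(ℝ, E) 𝓘(ℝ, ℝ) ∞ (fun _ : M => (0 : ℝ)) := contMDiff_const
    have := φ.trace_curvature hj hH hChern hK (Module.finBasis ℝ L) hHs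
      (r := -Real.log (gramMatrix j β (Module.finBasis ℝ L)).det)
      (fun z hz => by rw [hΩ.formIn hz, add_neg_cancel]) hx (φ.θ x u) (φ.θ x v)
    rw [φ.X_θ x hx, φ.X_θ x hx] at this
    rw [this, φ.formOf_apply, modelRicci_apply]
    simp [mvfderiv_const]
    ring
  · have h1 : K x u v = (φ.equiv hx).symm.conj (R (φ.θ x u) (φ.θ x v)) := rfl
    rw [h1, LinearMap.trace_conj', htrR]

end FrameAtlas

end ChernExistence

/-! ### Projecting left invariant fields to frames on `M` -/

section InvariantFields
variable {E : Type*} [NormedAddCommGroup E] [NormedSpace ℝ E]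
  {G : Type*} [Group G] [TopologicalSpace G] [ChartedSpace E G] [LieGroup 𝓘(ℝ, E) ∞ G]
open Bundle in
/-- Left invariant vector fields on a smooth Lie group are smooth. -/
theorem isSmoothField_mulInvariantVectorField (v : GroupLieAlgebra 𝓘(ℝ, E) G) :
    IsSmoothField (mulInvariantVectorField v : (g : G) → TangentSpace 𝓘(ℝ, E) g) := by
  let fg : G → TangentBundle 𝓘(ℝ, E) G := fun g ↦ TotalSpace.mk' E g 0
  have sfg : ContMDiff 𝓘(ℝ, E) (𝓘(ℝ, E).prod 𝓘(ℝ, E)) ∞ fg := contMDiff_zeroSection ℝ _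
  let fv : G → TangentBundle 𝓘(ℝ, E) G := fun _ ↦ TotalSpace.mk' E 1 v
  have sfv : ContMDiff 𝓘(ℝ, E) (𝓘(ℝ, E).prod 𝓘(ℝ, E)) ∞ fv := contMDiff_const
  have S₂ : ContMDiff ((𝓘(ℝ, E).prod 𝓘(ℝ, E)).prod (𝓘(ℝ, E).prod 𝓘(ℝ, E))) _ ∞
      (equivTangentBundleProd 𝓘(ℝ, E) G 𝓘(ℝ, E) G).symm := contMDiff_equivTangentBundleProd_symm
  have S₃ : ContMDiff (𝓘(ℝ, E).prod 𝓘(ℝ, E)).tangent 𝓘(ℝ, E).tangent ∞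
      (tangentMap (𝓘(ℝ, E).prod 𝓘(ℝ, E)) 𝓘(ℝ, E) (fun p : G × G ↦ p.1 * p.2)) :=
    ContMDiff.contMDiff_tangentMap (contMDiff_mul 𝓘(ℝ, E) ∞) (by simp)
  -- The left invariant field at `g` is the derivative of the multiplication at `(g, 1)` in the
  -- direction `(0, v)`, so it is a composition of smooth maps; its base point is `g * 1` and has to
  -- be moved to `g`.
  have S := (S₃.comp S₂).comp (sfg.prodMk sfv)
  refine S.congr fun g => ?_
  have h := mfderiv_prod_eq_add_apply (I := 𝓘(ℝ, E)) (I' := 𝓘(ℝ, E)) (I'' := 𝓘(ℝ, E))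
    (f := fun p : G × G ↦ p.1 * p.2) (p := (g, 1)) (v := ((0 : E), (v : E)))
    ((contMDiff_mul 𝓘(ℝ, E) ∞).mdifferentiable (by simp) _)
  have h1 : (g * 1 : G) = g := mul_one g
  have h2 : mfderiv (𝓘(ℝ, E).prod 𝓘(ℝ, E)) 𝓘(ℝ, E) (fun p : G × G ↦ p.1 * p.2) (g, 1)
      ((0 : E), (v : E)) = (mulInvariantVectorField v g : E) := by
    refine h.trans ?_
    change mfderiv 𝓘(ℝ, E) 𝓘(ℝ, E) (fun z : G => z * 1) g (0 : E) +
      mfderiv 𝓘(ℝ, E) 𝓘(ℝ, E) (fun z : G => g * z) 1 v = _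
    exact (congrArg (fun w : TangentSpace 𝓘(ℝ, E) (g * 1) => w +
      mfderiv 𝓘(ℝ, E) 𝓘(ℝ, E) (fun z : G => g * z) 1 v)
      (map_zero (mfderiv 𝓘(ℝ, E) 𝓘(ℝ, E) (fun z : G => z * 1) g))).trans (zero_add _)
  have h3 : ∀ (a : E) {g g' : G}, g = g' →
      (TotalSpace.mk' E g a : TangentBundle 𝓘(ℝ, E) G) = TotalSpace.mk' E g' a := by
    rintro a g _ rfl
    rfl
  refine (h3 _ h1.symm).trans ?_
  change _ = TotalSpace.mk' E (g * 1) (mfderiv (𝓘(ℝ, E).prod 𝓘(ℝ, E)) 𝓘(ℝ, E)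
    (fun p : G × G ↦ p.1 * p.2) (g, 1) ((0 : E), (v : E)))
  rw [h2]

variable [CompleteSpace E] [FiniteDimensional ℝ E]
  {M : Type*} [TopologicalSpace M] [ChartedSpace E M] [IsManifold 𝓘(ℝ, E) ∞ M] [T2Space M]

open VectorField

variable (E G) in
/-- The bracket of the Lie algebra of `G`, as a bilinear map on the model space. -/
def bracketMap : E →ₗ[ℝ] E →ₗ[ℝ] E :=
  LinearMap.mk₂ ℝ (Bracket.bracket (L := GroupLieAlgebra 𝓘(ℝ, E) G) (M := GroupLieAlgebra 𝓘(ℝ, E) G))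
    (fun u u' v => add_lie (L := GroupLieAlgebra 𝓘(ℝ, E) G) (M := GroupLieAlgebra 𝓘(ℝ, E) G) u u' v)
    (fun a u v => smul_lie (L := GroupLieAlgebra 𝓘(ℝ, E) G) (M := GroupLieAlgebra 𝓘(ℝ, E) G) a u v)
    (fun u v v' => lie_add (L := GroupLieAlgebra 𝓘(ℝ, E) G) (M := GroupLieAlgebra 𝓘(ℝ, E) G) u v v')
    (fun a u v => lie_smul (L := GroupLieAlgebra 𝓘(ℝ, E) G) (M := GroupLieAlgebra 𝓘(ℝ, E) G) a u v)

/-- The image under `dπ` of the left invariant vector fields. -/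
def pushInvariant (π : G → M) (y : G) : E →ₗ[ℝ] TangentSpace 𝓘(ℝ, E) (π y) :=
  (mfderiv 𝓘(ℝ, E) 𝓘(ℝ, E) π y ∘L mfderiv 𝓘(ℝ, E) 𝓘(ℝ, E) (y * ·) 1).toLinearMap

/-- The chain rule gives a one-sided inverse, which is two-sided by finite dimension. -/
theorem inverse_mfderiv_eq_of_leftInverse {π : G → M} {s : M → G} {y : G}
    (hπ : MDifferentiableAt 𝓘(ℝ, E) 𝓘(ℝ, E) π y) (hs : MDifferentiableAt 𝓘(ℝ, E) 𝓘(ℝ, E) s (π y))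
    (h : s ∘ π =ᶠ[𝓝 y] id) :
    ((mfderiv 𝓘(ℝ, E) 𝓘(ℝ, E) s (π y) : E →L[ℝ] E).IsInvertible) ∧
    (mfderiv 𝓘(ℝ, E) 𝓘(ℝ, E) s (π y) : E →L[ℝ] E).inverse =
      (mfderiv 𝓘(ℝ, E) 𝓘(ℝ, E) π y : E →L[ℝ] E) := by
  let A : E →L[ℝ] E := mfderiv 𝓘(ℝ, E) 𝓘(ℝ, E) s (π y)
  let B : E →L[ℝ] E := mfderiv 𝓘(ℝ, E) 𝓘(ℝ, E) π y
  have hAB : A ∘L B = ContinuousLinearMap.id ℝ E :=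
    ((mfderiv_comp y hs hπ).symm.trans h.mfderiv_eq).trans mfderiv_id
  have hBA : B ∘L A = ContinuousLinearMap.id ℝ E := by
    have h1 : A.toLinearMap * B.toLinearMap = 1 :=
      LinearMap.ext fun u => congrArg (fun C : E →L[ℝ] E => C u) hAB
    have h2 := mul_eq_one_comm.1 h1
    ext u
    exact congrArg (fun C : E →ₗ[ℝ] E => C u) h2
  exact ⟨⟨ContinuousLinearEquiv.equivOfInverse A B
    (fun u => congrArg (fun C : E →L[ℝ] E => C u) hBA)
    (fun u => congrArg (fun C : E →L[ℝ] E => C u) hAB), rfl⟩,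
    ContinuousLinearMap.inverse_eq hAB hBA⟩

/-- Near `π y`, the projections of the left invariant fields extend to smooth fields. -/
theorem exists_invariant_fields {π : G → M} (hπ : IsLocalDiffeomorph 𝓘(ℝ, E) 𝓘(ℝ, E) ∞ π) (y : G) :
    ∃ (U : Set M) (X : (z : M) → E →ₗ[ℝ] TangentSpace 𝓘(ℝ, E) z),
      IsOpen U ∧ π y ∈ U ∧ (∀ u, IsSmoothField fun z => X z u) ∧
      (∀ u, X (π y) u = pushInvariant π y u) ∧
      (∀ z ∈ U, ∃ y', π y' = z ∧ ∀ u, X (π y') u = pushInvariant π y' u) ∧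
      ∀ z ∈ U, ∀ u v, mlieBracket 𝓘(ℝ, E) (fun y => X y u) (fun y => X y v) z =
        X z (bracketMap E G u v) := by
  let hf := hπ y
  let s := hf.localInverse
  have hS : s.source ∈ 𝓝 (π y) := s.open_source.mem_nhds hf.localInverse_mem_source
  obtain ⟨χ, -, hχ⟩ := (SmoothBumpFunction.nhds_basis_tsupport (I := 𝓘(ℝ, E)) (π y)).mem_iff.1 hS
  -- The invariant fields pulled back by the local inverse `s` of `π`. Pullback preserves brackets,
  -- and it is the same as pushing forward by `π`.
  let Y : (z : M) → E →ₗ[ℝ] TangentSpace 𝓘(ℝ, E) z := fun z =>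
    ((mfderiv 𝓘(ℝ, E) 𝓘(ℝ, E) s z).inverse ∘L
      mfderiv 𝓘(ℝ, E) 𝓘(ℝ, E) (s z * ·) 1).toLinearMap
  have hY : ∀ u : E, (fun z => Y z u) =
    mpullback 𝓘(ℝ, E) 𝓘(ℝ, E) s (mulInvariantVectorField (u : GroupLieAlgebra 𝓘(ℝ, E) G)) :=
    fun u => rfl
  have hsd : ∀ z ∈ s.source, ContMDiffAt 𝓘(ℝ, E) 𝓘(ℝ, E) ∞ s z := fun z hz =>
    s.contMDiffOn_toFun.contMDiffAt (s.open_source.mem_nhds hz)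
  have hπd : ∀ y', MDifferentiableAt 𝓘(ℝ, E) 𝓘(ℝ, E) π y' := fun y' =>
    (hπ.contMDiff y').mdifferentiableAt (by simp)
  have hmap : ∀ z ∈ s.source, π (s z) = z := fun z hz => hf.localInverse_right_inv hz
  have hinv : ∀ z ∈ s.source,
      (mfderiv 𝓘(ℝ, E) 𝓘(ℝ, E) s (π (s z)) : E →L[ℝ] E).IsInvertible ∧
      (mfderiv 𝓘(ℝ, E) 𝓘(ℝ, E) s (π (s z)) : E →L[ℝ] E).inverse =
      (mfderiv 𝓘(ℝ, E) 𝓘(ℝ, E) π (s z) : E →L[ℝ] E) := fun z hz =>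
    inverse_mfderiv_eq_of_leftInverse (hπd (s z))
      ((hsd (π (s z)) (by rwa [hmap z hz])).mdifferentiableAt (by simp)) (by
        filter_upwards [s.open_target.mem_nhds (s.map_source' hz)] with y' hy'
        exact hf.localInverse_left_inv hy')
  have hinv' : ∀ z ∈ s.source, (mfderiv 𝓘(ℝ, E) 𝓘(ℝ, E) s z).IsInvertible := fun z hz => by
    have := (hinv z hz).1
    rw [hmap z hz] at this
    exact this
  have hYs : ∀ u, ∀ z ∈ s.source, IsSmoothFieldAt (fun z => Y z u) z := fun u z hz =>
    ContMDiffAt.mpullback_vectorField_preimage (m := ∞) (n := ∞)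
      (isSmoothField_mulInvariantVectorField u (s z)) (hsd z hz) (hinv' z hz) (by simp)
  have hYπ : ∀ y', y' ∈ s.target → π y' ∈ s.source → ∀ u, Y (π y') u = pushInvariant π y' u := by
    intro y' hy' hz u
    have h1 : s (π y') = y' := hf.localInverse_left_inv hy'
    have h2 := (hinv (π y') hz).2
    rw [h1] at h2
    change (mfderiv 𝓘(ℝ, E) 𝓘(ℝ, E) s (π y') : E →L[ℝ] E).inverse
      (mulInvariantVectorField (u : GroupLieAlgebra 𝓘(ℝ, E) G) (s (π y'))) = _
    rw [h2]
    exact congrArg (fun g => (mfderiv 𝓘(ℝ, E) 𝓘(ℝ, E) π y' : E →L[ℝ] E)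
      (mulInvariantVectorField (u : GroupLieAlgebra 𝓘(ℝ, E) G) g : E)) h1
  have hbr : ∀ z ∈ s.source, ∀ u v, mlieBracket 𝓘(ℝ, E) (fun y => Y y u) (fun y => Y y v) z =
        Y z (bracketMap E G u v) := by
    intro z hz
    have key : ∀ u v : GroupLieAlgebra 𝓘(ℝ, E) G, mlieBracket 𝓘(ℝ, E)
        (mpullback 𝓘(ℝ, E) 𝓘(ℝ, E) s (mulInvariantVectorField u))
        (mpullback 𝓘(ℝ, E) 𝓘(ℝ, E) s (mulInvariantVectorField v)) z =
        mpullback 𝓘(ℝ, E) 𝓘(ℝ, E) s (mulInvariantVectorField ⁅u, v⁆) z := by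
      intro u v
      rw [← mpullback_mlieBracket (n := ∞)
        (mdifferentiableAt_mulInvariantVectorField _) (mdifferentiableAt_mulInvariantVectorField _)
        (hsd z hz) (by simpa using ENat.LEInfty.out), ← mulInvariantVector_mlieBracket]
      rfl
    exact key
  -- The bump function extends the fields by zero to all of `M`. The interior is taken so that the
  -- cutoff equals `1` near each point of `U`, where it then does not affect brackets.
  let U : Set M := s.source ∩ interior {z | χ z = 1}
  have hU : ∀ z ∈ U, ∀ᶠ z' in 𝓝 z, χ z' = 1 := fun z hz => mem_interior_iff_mem_nhds.1 hz.2
  have h1 : ∀ z ∈ U, ∀ u, χ z • Y z u = Y z u := fun z hz u => by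
    rw [(hU z hz).self_of_nhds, one_smul]
  have hy : π y ∈ U := ⟨hf.localInverse_mem_source,
    mem_interior_iff_mem_nhds.2 χ.eventuallyEq_one⟩
  refine ⟨U, fun z => χ z • Y z, s.open_source.inter isOpen_interior, hy, fun u z => ?_,
    fun u => ?_, fun z hz => ?_, fun z hz u v => ?_⟩
  · by_cases hz : z ∈ tsupport χ
    · exact IsSmoothFieldAt.smul (f := χ) χ.contMDiffAt (hYs u z (hχ hz))
    · refine IsSmoothFieldAt.congr (X := fun z => 0) (Bundle.contMDiff_zeroSection ℝ _ z) ?_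
      filter_upwards [(isClosed_tsupport χ).isOpen_compl.mem_nhds hz] with z' hz'
      rw [LinearMap.smul_apply, image_eq_zero_of_notMem_tsupport hz', zero_smul]
  · rw [LinearMap.smul_apply, h1 _ hy]
    exact hYπ y hf.localInverse_mem_target hf.localInverse_mem_source u
  · refine ⟨s z, hmap z hz.1, fun u => ?_⟩
    rw [LinearMap.smul_apply, h1 _ (by rwa [hmap z hz.1])]
    exact hYπ (s z) (s.map_source' hz.1) (by rw [hmap z hz.1]; exact hz.1) u
  · rw [LinearMap.smul_apply, h1 z hz, ← hbr z hz.1 u v]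
    refine EventuallyEq.mlieBracket_vectorField_eq ?_ ?_
    · filter_upwards [hU z hz] with z' hz'
      rw [LinearMap.smul_apply, hz', one_smul]
    · filter_upwards [hU z hz] with z' hz'
      rw [LinearMap.smul_apply, hz', one_smul]

theorem pushInvariant_injective {π : G → M} (hπ : IsLocalDiffeomorph 𝓘(ℝ, E) 𝓘(ℝ, E) ∞ π) (y : G) :
    Function.Injective (pushInvariant (E := E) π y) := by
  have h1 : Function.Injective (mfderiv 𝓘(ℝ, E) 𝓘(ℝ, E) π y) :=
    (hπ.mfderivToContinuousLinearEquiv (by simp) y).injective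
  have h2 : Function.Injective (mfderiv 𝓘(ℝ, E) 𝓘(ℝ, E) (y * ·) (1 : G)) := by
    have h3 : (fun x : G => y⁻¹ * x) ∘ (fun x => y * x) = id := by ext x; simp
    have h4 := mfderiv_comp (I := 𝓘(ℝ, E)) (I' := 𝓘(ℝ, E)) (I'' := 𝓘(ℝ, E)) (1 : G)
      ((contMDiff_mul_left (I := 𝓘(ℝ, E)) (n := ∞) (a := y⁻¹) (y * 1)).mdifferentiableAt (by simp))
      ((contMDiff_mul_left (I := 𝓘(ℝ, E)) (n := ∞) (a := y) 1).mdifferentiableAt (by simp))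
    rw [h3, mfderiv_id] at h4
    intro u v huv
    have h5 := congrArg (mfderiv 𝓘(ℝ, E) 𝓘(ℝ, E) (y⁻¹ * ·) (y * 1)) huv
    change (mfderiv 𝓘(ℝ, E) 𝓘(ℝ, E) (y⁻¹ * ·) (y * 1) ∘L mfderiv 𝓘(ℝ, E) 𝓘(ℝ, E) (y * ·) 1) u =
      (mfderiv 𝓘(ℝ, E) 𝓘(ℝ, E) (y⁻¹ * ·) (y * 1) ∘L mfderiv 𝓘(ℝ, E) 𝓘(ℝ, E) (y * ·) 1) v at h5
    rw [← h4] at h5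
    exact h5
  exact fun u v huv => h2 (h1 huv)

/-- `Ω` has constant coefficients on the left invariant fields. -/
def IsInvariantForm (π : G → M) (Ω : FormField E M) (β : E →ₗ[ℝ] E →ₗ[ℝ] ℝ) : Prop :=
  ∀ y u v, Ω (π y) (pushInvariant π y u) (pushInvariant π y v) = β u v

variable {J : EndField E M} {Ω₀ : FormField E M} {π : G → M}
  {j : E →ₗ[ℝ] E} {β : E →ₗ[ℝ] E →ₗ[ℝ] ℝ}

theorem IsInvariantForm.isHermitianForm (hJ : IsAlmostComplexStructure J)
    (hΩ₀ : IsAlmostHermitian J Ω₀) (hπ : IsLocalDiffeomorph 𝓘(ℝ, E) 𝓘(ℝ, E) ∞ π)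
    (hj : ∀ y u, J (π y) (pushInvariant π y u) = pushInvariant π y (j u))
    (hβ : IsInvariantForm π Ω₀ β) : IsHermitianForm j β where
  sq u := pushInvariant_injective hπ 1 (by rw [← hj, ← hj, hJ.sq, map_neg])
  alternating u v := by rw [← hβ 1, ← hβ 1, hΩ₀.alternating]
  invariant u v := by rw [← hβ 1, ← hβ 1, ← hj, ← hj, hΩ₀.invariant]
  positive u hu := by
    rw [← hβ 1, ← hj]
    exact hΩ₀.positive _ _ fun h => hu (pushInvariant_injective hπ 1 (h.trans (map_zero _).symm))

/-- The cut-off fields need not be independent away from `U`, so the coframe is not taken as their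
inverse. It is defined by pairing with the fields through the metric of `Ω₀`, which makes sense and
is smooth on all of `M`, and inverts the frame over `U` because the basis is orthonormal. -/
theorem exists_localFrame (hJ : IsAlmostComplexStructure J)
    (hΩ₀ : IsAlmostHermitian J Ω₀) (hπ : IsLocalDiffeomorph 𝓘(ℝ, E) 𝓘(ℝ, E) ∞ π)
    (hj : ∀ y u, J (π y) (pushInvariant π y u) = pushInvariant π y (j u))
    (hβ : IsInvariantForm π Ω₀ β) (y : G) :
    ∃ (U : Set M) (φ : LocalFrame J (bracketMap E G) j U), π y ∈ U ∧
      (∀ u, φ.X (π y) u = pushInvariant π y u) ∧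
      ∀ z ∈ U, ∃ y', π y' = z ∧ ∀ u, φ.X (π y') u = pushInvariant π y' u := by
  obtain ⟨U, X, hU, hyU, hXs, hXy, hXπ, hXb⟩ := exists_invariant_fields hπ y
  have hH := hβ.isHermitianForm hJ hΩ₀ hπ hj
  obtain ⟨e, -, he, -⟩ := exists_orthonormal_diagonal_basis rfl (metricOf j β) (metricOf j β)
    hH.metric_symm (fun u hu => hH.positive u hu) hH.metric_symm
  let θ : (z : M) → TangentSpace 𝓘(ℝ, E) z →ₗ[ℝ] E := fun z =>
    { toFun := fun w => ∑ i, Ω₀ z w (J z (X z (e i))) • e i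
      map_add' := fun w w' => by
        simp only [map_add, add_apply, add_smul, Finset.sum_add_distrib]
      map_smul' := fun a w => by
        simp only [map_smul, smul_apply, smul_eq_mul, mul_smul, Finset.smul_sum, RingHom.id_apply] }
  have hθ : ∀ z w, θ z w = ∑ i, Ω₀ z w (J z (X z (e i))) • e i := fun z w => rfl
  have hθX : ∀ z ∈ U, ∀ u, θ z (X z u) = u := by
    intro z hz u
    obtain ⟨y', rfl, hy'⟩ := hXπ z hz
    rw [hθ]
    conv_rhs => rw [← e.sum_repr u]
    refine Finset.sum_congr rfl fun i _ => ?_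
    rw [hy', hy', hj, hβ, repr_eq_of_orthonormal _ e he, metricOf_apply]
  have hXθ : ∀ z ∈ U, ∀ w, X z (θ z w) = w := by
    intro z hz w
    have hinj : Function.Injective (X z) := Function.LeftInverse.injective (hθX z hz)
    have hsurj : Function.Surjective (X z) :=
      LinearMap.surjective_of_injective (V := E) (f := (X z : E →ₗ[ℝ] E)) hinj
    obtain ⟨u, rfl⟩ := hsurj w
    rw [hθX z hz]
  refine ⟨U, ⟨X, θ, hU, hXs, fun Y x hY => ?_, hθX, hXθ, hXb, fun z hz u => ?_⟩, hyU, hXy, hXπ⟩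
  · simp only [hθ]
    refine ContMDiffAt.sum fun i _ => ?_
    exact (contMDiffAt_form_apply (hΩ₀.smooth x) hY
      (isSmoothFieldAt_end_apply (hJ.smooth x) (hXs (e i) x))).smul contMDiffAt_const
  · obtain ⟨y', rfl, hy'⟩ := hXπ z hz
    rw [hy', hy', hj]

/-- A covering by local frames projected from the left invariant frame, one of them centred at a
given point of `G`. -/
theorem exists_frameAtlas (hJ : IsAlmostComplexStructure J)
    (hΩ₀ : IsAlmostHermitian J Ω₀) (hπ : IsLocalDiffeomorph 𝓘(ℝ, E) 𝓘(ℝ, E) ∞ π)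
    (hπs : Function.Surjective π)
    (hj : ∀ y u, J (π y) (pushInvariant π y u) = pushInvariant π y (j u))
    (hβ : IsInvariantForm π Ω₀ β) (y₀ : G) :
    ∃ 𝒜 : FrameAtlas J (bracketMap E G) j,
      (∀ u, (𝒜.frame (π y₀)).X (π y₀) u = pushInvariant π y₀ u) ∧
      ∀ (Ω : FormField E M) (β' : E →ₗ[ℝ] E →ₗ[ℝ] ℝ), IsInvariantForm π Ω β' → 𝒜.IsConst Ω β' := by
  classical
  -- Different preimages of a point may give different frames there; the implication forces the
  -- frame chosen at `π y₀` to be the one projected from `y₀`.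
  have key : ∀ x, ∃ (U : Set M) (φ : LocalFrame J (bracketMap E G) j U), x ∈ U ∧
      (x = π y₀ → ∀ u, φ.X (π y₀) u = pushInvariant π y₀ u) ∧
      ∀ z ∈ U, ∃ y', π y' = z ∧ ∀ u, φ.X (π y') u = pushInvariant π y' u := by
    intro x
    by_cases hx : x = π y₀
    · obtain ⟨U, φ, h1, h2, h3⟩ := exists_localFrame hJ hΩ₀ hπ hj hβ y₀
      exact ⟨U, φ, hx ▸ h1, fun _ => h2, h3⟩
    · obtain ⟨y, rfl⟩ := hπs x
      obtain ⟨U, φ, h1, h2, h3⟩ := exists_localFrame hJ hΩ₀ hπ hj hβ y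
      exact ⟨U, φ, h1, fun h => absurd h hx, h3⟩
  choose U φ h1 h2 h3 using key
  refine ⟨⟨U, h1, φ⟩, h2 _ rfl, fun Ω β' hΩ a z hz u v => ?_⟩
  obtain ⟨y', rfl, hy'⟩ := h3 a z hz
  change Ω _ ((φ a).X _ u) ((φ a).X _ v) = _
  rw [hy', hy', hΩ]

end InvariantFields

/-! ### Extrema of time integrals and a maximum principle -/

section MaximumPrinciple

theorem hasDerivAt_integral_of_continuousOn {k k' : ℝ → ℝ → ℝ} {t ε₀ r : ℝ} (ht : 0 ≤ t)
    (hr : 0 < r) (hk : ∀ ε ∈ Metric.closedBall ε₀ r, ContinuousOn (fun s => k s ε) (Icc 0 t))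
    (hk' : ContinuousOn (Function.uncurry k') (Icc 0 t ×ˢ Metric.closedBall ε₀ r))
    (hd : ∀ s ∈ Icc 0 t, ∀ ε ∈ Metric.closedBall ε₀ r, HasDerivAt (k s) (k' s ε) ε) :
    HasDerivAt (fun ε => ∫ s in (0 : ℝ)..t, k s ε) (∫ s in (0 : ℝ)..t, k' s ε₀) ε₀ := by
  obtain ⟨C, hC⟩ := (isCompact_Icc.prod (isCompact_closedBall ε₀ r)).exists_bound_of_continuousOn hk'
  have hsub : uIoc 0 t ⊆ Icc 0 t := by
    rw [uIoc_of_le ht]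
    exact Ioc_subset_Icc_self
  have hmeas : ∀ {f : ℝ → ℝ}, ContinuousOn f (Icc 0 t) →
      MeasureTheory.AEStronglyMeasurable f (MeasureTheory.volume.restrict (uIoc 0 t)) := fun hf =>
    (hf.mono hsub).aestronglyMeasurable measurableSet_uIoc
  have hmem : ε₀ ∈ Metric.closedBall ε₀ r := Metric.mem_closedBall_self hr.le
  refine (intervalIntegral.hasDerivAt_integral_of_dominated_loc_of_deriv_le
    (F := fun ε s => k s ε) (F' := fun ε s => k' s ε) (bound := fun _ => C)
    (Metric.closedBall_mem_nhds ε₀ hr) ?_ ?_ ?_ ?_ intervalIntegrable_const ?_).2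
  · filter_upwards [Metric.closedBall_mem_nhds ε₀ hr] with ε hε using hmeas (hk ε hε)
  · exact (hk ε₀ hmem).intervalIntegrable_of_Icc ht
  · exact hmeas (hk'.comp (f := fun s => (s, ε₀)) (by fun_prop) fun s hs => ⟨hs, hmem⟩)
  · exact Eventually.of_forall fun s hs ε hε => hC (s, ε) ⟨hsub hs, hε⟩
  · exact Eventually.of_forall fun s hs ε hε => hd s (hsub hs) ε hε

/-- A smooth function with a local maximum has nonpositive second derivative. -/
theorem deriv_eq_zero_and_nonpos_of_isLocalMax {f f' : ℝ → ℝ} {f'' x : ℝ} (hmax : IsLocalMax f x)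
    (hf : ∀ᶠ y in 𝓝 x, HasDerivAt f (f' y) y) (hf' : HasDerivAt f' f'' x) :
    f' x = 0 ∧ f'' ≤ 0 := by
  have h0 : f' x = 0 := hmax.hasDerivAt_eq_zero hf.self_of_nhds
  refine ⟨h0, ?_⟩
  -- If `f'' > 0` the point is also a local minimum, so `f` is locally constant and `f''` vanishes
  -- after all.
  by_contra! hpos
  have hd : deriv f =ᶠ[𝓝 x] f' := hf.mono fun y hy => hy.deriv
  have hdd : deriv (deriv f) x = f'' := by rw [hd.deriv_eq, hf'.deriv]
  have hmin := isLocalMin_of_deriv_deriv_pos (f := f) (x₀ := x) (by rw [hdd]; exact hpos)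
    (by rw [hd.self_of_nhds, h0]) hf.self_of_nhds.continuousAt
  have hc : f =ᶠ[𝓝 x] fun _ => f x := by
    filter_upwards [hmin, hmax] with y h1 h2 using le_antisymm h2 h1
  have hd0 : deriv f =ᶠ[𝓝 x] fun _ => 0 := by
    filter_upwards [hc.eventuallyEq_nhds] with y hy
    rw [hy.deriv_eq, deriv_const]
  rw [hd0.deriv_eq, deriv_const] at hdd
  exact hpos.ne hdd

variable {E : Type*} [NormedAddCommGroup E] [NormedSpace ℝ E]
  {M : Type*} [TopologicalSpace M] [ChartedSpace E M] [IsManifold 𝓘(ℝ, E) ∞ M]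

theorem hasDerivAt_comp_integralCurve {f : M → ℝ} {Y : (z : M) → TangentSpace 𝓘(ℝ, E) z}
    {γ : ℝ → M} {ε : ℝ} (hf : ContMDiff 𝓘(ℝ, E) 𝓘(ℝ, ℝ) ∞ f)
    (hγ : HasMFDerivAt 𝓘(ℝ, ℝ) 𝓘(ℝ, E) γ ε ((1 : ℝ →L[ℝ] ℝ).smulRight (Y (γ ε)))) :
    HasDerivAt (fun ε => f (γ ε)) (mvfderiv 𝓘(ℝ, E) f (γ ε) (Y (γ ε))) ε := by
  have h1 := (hf.contMDiffAt.mdifferentiableAt (x := γ ε) (by simp)).hasMFDerivAt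
  let A : E →L[ℝ] ℝ := mfderiv 𝓘(ℝ, E) 𝓘(ℝ, ℝ) f (γ ε)
  let w : E := Y (γ ε)
  let B : ℝ →L[ℝ] E := (1 : ℝ →L[ℝ] ℝ).smulRight w
  have h2 : HasMFDerivAt 𝓘(ℝ, ℝ) 𝓘(ℝ, ℝ) (fun ε => f (γ ε)) ε (A ∘L B) := h1.comp ε hγ
  have h3 : HasFDerivAt (fun ε => f (γ ε)) (A ∘L B) ε := hasMFDerivAt_iff_hasFDerivAt.1 h2
  refine h3.hasDerivAt.congr_deriv ?_
  change A ((1 : ℝ) • w) = A w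
  rw [one_smul]

theorem contMDiff_slice {K : ℝ → M → ℝ} {I : Set ℝ}
    (hK : ContMDiffOn (𝓘(ℝ, ℝ).prod 𝓘(ℝ, E)) 𝓘(ℝ, ℝ) ∞ (Function.uncurry K) (I ×ˢ univ))
    {s : ℝ} (hs : s ∈ I) : ContMDiff 𝓘(ℝ, E) 𝓘(ℝ, ℝ) ∞ (K s) := by
  rw [← contMDiffOn_univ]
  exact hK.comp (f := fun x : M => (s, x)) (contMDiff_const.prodMk contMDiff_id).contMDiffOn
    fun x _ => ⟨hs, mem_univ _⟩

/-- Differentiation under the integral sign along an integral curve. -/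
theorem hasDerivAt_integral_integralCurve {K : ℝ → M → ℝ} {I : Set ℝ} {t : ℝ} (ht : 0 ≤ t)
    (hI : Icc 0 t ⊆ I)
    (hK : ContMDiffOn (𝓘(ℝ, ℝ).prod 𝓘(ℝ, E)) 𝓘(ℝ, ℝ) ∞ (Function.uncurry K) (I ×ˢ univ))
    {Y : (z : M) → TangentSpace 𝓘(ℝ, E) z} (hY : IsSmoothField Y) {γ : ℝ → M} {ε₀ : ℝ}
    (hγ : IsMIntegralCurveAt γ Y ε₀) :
    HasDerivAt (fun ε => ∫ s in (0 : ℝ)..t, K s (γ ε))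
      (∫ s in (0 : ℝ)..t, mvfderiv 𝓘(ℝ, E) (K s) (γ ε₀) (Y (γ ε₀))) ε₀ := by
  obtain ⟨r, hr, hγr⟩ := (Metric.nhds_basis_closedBall.eventually_iff).1 hγ
  have hγc : ContinuousOn γ (Metric.closedBall ε₀ r) := fun ε hε =>
    (hγr hε).continuousAt.continuousWithinAt
  have hK' := contMDiffOn_mvfderiv_apply hK hY
  refine hasDerivAt_integral_of_continuousOn (k := fun s ε => K s (γ ε))
    (k' := fun s ε => mvfderiv 𝓘(ℝ, E) (K s) (γ ε) (Y (γ ε))) ht hr (fun ε _ => ?_) ?_ ?_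
  · exact hK.continuousOn.comp (f := fun s => (s, γ ε)) (by fun_prop)
      fun s hs => ⟨hI hs, mem_univ _⟩
  · refine hK'.continuousOn.comp (f := fun q : ℝ × ℝ => (q.1, γ q.2)) ?_
      fun q hq => ⟨hI hq.1, mem_univ _⟩
    exact continuousOn_fst.prodMk (hγc.comp continuousOn_snd fun q hq => hq.2)
  · exact fun s hs ε hε => hasDerivAt_comp_integralCurve (contMDiff_slice hK (hI hs)) (hγr hε)

/-- At a maximum of a time integral, its derivative along a field vanishes and the second derivative
is nonpositive. -/
theorem integral_mvfderiv_of_isMax [CompleteSpace E] {K : ℝ → M → ℝ} {I : Set ℝ} {t : ℝ} (ht : 0 ≤ t)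
    (hI : Icc 0 t ⊆ I)
    (hK : ContMDiffOn (𝓘(ℝ, ℝ).prod 𝓘(ℝ, E)) 𝓘(ℝ, ℝ) ∞ (Function.uncurry K) (I ×ˢ univ))
    {Y : (z : M) → TangentSpace 𝓘(ℝ, E) z} (hY : IsSmoothField Y) {x : M}
    (hx : ∀ y, ∫ s in (0 : ℝ)..t, K s y ≤ ∫ s in (0 : ℝ)..t, K s x) :
    ∫ s in (0 : ℝ)..t, mvfderiv 𝓘(ℝ, E) (K s) x (Y x) = 0 ∧
    ∫ s in (0 : ℝ)..t, mvfderiv 𝓘(ℝ, E)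
      (fun z => mvfderiv 𝓘(ℝ, E) (K s) z (Y z)) x (Y x) ≤ 0 := by
  have : IsManifold 𝓘(ℝ, E) 1 M := IsManifold.of_le (n := ∞) (by simp)
  -- Along the integral curve of `Y` through `x`, the ordinary derivatives of the time integral are
  -- the integrals of `Y K` and `Y Y K`; this reduces the claim to one variable.
  obtain ⟨γ, rfl, hγ⟩ := exists_isMIntegralCurveAt_of_contMDiffAt_boundaryless (I := 𝓘(ℝ, E)) (t₀ := 0)
    (v := Y) (x₀ := x) (ContMDiffAt.of_le (n := ∞) (hY x) (by simp))
  refine deriv_eq_zero_and_nonpos_of_isLocalMax (f := fun ε => ∫ s in (0 : ℝ)..t, K s (γ ε))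
    (f' := fun ε => ∫ s in (0 : ℝ)..t, mvfderiv 𝓘(ℝ, E) (K s) (γ ε) (Y (γ ε)))
    (Eventually.of_forall fun ε => hx (γ ε)) ?_
    (hasDerivAt_integral_integralCurve ht hI (contMDiffOn_mvfderiv_apply hK hY) hY hγ)
  filter_upwards [hγ.eventually_nhds] with ε hε
  exact hasDerivAt_integral_integralCurve ht hI hK hY hε

/-- A maximum principle. -/
theorem integral_nonpos_of_isMax [CompactSpace M] [T2Space M] {F : ℝ → M → ℝ} {t₁ : ℝ}
    (hF : ContinuousOn (Function.uncurry F) (Icc 0 t₁ ×ˢ univ))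
    (h : ∀ t ∈ Icc 0 t₁, ∀ x, (∀ y, ∫ s in (0 : ℝ)..t, F s y ≤ ∫ s in (0 : ℝ)..t, F s x) →
      F t x ≤ 0) {t : ℝ} (ht : t ∈ Icc 0 t₁) (x : M) : ∫ s in (0 : ℝ)..t, F s x ≤ 0 := by
  have ht₁ : 0 ≤ t₁ := ht.1.trans ht.2
  -- Constant extension in time makes the integrand continuous for all times, so the integral is
  -- differentiable from both sides even at `t₁`.
  let F' : ℝ → M → ℝ := fun s y => F (projIcc 0 t₁ ht₁ s) y
  have hF' : Continuous (Function.uncurry F') :=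
    hF.comp_continuous (f := fun q : ℝ × M => ((projIcc 0 t₁ ht₁ q.1 : ℝ), q.2))
      (((continuous_subtype_val.comp continuous_projIcc).comp continuous_fst).prodMk continuous_snd)
      fun q => ⟨(projIcc 0 t₁ ht₁ q.1).2, mem_univ _⟩
  have hFF' : ∀ s ∈ Icc 0 t₁, ∀ y, F' s y = F s y := fun s hs y => by
    simp only [F', projIcc_of_mem ht₁ hs]
  have hint : ∀ s ∈ Icc 0 t₁, ∀ y, ∫ r in (0 : ℝ)..s, F r y = ∫ r in (0 : ℝ)..s, F' r y :=
    fun s hs y => intervalIntegral.integral_congr fun r hr => by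
      rw [uIcc_of_le hs.1] at hr
      exact (hFF' r ⟨hr.1, hr.2.trans hs.2⟩ y).symm
  have hψ : Continuous fun q : ℝ × M => ∫ r in (0 : ℝ)..q.1, F' r q.2 :=
    intervalIntegral.continuous_parametric_intervalIntegral_of_continuous
      (f := fun (q : ℝ × M) r => F' r q.2)
      (hF'.comp (continuous_snd.prodMk (continuous_snd.comp continuous_fst))) continuous_fst
  -- Subtracting `ε t` makes the sign strict. At a space-time maximum with `t₀ > 0` the time
  -- derivative is at most `-ε`, since `x₀` is a spatial maximum at time `t₀`; but the slopes from
  -- the left are nonnegative.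
  have key : ∀ ε : ℝ, 0 < ε → (∫ r in (0 : ℝ)..t, F' r x) - ε * t ≤ 0 := by
    intro ε hε
    have hφ : ContinuousOn (fun q : ℝ × M => (∫ r in (0 : ℝ)..q.1, F' r q.2) - ε * q.1)
        (Icc 0 t₁ ×ˢ univ) :=
      (hψ.sub (continuous_const.mul continuous_fst)).continuousOn
    obtain ⟨⟨t₀, x₀⟩, ⟨ht₀, -⟩, hmax⟩ := (isCompact_Icc.prod isCompact_univ).exists_isMaxOn
      ⟨(t, x), ht, mem_univ _⟩ hφ
    have hmax' : ∀ s ∈ Icc 0 t₁, ∀ y, (∫ r in (0 : ℝ)..s, F' r y) - ε * s ≤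
        (∫ r in (0 : ℝ)..t₀, F' r x₀) - ε * t₀ := fun s hs y =>
      hmax (show (s, y) ∈ Icc 0 t₁ ×ˢ univ from ⟨hs, mem_univ _⟩)
    refine (hmax' t ht x).trans ?_
    rcases ht₀.1.eq_or_lt with h0 | h0
    · have h0' : t₀ = 0 := h0.symm
      simp [h0']
    exfalso
    have hF0 : F t₀ x₀ ≤ 0 := h t₀ ht₀ x₀ fun y => by
      rw [hint t₀ ht₀, hint t₀ ht₀]
      linarith [hmax' t₀ ht₀ y]
    have hc : Continuous fun r => F' r x₀ := hF'.comp (continuous_id.prodMk continuous_const)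
    have hd : HasDerivAt (fun s => (∫ r in (0 : ℝ)..s, F' r x₀) - ε * s) (F t₀ x₀ - ε) t₀ := by
      rw [← hFF' t₀ ht₀]
      have h1 := intervalIntegral.integral_hasDerivAt_right (hc.intervalIntegrable 0 t₀)
        hc.stronglyMeasurable.stronglyMeasurableAtFilter hc.continuousAt
      simpa using h1.fun_sub ((hasDerivAt_id t₀).const_mul ε)
    have hs := hd.tendsto_slope.mono_left
      (nhdsWithin_mono t₀ (fun s (hs : s ∈ Iio t₀) => (hs : s < t₀).ne))
    have := ge_of_tendsto (b := (0 : ℝ)) hs (by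
      filter_upwards [Ioo_mem_nhdsLT h0] with s hs
      rw [slope_def_field]
      exact div_nonneg_of_nonpos
        (sub_nonpos.2 (hmax' s ⟨hs.1.le, hs.2.le.trans ht₀.2⟩ x₀)) (sub_nonpos.2 hs.2.le))
    linarith
  rw [hint t ht]
  by_contra! hpos
  rcases ht.1.eq_or_lt with h0 | h0
  · simp [← h0] at hpos
  -- This `ε` removes only half of the supposed positive value.
  have := key ((∫ r in (0 : ℝ)..t, F' r x) / (2 * t)) (by positivity)
  have h3 : (∫ r in (0 : ℝ)..t, F' r x) / (2 * t) * t = (∫ r in (0 : ℝ)..t, F' r x) / 2 := by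
    field_simp
  linarith

end MaximumPrinciple

/-! ### Uniqueness of the flow among all smooth solutions -/

section FlowUniqueness

variable {E : Type*} [NormedAddCommGroup E] [NormedSpace ℝ E]
  {M : Type*} [TopologicalSpace M] [ChartedSpace E M] [IsManifold 𝓘(ℝ, E) ∞ M]
  {L : Type*} [NormedAddCommGroup L] [NormedSpace ℝ L] [FiniteDimensional ℝ L]

theorem contMDiffWithinAt_log_det
    {E' : Type*} [NormedAddCommGroup E'] [NormedSpace ℝ E'] {H' : Type*} [TopologicalSpace H']
    {I' : ModelWithCorners ℝ E' H'} {N : Type*} [TopologicalSpace N] [ChartedSpace H' N]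
    {ι : Type*} [Fintype ι] [DecidableEq ι] {A : N → Matrix ι ι ℝ} {s : Set N} {x : N}
    (hA : ∀ i k, ContMDiffWithinAt I' 𝓘(ℝ, ℝ) ∞ (fun n => A n i k) s x) (h0 : (A x).det ≠ 0) :
    ContMDiffWithinAt I' 𝓘(ℝ, ℝ) ∞ (fun n => Real.log (A n).det) s x := by
  have h1 : ContDiff ℝ ∞ fun m : ι → ι → ℝ => (Matrix.of m).det := by
    simp only [Matrix.det_apply', Matrix.of_apply]
    fun_prop
  have h2 : ContMDiffWithinAt I' 𝓘(ℝ, ι → ι → ℝ) ∞ (fun n => entries (A n)) s x :=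
    contMDiffWithinAt_pi_space.2 fun i => contMDiffWithinAt_pi_space.2 fun k => hA i k
  exact ContDiffAt.comp_contMDiffWithinAt (g := Real.log) (Real.contDiffAt_log.2 h0)
    (h1.comp_contMDiffWithinAt h2)

theorem integral_mvfderiv_of_isMin [CompleteSpace E] {K : ℝ → M → ℝ} {I : Set ℝ} {t : ℝ}
    (ht : 0 ≤ t) (hI : Icc 0 t ⊆ I)
    (hK : ContMDiffOn (𝓘(ℝ, ℝ).prod 𝓘(ℝ, E)) 𝓘(ℝ, ℝ) ∞ (Function.uncurry K) (I ×ˢ univ))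
    {Y : (z : M) → TangentSpace 𝓘(ℝ, E) z} (hY : IsSmoothField Y) {x : M}
    (hx : ∀ y, ∫ s in (0 : ℝ)..t, K s x ≤ ∫ s in (0 : ℝ)..t, K s y) :
    ∫ s in (0 : ℝ)..t, mvfderiv 𝓘(ℝ, E) (K s) x (Y x) = 0 ∧
    0 ≤ ∫ s in (0 : ℝ)..t, mvfderiv 𝓘(ℝ, E)
      (fun z => mvfderiv 𝓘(ℝ, E) (K s) z (Y z)) x (Y x) := by
  have h := integral_mvfderiv_of_isMax (K := fun s y => -K s y) ht hI hK.neg hY (x := x)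
    fun y => by simpa using hx y
  simp only [mvfderiv_fun_neg, neg_apply, intervalIntegral.integral_neg] at h
  exact ⟨neg_eq_zero.1 h.1, by linarith [h.2]⟩

/-- Polarization of the symmetric forms `Ω(·, j·)`; thus metrics need only be compared on pairs `(u,
ju)`. -/
theorem IsHermitianForm.ext_of_diag {V : Type*} [AddCommGroup V] [Module ℝ V] {j : V →ₗ[ℝ] V}
    {Ω Ω' : V →ₗ[ℝ] V →ₗ[ℝ] ℝ} (h : IsHermitianForm j Ω)
    (h' : IsHermitianForm j Ω') (hd : ∀ u, Ω u (j u) = Ω' u (j u)) : Ω = Ω' := by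
  have h1 : ∀ u v, Ω u (j v) = Ω' u (j v) := fun u v => by
    have e := hd (u + v)
    have e1 := h.metric_symm u v
    have e2 := h'.metric_symm u v
    simp only [metricOf_apply] at e1 e2
    simp only [map_add, LinearMap.add_apply] at e
    linarith [hd u, hd v]
  refine LinearMap.ext₂ fun u v => ?_
  have := h1 u (j v)
  rwa [h.sq, map_neg, map_neg, neg_inj] at this

variable [CompleteSpace E] [FiniteDimensional ℝ E]

namespace FrameAtlas

variable {J : EndField E M} {c : L →ₗ[ℝ] L →ₗ[ℝ] L} {j : L →ₗ[ℝ] L} (𝒜 : FrameAtlas J c j)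
  {Ω₀ : FormField E M} {β : L →ₗ[ℝ] L →ₗ[ℝ] ℝ}

/-- The logarithm of the volume density of `Ω` in the frames of the atlas. -/
def logVolume (Ω : FormField E M) (x : M) : ℝ :=
  Real.log (gramMatrix j ((𝒜.frame x).formIn Ω x) (Module.finBasis ℝ L)).det

/-- The frames at `z` and at `a` differ over `z` by a map `g` commuting with `j`. As `Ω₀` has the
same constant coefficients `β` in both, `g` also preserves the volume of `β`, hence every volume
density. So `logVolume`, defined with a different frame at each point, can be computed near any
point in one fixed frame. -/
theorem logVolume_eq (hj : ∀ u, j (j u) = -u) (hΩ₀ : 𝒜.IsConst Ω₀ β) (hβ : IsHermitianForm j β)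
    {Ω : FormField E M} (hΩ : IsAlmostHermitian J Ω) {a z : M} (hz : z ∈ 𝒜.U a) :
    𝒜.logVolume Ω z =
      Real.log (gramMatrix j ((𝒜.frame a).formIn Ω z) (Module.finBasis ℝ L)).det := by
  set b := Module.finBasis ℝ L
  set φ := 𝒜.frame a
  set ψ := 𝒜.frame z
  have hz' := 𝒜.mem z
  let g : L ≃ₗ[ℝ] L := (φ.equiv hz).symm.trans (ψ.equiv hz')
  have hg : ∀ u, ψ.X z (g u) = φ.X z u := fun u => ψ.X_θ z hz' _
  have hgj : ∀ u, j (g u) = g (j u) := fun u => by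
    change j (ψ.θ z (φ.X z u)) = ψ.θ z (φ.X z (j u))
    rw [← φ.complex z hz, ψ.θ_complex hz']
  have key : ∀ Ω : FormField E M,
      gramMatrix j (ψ.formIn Ω z) (b.map g) = gramMatrix j (φ.formIn Ω z) b := fun Ω => by
    ext i k
    simp only [gramMatrix, Matrix.of_apply, Module.Basis.map_apply]
    rw [LocalFrame.formIn_apply, LocalFrame.formIn_apply, hgj, hg, hg]
  have h := log_det_gramMatrix_sub_change hβ.det_gramMatrix_pos
    (ψ.isHermitianForm hj hΩ hz').det_gramMatrix_pos b (b.map g)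
  rw [key] at h
  have h2 := key Ω₀
  rw [hΩ₀.formIn hz, hΩ₀.formIn hz'] at h2
  rw [h2] at h
  change Real.log (gramMatrix j (ψ.formIn Ω z) b).det = _
  linarith

theorem contMDiffOn_logVolume (hj : ∀ u, j (j u) = -u) (hΩ₀ : 𝒜.IsConst Ω₀ β)
    (hβ : IsHermitianForm j β) {Ω : ℝ → FormField E M} {I : Set ℝ}
    (hΩ : ∀ s ∈ I, IsAlmostHermitian J (Ω s))
    (hs : ContMDiffOn (𝓘(ℝ, ℝ).prod 𝓘(ℝ, E)) (𝓘(ℝ, E).prod 𝓘(ℝ, E →L[ℝ] E →L[ℝ] ℝ)) ∞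
      (fun q : ℝ × M => Bundle.TotalSpace.mk' (E →L[ℝ] E →L[ℝ] ℝ)
        (E := fun y : M => TangentSpace 𝓘(ℝ, E) y →L[ℝ] TangentSpace 𝓘(ℝ, E) y →L[ℝ] ℝ)
        q.2 (Ω q.1 q.2)) (I ×ˢ univ)) :
    ContMDiffOn (𝓘(ℝ, ℝ).prod 𝓘(ℝ, E)) 𝓘(ℝ, ℝ) ∞
      (Function.uncurry fun s z => 𝒜.logVolume (Ω s) z) (I ×ˢ univ) := by
  rintro ⟨s, x⟩ hsx
  have hX : ∀ u, ContMDiffWithinAt (𝓘(ℝ, ℝ).prod 𝓘(ℝ, E)) (𝓘(ℝ, E).prod 𝓘(ℝ, E)) ∞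
      (fun q : ℝ × M => (Bundle.TotalSpace.mk' E q.2 ((𝒜.frame x).X q.2 u) : TangentBundle 𝓘(ℝ, E) M))
      (I ×ˢ univ) (s, x) := fun u =>
    ((𝒜.frame x).smooth_X u).contMDiffAt.comp_contMDiffWithinAt _ contMDiffWithinAt_snd
  have h1 : ContMDiffWithinAt (𝓘(ℝ, ℝ).prod 𝓘(ℝ, E)) 𝓘(ℝ, ℝ) ∞ (fun q : ℝ × M => Real.log
      (gramMatrix j ((𝒜.frame x).formIn (Ω q.1) q.2) (Module.finBasis ℝ L)).det)
      (I ×ˢ univ) (s, x) :=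
    contMDiffWithinAt_log_det (fun i k => contMDiffWithinAt_form_apply (hs (s, x) hsx) (hX _) (hX _))
      (((𝒜.frame x).isHermitianForm hj (hΩ s hsx.1) (𝒜.mem x)).det_gramMatrix_pos _).ne'
  refine h1.congr_of_eventuallyEq_of_mem ?_ hsx
  have h2 : ∀ᶠ q : ℝ × M in 𝓝 (s, x), q.2 ∈ 𝒜.U x :=
    continuous_snd.continuousAt.eventually ((𝒜.frame x).eventually_mem (𝒜.mem x))
  filter_upwards [nhdsWithin_le_nhds h2, self_mem_nhdsWithin] with q hq hq'
  exact 𝒜.logVolume_eq hj hΩ₀ hβ (hΩ q.1 hq'.1) hq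

section Evolution

variable [CompactSpace M] [T2Space M] {η : L →ₗ[ℝ] L →ₗ[ℝ] ℝ} {τ : EReal} {Ω : ℝ → FormField E M}
  {t₁ : ℝ}

/-- The logarithm of the ratio of the volume forms of a solution and of the invariant solution. -/
def relativeVolume (β η : L →ₗ[ℝ] L →ₗ[ℝ] ℝ) (Ω : ℝ → FormField E M) (s : ℝ) (x : M) : ℝ :=
  𝒜.logVolume (Ω s) x - Real.log (gramMatrix j (β - s • η) (Module.finBasis ℝ L)).det

theorem contMDiffOn_relativeVolume (hΩ₀ : 𝒜.IsConst Ω₀ β)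
    (hβ : ∀ s ∈ Icc 0 t₁, IsHermitianForm j (β - s • η)) (hΩ : IsFlowSolution J Ω₀ τ Ω)
    (ht₁ : t₁ ∈ timeInterval τ) :
    ContMDiffOn (𝓘(ℝ, ℝ).prod 𝓘(ℝ, E)) 𝓘(ℝ, ℝ) ∞
      (Function.uncurry (𝒜.relativeVolume β η Ω)) (Icc 0 t₁ ×ˢ univ) := by
  have h0 := hβ 0 ⟨le_rfl, ht₁.1⟩
  rw [show β - (0 : ℝ) • η = β from LinearMap.ext₂ fun u v => by simp] at h0
  have hI : Icc 0 t₁ ⊆ timeInterval τ := fun s hs =>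
    ⟨hs.1, (EReal.coe_le_coe_iff.2 hs.2).trans_lt ht₁.2⟩
  have h1 := 𝒜.contMDiffOn_logVolume h0.sq hΩ₀ h0 (fun s hs => hΩ.hermitian s (hI hs))
    (hΩ.smooth.mono (prod_mono hI subset_rfl))
  refine h1.sub fun q hq => ?_
  refine contMDiffWithinAt_log_det (A := fun q : ℝ × M => gramMatrix j (β - q.1 • η)
    (Module.finBasis ℝ L)) (fun i k => ?_) ((hβ q.1 hq.1).det_gramMatrix_pos _).ne'
  exact contMDiffWithinAt_const.sub (contMDiffWithinAt_fst.smul contMDiffWithinAt_const)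

/-- The evolution of a solution of the flow in an invariant frame. -/
theorem formIn_sub_eq_integral (hΩ₀ : 𝒜.IsConst Ω₀ β)
    (hη : ∀ u, η u (j u) = modelRicci c j u (j u))
    (hβ : ∀ s ∈ Icc 0 t₁, IsHermitianForm j (β - s • η)) (hΩ : IsFlowSolution J Ω₀ τ Ω)
    (ht₁ : t₁ ∈ timeInterval τ) {t : ℝ} (ht : t ∈ Icc 0 t₁) {a x : M} (hx : x ∈ 𝒜.U a) (u : L) :
    let φ := 𝒜.frame a
    let K := 𝒜.relativeVolume β η Ω
    φ.formIn (Ω t) x u (j u) - (β - t • η) u (j u) = 1 / 4 *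
      ((∫ s in (0 : ℝ)..t, mvfderiv 𝓘(ℝ, E)
        (fun z => mvfderiv 𝓘(ℝ, E) (K s) z (φ.X z u)) x (φ.X x u)) +
      (∫ s in (0 : ℝ)..t, mvfderiv 𝓘(ℝ, E)
        (fun z => mvfderiv 𝓘(ℝ, E) (K s) z (φ.X z (j u))) x (φ.X x (j u))) +
      ∫ s in (0 : ℝ)..t, mvfderiv 𝓘(ℝ, E) (K s) x (φ.X x (j (c u (j u))))) := by
  intro φ K
  have h0 := hβ 0 ⟨le_rfl, ht₁.1⟩
  rw [show β - (0 : ℝ) • η = β from LinearMap.ext₂ fun u v => by simp] at h0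
  have hj := h0.sq
  have hI : Icc 0 t₁ ⊆ timeInterval τ := fun s hs =>
    ⟨hs.1, (EReal.coe_le_coe_iff.2 hs.2).trans_lt ht₁.2⟩
  have hK : ContMDiffOn (𝓘(ℝ, ℝ).prod 𝓘(ℝ, E)) 𝓘(ℝ, ℝ) ∞ (Function.uncurry K)
    (Icc 0 t₁ ×ˢ univ) := 𝒜.contMDiffOn_relativeVolume hΩ₀ hβ hΩ ht₁
  have hint : ∀ {k : ℝ → M → ℝ}, ContMDiffOn (𝓘(ℝ, ℝ).prod 𝓘(ℝ, E)) 𝓘(ℝ, ℝ) ∞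
      (Function.uncurry k) (Icc 0 t₁ ×ˢ univ) →
      IntervalIntegrable (fun s => k s x) MeasureTheory.volume 0 t := fun {k} hk => by
    refine ContinuousOn.intervalIntegrable_of_Icc ht.1 ?_
    exact hk.continuousOn.comp (f := fun s => (s, x)) (by fun_prop)
      fun s hs => ⟨⟨hs.1, hs.2.trans ht.2⟩, mem_univ _⟩
  have h1 := hint (contMDiffOn_mvfderiv_apply (contMDiffOn_mvfderiv_apply hK (φ.smooth_X u))
    (φ.smooth_X u))
  have h2 := hint (contMDiffOn_mvfderiv_apply (contMDiffOn_mvfderiv_apply hK (φ.smooth_X (j u)))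
    (φ.smooth_X (j u)))
  have h3 := hint (contMDiffOn_mvfderiv_apply hK (φ.smooth_X (j (c u (j u)))))
  rw [← intervalIntegral.integral_add h1 h2, ← intervalIntegral.integral_add (h1.add h2) h3,
    ← intervalIntegral.integral_const_mul]
  let g : ℝ → ℝ := fun s => Ω s x (φ.X x u) (φ.X x (j u)) - (β u (j u) - s * η u (j u))
  have hg0 : g 0 = 0 := by
    have := hΩ₀ a x hx u (j u)
    simp only [g, hΩ.initial]
    rw [this]
    ring
  have hd : ∀ s ∈ Icc 0 t₁, HasDerivWithinAt g (1 / 4 * (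
      mvfderiv 𝓘(ℝ, E) (fun z => mvfderiv 𝓘(ℝ, E) (K s) z (φ.X z u)) x (φ.X x u) +
      mvfderiv 𝓘(ℝ, E) (fun z => mvfderiv 𝓘(ℝ, E) (K s) z (φ.X z (j u))) x (φ.X x (j u)) +
      mvfderiv 𝓘(ℝ, E) (K s) x (φ.X x (j (c u (j u)))))) (timeInterval τ) s := by
    intro s hs
    obtain ⟨ρ, hρ, hev⟩ := hΩ.evolution s (hI hs)
    have hH := hΩ.hermitian s (hI hs)
    -- The reference density depends on time only, so in space `K s` is the logarithmic volume up to
    -- an additive constant.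
    have hric := φ.ricciForm_apply hj hH hρ (Module.finBasis ℝ L) (contMDiff_slice hK hs)
      (r := -Real.log (gramMatrix j (β - s • η) (Module.finBasis ℝ L)).det)
      (fun z hz => by
        change 𝒜.logVolume (Ω s) z - _ = _
        rw [𝒜.logVolume_eq hj hΩ₀ h0 hH hz]
        rfl) hx
    have e1 := hric u (j u)
    have e2 := hric (j u) (j (j u))
    have e3 := (hev x (φ.X x u) (φ.X x (j u))).sub
      (((hasDerivWithinAt_id s _).mul_const (η u (j u))).const_sub (β u (j u)))
    refine e3.congr_deriv ?_
    -- With this identity the two halves of the `(1,1)` part at `(u, ju)` coincide.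
    have e4 : c (j u) (-u) = c u (j u) := by
      rw [map_neg, φ.bracket_swap hx u]
    rw [oneOnePart, φ.complex x hx, φ.complex x hx, e1, e2, hη, modelRicci_apply]
    simp only [hj, map_neg, neg_apply, e4, mvfderiv_fun_neg]
    ring
  have hFTC := intervalIntegral.integral_eq_sub_of_hasDeriv_right_of_le ht.1
    (fun s hs => ((hd s ⟨hs.1, hs.2.trans ht.2⟩).continuousWithinAt).mono
      fun r hr => hI ⟨hr.1, hr.2.trans ht.2⟩)
    (fun s hs => (hd s ⟨hs.1.le, hs.2.le.trans ht.2⟩).mono_of_mem_nhdsWithin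
      (mem_of_superset (Ioo_mem_nhdsGT hs.2)
        fun r hr => hI ⟨hs.1.le.trans hr.1.le, hr.2.le.trans ht.2⟩))
    (((h1.add h2).add h3).const_mul (1 / 4))
  rw [hFTC, hg0, sub_zero]
  simp [g, LocalFrame.formIn_apply]

/-- A solution of the flow with invariant initial value coincides with the invariant solution. -/
theorem isConst_of_isFlowSolution (hΩ₀ : 𝒜.IsConst Ω₀ β)
    (hη : ∀ u, η u (j u) = modelRicci c j u (j u))
    (hβ : ∀ s ∈ Icc 0 t₁, IsHermitianForm j (β - s • η)) (hΩ : IsFlowSolution J Ω₀ τ Ω)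
    (ht₁ : t₁ ∈ timeInterval τ) {t : ℝ} (ht : t ∈ Icc 0 t₁) : 𝒜.IsConst (Ω t) (β - t • η) := by
  set K := 𝒜.relativeVolume β η Ω with hKdef
  have h0 := hβ 0 ⟨le_rfl, ht₁.1⟩
  rw [show β - (0 : ℝ) • η = β from LinearMap.ext₂ fun u v => by simp] at h0
  have hj := h0.sq
  have hI : Icc 0 t₁ ⊆ timeInterval τ := fun s hs =>
    ⟨hs.1, (EReal.coe_le_coe_iff.2 hs.2).trans_lt ht₁.2⟩
  have hK : ContMDiffOn (𝓘(ℝ, ℝ).prod 𝓘(ℝ, E)) 𝓘(ℝ, ℝ) ∞ (Function.uncurry K)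
    (Icc 0 t₁ ×ˢ univ) := 𝒜.contMDiffOn_relativeVolume hΩ₀ hβ hΩ ht₁
  have hform : ∀ s ∈ Icc 0 t₁, ∀ a, ∀ x ∈ 𝒜.U a,
      IsHermitianForm j ((𝒜.frame a).formIn (Ω s) x) :=
    fun s hs a x hx => (𝒜.frame a).isHermitianForm hj (hΩ.hermitian s (hI hs)) hx
  have hsub : ∀ s ∈ Icc 0 t₁, Icc 0 s ⊆ Icc 0 t₁ := fun s hs => Icc_subset_Icc_right hs.2
  -- At a spatial maximum of the time integral the first-order term vanishes and both second-order
  -- terms are nonpositive, which orders the two metrics at that point.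
  have hmax : ∀ s ∈ Icc 0 t₁, ∀ a, ∀ x ∈ 𝒜.U a,
      (∀ y, ∫ r in (0 : ℝ)..s, K r y ≤ ∫ r in (0 : ℝ)..s, K r x) →
      ∀ u, (𝒜.frame a).formIn (Ω s) x u (j u) ≤ (β - s • η) u (j u) := by
    intro s hs a x hxa hx u
    have h1 := fun w => integral_mvfderiv_of_isMax hs.1 (hsub s hs) hK ((𝒜.frame a).smooth_X w) hx
    have h2 := 𝒜.formIn_sub_eq_integral hΩ₀ hη hβ hΩ ht₁ hs hxa u
    simp only [← hKdef, (h1 _).1] at h2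
    linarith [(h1 u).2, (h1 (j u)).2]
  have hmin : ∀ s ∈ Icc 0 t₁, ∀ a, ∀ x ∈ 𝒜.U a,
      (∀ y, ∫ r in (0 : ℝ)..s, K r x ≤ ∫ r in (0 : ℝ)..s, K r y) →
      ∀ u, (β - s • η) u (j u) ≤ (𝒜.frame a).formIn (Ω s) x u (j u) := by
    intro s hs a x hxa hx u
    have h1 := fun w => integral_mvfderiv_of_isMin hs.1 (hsub s hs) hK ((𝒜.frame a).smooth_X w) hx
    have h2 := 𝒜.formIn_sub_eq_integral hΩ₀ hη hβ hΩ ht₁ hs hxa u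
    simp only [← hKdef, (h1 _).1] at h2
    linarith [(h1 u).2, (h1 (j u)).2]
  -- The smaller metric has the smaller volume, so the integrand is nonpositive at spatial maxima of
  -- its integral: the hypothesis of the maximum principle.
  have hle : ∀ s ∈ Icc 0 t₁, ∀ x, ∫ r in (0 : ℝ)..s, K r x ≤ 0 := fun s hs x =>
    integral_nonpos_of_isMax hK.continuousOn (fun s hs x hx => sub_nonpos.2
      ((hβ s hs).log_det_gramMatrix_le (hform s hs x x (𝒜.mem x)) (hmax s hs x x (𝒜.mem x) hx) _)) hs x
  have hge : ∀ s ∈ Icc 0 t₁, ∀ x, 0 ≤ ∫ r in (0 : ℝ)..s, K r x := fun s hs x => by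
    have := integral_nonpos_of_isMax (F := fun s y => -K s y) hK.continuousOn.neg
      (fun s hs x hx => neg_nonpos.2 (sub_nonneg.2
      ((hform s hs x x (𝒜.mem x)).log_det_gramMatrix_le (hβ s hs) (hmin s hs x x (𝒜.mem x) fun y => by
        have := hx y
        simp only [intervalIntegral.integral_neg] at this
        linarith) _))) hs x
    simp only [intervalIntegral.integral_neg] at this
    linarith
  have hzero : ∀ x, ∫ r in (0 : ℝ)..t, K r x = 0 := fun x => le_antisymm (hle t ht x) (hge t ht x)
  -- The integral vanishes identically, so every point is a maximum and a minimum and both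
  -- comparisons hold everywhere.
  have hdiag : ∀ a, ∀ x ∈ 𝒜.U a, (𝒜.frame a).formIn (Ω t) x = β - t • η := fun a x hx =>
    (hform t ht a x hx).ext_of_diag (hβ t ht) fun u => le_antisymm
      (hmax t ht a x hx (fun y => by rw [hzero, hzero]) u)
      (hmin t ht a x hx (fun y => by rw [hzero, hzero]) u)
  intro a z hz u v
  rw [← hdiag a z hz, LocalFrame.formIn_apply]

end Evolution

end FrameAtlas

end FlowUniqueness

/-! ### The affine solution, its maximality and its scalar curvature -/

section InvariantFlow

variable {E : Type*} [NormedAddCommGroup E] [NormedSpace ℝ E]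
  {M : Type*} [TopologicalSpace M] [ChartedSpace E M] [IsManifold 𝓘(ℝ, E) ∞ M]
  {L : Type*} [NormedAddCommGroup L] [NormedSpace ℝ L] [FiniteDimensional ℝ L]

/-- Affine combinations of smooth fields of forms are smooth in time and space. -/
theorem contMDiff_sub_smul_form {Ω ρ : FormField E M} (hΩ : ∀ x, IsSmoothFormAt Ω x)
    (hρ : ∀ x, IsSmoothFormAt ρ x) :
    ContMDiff (𝓘(ℝ, ℝ).prod 𝓘(ℝ, E)) (𝓘(ℝ, E).prod 𝓘(ℝ, E →L[ℝ] E →L[ℝ] ℝ)) ∞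
    (fun q : ℝ × M => Bundle.TotalSpace.mk' (E →L[ℝ] E →L[ℝ] ℝ)
      (E := fun y : M => TangentSpace 𝓘(ℝ, E) y →L[ℝ] TangentSpace 𝓘(ℝ, E) y →L[ℝ] ℝ)
      q.2 (Ω q.2 - q.1 • ρ q.2)) := by
  rintro ⟨t, x⟩
  have h1 := ContMDiffAt.comp (t, x) (hΩ x) (contMDiffAt_snd (I := 𝓘(ℝ, ℝ)) (p := (t, x)))
  have h2 := ContMDiffAt.comp (t, x) (hρ x) (contMDiffAt_snd (I := 𝓘(ℝ, ℝ)) (p := (t, x)))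
  rw [Function.comp_def] at h1 h2
  have h1' := (contMDiffAt_hom_bundle (F₁ := E) (E₁ := fun y : M => TangentSpace 𝓘(ℝ, E) y)
    (F₂ := E →L[ℝ] ℝ) (E₂ := fun y : M => TangentSpace 𝓘(ℝ, E) y →L[ℝ] ℝ) _).1 h1
  have h2' := (contMDiffAt_hom_bundle (F₁ := E) (E₁ := fun y : M => TangentSpace 𝓘(ℝ, E) y)
    (F₂ := E →L[ℝ] ℝ) (E₂ := fun y : M => TangentSpace 𝓘(ℝ, E) y →L[ℝ] ℝ) _).1 h2
  refine (contMDiffAt_hom_bundle (F₁ := E) (E₁ := fun y : M => TangentSpace 𝓘(ℝ, E) y)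
    (F₂ := E →L[ℝ] ℝ) (E₂ := fun y : M => TangentSpace 𝓘(ℝ, E) y →L[ℝ] ℝ) _).2
    ⟨contMDiffAt_snd, (h1'.2.sub (contMDiffAt_fst.smul h2'.2)).congr_of_eventuallyEq
      (Eventually.of_forall fun q => ?_)⟩
  refine ContinuousLinearMap.ext fun w => ?_
  simp only [ContinuousLinearMap.inCoordinates, ContinuousLinearMap.comp_apply, sub_apply,
    smul_apply]
  exact ((ContinuousLinearMap.map_sub _ _ _).trans (congrArg _ (ContinuousLinearMap.map_smul _ _ _)))

/-- The form `p^{(1,1)}` on the model space. -/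
def modelForm (c : L →ₗ[ℝ] L →ₗ[ℝ] L) (j : L →ₗ[ℝ] L) : L →ₗ[ℝ] L →ₗ[ℝ] ℝ :=
  (1 / 4 : ℝ) • (FrameAtlas.modelRicci c j + (FrameAtlas.modelRicci c j).compl₁₂ j j)

section ModelForm

variable {c : L →ₗ[ℝ] L →ₗ[ℝ] L} {j : L →ₗ[ℝ] L}

theorem modelForm_apply (u v : L) : modelForm c j u v =
    1 / 4 * (FrameAtlas.modelRicci c j u v + FrameAtlas.modelRicci c j (j u) (j v)) := rfl

theorem modelRicci_alternating (hc : ∀ u v, c u v = -c v u) (u v : L) :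
    FrameAtlas.modelRicci c j u v = -FrameAtlas.modelRicci c j v u := by
  rw [FrameAtlas.modelRicci_apply, FrameAtlas.modelRicci_apply, hc]
  simp

theorem modelForm_alternating (hc : ∀ u v, c u v = -c v u) (u v : L) :
    modelForm c j u v = -modelForm c j v u := by
  rw [modelForm_apply, modelForm_apply, modelRicci_alternating hc u,
    modelRicci_alternating hc (j u)]
  ring

theorem modelForm_invariant (hj : ∀ u, j (j u) = -u) (u v : L) :
    modelForm c j (j u) (j v) = modelForm c j u v := by
  rw [modelForm_apply, modelForm_apply, hj, hj]
  simp only [map_neg, LinearMap.neg_apply, neg_neg]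
  ring

/-- On pairs `(u, ju)` an alternating form equals its `(1,1)` part, so the affine solution fits the
uniqueness argument. -/
theorem two_mul_modelForm_diag (hc : ∀ u v, c u v = -c v u) (hj : ∀ u, j (j u) = -u) (u : L) :
    2 * modelForm c j u (j u) = FrameAtlas.modelRicci c j u (j u) := by
  rw [modelForm_apply, hj, map_neg, modelRicci_alternating hc (j u)]
  ring

end ModelForm

variable [CompleteSpace E] [FiniteDimensional ℝ E]

/-- The `(1,1)` part of a bilinear form, as a continuous bilinear map. -/
def oneOneForm (J : E →L[ℝ] E) (ρ : E →L[ℝ] E →L[ℝ] ℝ) : E →L[ℝ] E →L[ℝ] ℝ :=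
  (1 / 2 : ℝ) • (ρ + ρ.bilinearComp J J)

theorem oneOneForm_apply (J : E →L[ℝ] E) (ρ : E →L[ℝ] E →L[ℝ] ℝ) (u v : E) :
    oneOneForm J ρ u v = oneOnePart J (fun u v => ρ u v) u v := by
  change 1 / 2 * (ρ u v + ρ (J u) (J v)) = _
  rw [oneOnePart]
  ring

/-- The `(1,1)` part of a field of forms. -/
def oneOneField (J : EndField E M) (ρ : FormField E M) : FormField E M := fun x =>
  oneOneForm (E := E) (J x) (ρ x)

theorem oneOneField_apply (J : EndField E M) (ρ : FormField E M) (x : M)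
    (u v : TangentSpace 𝓘(ℝ, E) x) :
    oneOneField J ρ x u v = oneOnePart (J x) (fun u v => ρ x u v) u v :=
  oneOneForm_apply (E := E) (J x) (ρ x) u v

/-- The field of forms `Ω₀ - t ρ^{(1,1)}`. -/
def affineFlow (J : EndField E M) (Ω₀ ρ : FormField E M) (t : ℝ) : FormField E M := fun x =>
  Ω₀ x - t • oneOneField J ρ x

theorem affineFlow_apply (J : EndField E M) (Ω₀ ρ : FormField E M) (t : ℝ) (x : M)
    (u v : TangentSpace 𝓘(ℝ, E) x) : affineFlow J Ω₀ ρ t x u v =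
      Ω₀ x u v - t * oneOnePart (J x) (fun u v => ρ x u v) u v := by
  rw [← oneOneField_apply]
  rfl

namespace FrameAtlas

variable {J : EndField E M} {c : L →ₗ[ℝ] L →ₗ[ℝ] L} {j : L →ₗ[ℝ] L} {𝒜 : FrameAtlas J c j}
  {Ω₀ ρ : FormField E M} {β : L →ₗ[ℝ] L →ₗ[ℝ] ℝ}

theorem IsConst.oneOneField (hρ : 𝒜.IsConst ρ (modelRicci c j)) :
    𝒜.IsConst (oneOneField J ρ) ((2 : ℝ) • modelForm c j) := by
  intro a z hz u v
  rw [oneOneField_apply, oneOnePart, (𝒜.frame a).complex z hz, (𝒜.frame a).complex z hz,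
    hρ a z hz, hρ a z hz, LinearMap.smul_apply, LinearMap.smul_apply, modelForm_apply, smul_eq_mul]
  ring

theorem IsConst.affineFlow (hΩ₀ : 𝒜.IsConst Ω₀ β) (hρ : 𝒜.IsConst ρ (modelRicci c j)) (t : ℝ) :
    𝒜.IsConst (affineFlow J Ω₀ ρ t) (β - (2 * t) • modelForm c j) := by
  intro a z hz u v
  rw [affineFlow_apply, ← oneOneField_apply, hΩ₀ a z hz, hρ.oneOneField a z hz]
  simp only [LinearMap.sub_apply, LinearMap.smul_apply, smul_eq_mul]
  ring

variable [Nonempty M] {m : ℕ} {P : L →ₗ[ℝ] L} {e : Module.Basis (Fin m) ℝ L} {p : Fin m → ℝ}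

theorem bracket_swap (𝒜 : FrameAtlas J c j) (u v : L) : c u v = -c v u :=
  (𝒜.frame (Classical.arbitrary M)).bracket_swap (𝒜.mem _) u v

theorem isHermitianForm_flow (𝒜 : FrameAtlas J c j) (hβ : IsHermitianForm j β)
    (hP : ∀ u v, modelForm c j u v = β (P u) v)
    (he : ∀ i k, β (e i) (j (e k)) = if i = k then 1 else 0) (hp : ∀ i, P (e i) = p i • e i)
    {t : ℝ} (ht : t ∈ timeInterval (maxTime p)) :
    IsHermitianForm j (β - (2 * t) • modelForm c j) :=
  hβ.flow (modelForm_alternating 𝒜.bracket_swap) (modelForm_invariant hβ.sq) hP he hp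
    (mem_timeInterval_maxTime.1 ht).2

/-- The affine family of forms solves the flow as long as it stays positive. -/
theorem isFlowSolution_affineFlow (hβ : IsHermitianForm j β)
    (hP : ∀ u v, modelForm c j u v = β (P u) v)
    (he : ∀ i k, β (e i) (j (e k)) = if i = k then 1 else 0) (hp : ∀ i, P (e i) = p i • e i)
    (hΩ₀ : 𝒜.IsConst Ω₀ β) (hρ : 𝒜.IsConst ρ (modelRicci c j)) :
    IsFlowSolution J Ω₀ (maxTime p) (AlmostComplexFlow.affineFlow J Ω₀ ρ) where
  smooth := (contMDiff_sub_smul_form hΩ₀.smooth hρ.oneOneField.smooth).contMDiffOn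
  hermitian t ht := (hΩ₀.affineFlow hρ t).isAlmostHermitian
    (𝒜.isHermitianForm_flow hβ hP he hp ht)
  initial := by
    funext x
    ext u v
    rw [affineFlow_apply, zero_mul, sub_zero]
  evolution t ht := by
    have hβt := 𝒜.isHermitianForm_flow hβ hP he hp ht
    obtain ⟨ρ', hρ'⟩ := 𝒜.exists_isChernRicciForm hβ.sq (hΩ₀.affineFlow hρ t) hβt
    have h := 𝒜.isConst_of_isChernRicciForm hβ.sq (hΩ₀.affineFlow hρ t) hβt hρ'
    -- The Ricci form at time `t` is the initial one, since `modelRicci` does not depend on the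
    -- metric.
    obtain rfl : ρ' = ρ := IsConst.ext 𝒜 h hρ
    refine ⟨ρ', hρ', fun x u v => ?_⟩
    simp only [affineFlow_apply]
    simpa using ((hasDerivWithinAt_id t (timeInterval (maxTime p))).mul_const
      (oneOnePart (J x) (fun u v => ρ' x u v) u v)).const_sub (Ω₀ x u v)

/-- Before `maxTime` any solution is the affine one. If it continued to a finite `maxTime`,
continuity would give its metric there the values `1 - 2 T' p α` on the basis vectors; these would
all be positive, so that `T'` would lie before itself. -/
theorem isMaximalFlowSolution_affineFlow [CompactSpace M] [T2Space M] (hβ : IsHermitianForm j β)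
    (hP : ∀ u v, modelForm c j u v = β (P u) v)
    (he : ∀ i k, β (e i) (j (e k)) = if i = k then 1 else 0) (hp : ∀ i, P (e i) = p i • e i)
    (hΩ₀ : 𝒜.IsConst Ω₀ β) (hρ : 𝒜.IsConst ρ (modelRicci c j)) :
    IsMaximalFlowSolution J Ω₀ (maxTime p) (AlmostComplexFlow.affineFlow J Ω₀ ρ) where
  pos := maxTime_pos
  solution := isFlowSolution_affineFlow hβ hP he hp hΩ₀ hρ
  maximal τ Ω' hΩ' := by
    have hform : ∀ t : ℝ, β - t • ((2 : ℝ) • modelForm c j) = β - (2 * t) • modelForm c j := fun t =>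
      LinearMap.ext₂ fun u v => by
        simp only [LinearMap.sub_apply, LinearMap.smul_apply, smul_eq_mul]
        ring
    have hconst : ∀ t ∈ timeInterval τ, t ∈ timeInterval (maxTime p) →
        𝒜.IsConst (Ω' t) (β - (2 * t) • modelForm c j) := by
      intro t ht htp
      rw [← hform]
      refine 𝒜.isConst_of_isFlowSolution hΩ₀ (fun u => ?_) (fun s hs => ?_) hΩ' ht ⟨ht.1, le_rfl⟩
      · rw [← two_mul_modelForm_diag 𝒜.bracket_swap hβ.sq]
        rfl
      · rw [hform]
        exact 𝒜.isHermitianForm_flow hβ hP he hp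
          ⟨hs.1, (EReal.coe_le_coe_iff.2 hs.2).trans_lt htp.2⟩
    have hτ : τ ≤ maxTime p := by
      by_contra! hlt
      lift maxTime p to ℝ using ⟨hlt.ne_top, (EReal.bot_lt_zero.trans maxTime_pos).ne'⟩ with T' hT'
      have hT0 : 0 < T' := by
        have := maxTime_pos (p := p)
        rw [← hT'] at this
        exact_mod_cast this
      have hTτ : T' ∈ timeInterval τ := ⟨hT0.le, hlt⟩
      have x : M := Classical.arbitrary M
      have hmem : T' ∈ timeInterval (maxTime p) := by
        rw [mem_timeInterval_maxTime]
        refine ⟨hT0.le, fun α => ?_⟩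
        set φ := 𝒜.frame x
        obtain ⟨ρ', -, hev⟩ := hΩ'.evolution T' hTτ
        have hc := (hev x (φ.X x (e α)) (φ.X x (j (e α)))).continuousWithinAt
        have hval : ∀ t, (β - (2 * t) • modelForm c j) (e α) (j (e α)) = 1 - 2 * t * p α := fun t => by
          simp only [LinearMap.sub_apply, LinearMap.smul_apply, hP, hp, map_smul, he, smul_eq_mul,
            if_true]
          ring
        have hsub : Ico 0 T' ⊆ timeInterval τ := fun s hs =>
          ⟨hs.1, (EReal.coe_lt_coe_iff.2 hs.2).trans hlt⟩
        have hlim : Tendsto (fun s => Ω' s x (φ.X x (e α)) (φ.X x (j (e α)))) (𝓝[<] T')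
            (𝓝 (Ω' T' x (φ.X x (e α)) (φ.X x (j (e α))))) :=
          hc.mono_left (nhdsWithin_le_of_mem (mem_of_superset (Ico_mem_nhdsLT hT0) hsub))
        have hlim2 : Tendsto (fun s : ℝ => 1 - 2 * s * p α) (𝓝[<] T') (𝓝 (1 - 2 * T' * p α)) := by
          refine Tendsto.mono_left (Continuous.tendsto ?_ T') nhdsWithin_le_nhds
          fun_prop
        have heq := tendsto_nhds_unique (hlim.congr' (f₂ := fun s : ℝ => 1 - 2 * s * p α) (by
          filter_upwards [Ico_mem_nhdsLT hT0] with s hs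
          rw [← hval]
          exact hconst s (hsub hs) ⟨hs.1, EReal.coe_lt_coe_iff.2 hs.2⟩ x x (𝒜.mem x) _ _))
          hlim2
        rw [← heq]
        exact (φ.isHermitianForm hβ.sq (hΩ'.hermitian T' hTτ) (𝒜.mem x)).positive _ (e.ne_zero α)
      have := hmem.2
      rw [← hT'] at this
      exact lt_irrefl _ this
    refine ⟨hτ, fun t ht => ?_⟩
    exact IsConst.ext 𝒜 (hconst t ht ⟨ht.1, ht.2.trans_le hτ⟩) (hΩ₀.affineFlow hρ t)

/-- The `(1,1)` part of the Ricci form is represented by `2Q`, with `Q` the Chern-Ricci operator at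
time `t`. The factor `2` cancels the `1/2` in `formTrace`, leaving `tr Q`. -/
theorem isChernScalarCurvature_affineFlow_iff (hβ : IsHermitianForm j β)
    (hP : ∀ u v, modelForm c j u v = β (P u) v)
    (he : ∀ i k, β (e i) (j (e k)) = if i = k then 1 else 0) (hp : ∀ i, P (e i) = p i • e i)
    (hΩ₀ : 𝒜.IsConst Ω₀ β) (hρ : 𝒜.IsConst ρ (modelRicci c j)) {t : ℝ}
    (ht : t ∈ timeInterval (maxTime p)) (s : M → ℝ) :
    IsChernScalarCurvature J (AlmostComplexFlow.affineFlow J Ω₀ ρ t) s ↔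
      s = fun _ => scalarFun p t := by
  have hβt := 𝒜.isHermitianForm_flow hβ hP he hp ht
  have hΩt := hΩ₀.affineFlow hρ t
  have hpos := (mem_timeInterval_maxTime.1 ht).2
  set Q := Ring.inverse (1 - (2 * t) • P) * P
  have hQ : ∀ u v, modelForm c j u v = (β - (2 * t) • modelForm c j) (Q u) v :=
    (hβ.operator_flow hP (isUnit_flow hp hpos) Q).2 rfl
  have htr : ∀ x, formTrace (J x) (fun u v => AlmostComplexFlow.affineFlow J Ω₀ ρ t x u v)
      (fun u v => ρ x u v) = scalarFun p t := by
    intro x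
    have hx := 𝒜.mem x
    set φ := 𝒜.frame x
    set θ := φ.equiv hx
    have hA := hΩt.isAlmostHermitian hβt
    let B : FormField E M → TangentSpace 𝓘(ℝ, E) x →ₗ[ℝ] TangentSpace 𝓘(ℝ, E) x →ₗ[ℝ] ℝ :=
      fun Ω => LinearMap.mk₂ ℝ (fun u v => Ω x u v) (fun u u' v => by rw [map_add, add_apply])
        (fun a u v => by rw [map_smul, smul_apply]) (fun u v v' => by rw [map_add])
        (fun a u v => by rw [map_smul])
    have hH : IsHermitianForm (J x).toLinearMap (B (AlmostComplexFlow.affineFlow J Ω₀ ρ t)) :=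
      ⟨fun u => ?_, hA.alternating x, hA.invariant x, hA.positive x⟩
    · refine (hH.formTrace_eq (B ρ) (Q := θ.symm.conj ((2 : ℝ) • Q)) fun u v => ?_).trans ?_
      · refine (oneOneField_apply J ρ x u v).symm.trans ((hρ.oneOneField.apply hx u v).trans ?_)
        refine Eq.trans ?_ (hΩt.apply hx _ v).symm
        have hθQ : φ.θ x (θ.symm.conj ((2 : ℝ) • Q) u) = (2 : ℝ) • Q (φ.θ x u) :=
          φ.θ_X x hx _
        rw [hθQ, map_smul]
        exact congrArg ((2 : ℝ) * ·) (hQ _ _)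
      · rw [LinearMap.trace_conj', map_smul, smul_eq_mul, trace_operator_flow hp hpos]
        ring
    · refine φ.equiv hx |>.injective ?_
      change φ.θ x (J x (J x u)) = φ.θ x (-u)
      rw [φ.θ_complex hx, φ.θ_complex hx, hβ.sq, map_neg]
  have hric : ∀ ρ', IsChernRicciForm J (AlmostComplexFlow.affineFlow J Ω₀ ρ t) ρ' → ρ' = ρ :=
    fun ρ' h => IsConst.ext 𝒜 (𝒜.isConst_of_isChernRicciForm hβ.sq hΩt hβt h) hρ
  constructor
  · rintro ⟨ρ', hρ', hs⟩
    obtain rfl := hric ρ' hρ'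
    funext x
    rw [hs, htr]
  · rintro rfl
    obtain ⟨ρ', hρ'⟩ := 𝒜.exists_isChernRicciForm hβ.sq hΩt hβt
    obtain rfl := hric ρ' hρ'
    exact ⟨ρ', hρ', fun x => (htr x).symm⟩

end FrameAtlas

end InvariantFlow

/-! ### Translation between `M` and the Lie algebra of `G` -/

section LeftInvariant

variable {E : Type*} [NormedAddCommGroup E] [NormedSpace ℝ E] [FiniteDimensional ℝ E]
  [CompleteSpace E]
  {M : Type*} [TopologicalSpace M] [ChartedSpace E M] [IsManifold 𝓘(ℝ, E) ∞ M] [T2Space M]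
  {G : Type*} [Group G] [TopologicalSpace G] [ChartedSpace E G] [LieGroup 𝓘(ℝ, E) ∞ G]
  {J : EndField E M} {Ω₀ Ω ρ : FormField E M} {π : G → M}
  {j : E →ₗ[ℝ] E} {β β' : E →ₗ[ℝ] E →ₗ[ℝ] ℝ}

theorem mfderiv_pullbackEnd (hπ : IsLocalDiffeomorph 𝓘(ℝ, E) 𝓘(ℝ, E) ∞ π) (y : G)
    (w : TangentSpace 𝓘(ℝ, E) y) :
    mfderiv 𝓘(ℝ, E) 𝓘(ℝ, E) π y (pullbackEnd π J y w) =
      J (π y) (mfderiv 𝓘(ℝ, E) 𝓘(ℝ, E) π y w) := by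
  set e := hπ.mfderivToContinuousLinearEquiv (by simp) y
  have he : mfderiv 𝓘(ℝ, E) 𝓘(ℝ, E) π y = (e : _ →L[ℝ] _) := rfl
  rw [pullbackEnd, he, ContinuousLinearMap.inverse_equiv]
  exact e.apply_symm_apply _

theorem complex_pushInvariant (hπ : IsLocalDiffeomorph 𝓘(ℝ, E) 𝓘(ℝ, E) ∞ π)
    (hJ : IsLeftInvariantEnd (pullbackEnd π J)) (hj : ∀ u : E, j u = pullbackEnd π J (1 : G) u)
    (y : G) (u : E) : J (π y) (pushInvariant π y u) = pushInvariant π y (j u) := by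
  have h1 : ∀ z, z = y → ∀ w : E, (pullbackEnd π J z w : E) = (pullbackEnd π J y w : E) := by
    rintro z rfl w
    rfl
  have h2 := (h1 _ (mul_one y) _).symm.trans (hJ y 1 u)
  refine (mfderiv_pullbackEnd hπ y _).symm.trans ?_
  rw [hj]
  exact congrArg (mfderiv 𝓘(ℝ, E) 𝓘(ℝ, E) π y) h2

theorem pushInvariant_one (u : E) :
    pushInvariant π (1 : G) u = mfderiv 𝓘(ℝ, E) 𝓘(ℝ, E) π 1 (u : TangentSpace 𝓘(ℝ, E) (1 : G)) := by
  have h : (fun x : G => 1 * x) = id := funext one_mul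
  change mfderiv 𝓘(ℝ, E) 𝓘(ℝ, E) π 1 (mfderiv 𝓘(ℝ, E) 𝓘(ℝ, E) (fun x : G => 1 * x) 1 u) = _
  rw [h, mfderiv_id]
  rfl

theorem IsInvariantForm.pullbackForm_one (h : IsInvariantForm π Ω β) (u v : E) :
    pullbackForm π Ω (1 : G) u v = β u v := by
  rw [← h 1, pushInvariant_one, pushInvariant_one]
  rfl

theorem IsInvariantForm.pullbackForm_apply (h : IsInvariantForm π Ω β) (y : G)
    (X Y : GroupLieAlgebra 𝓘(ℝ, E) G) :
    pullbackForm π Ω y (mulInvariantVectorField X y) (mulInvariantVectorField Y y) =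
      β (X : E) (Y : E) := h y X Y

theorem exists_isInvariantForm (h : IsLeftInvariantForm (pullbackForm π Ω)) :
    ∃ β : E →ₗ[ℝ] E →ₗ[ℝ] ℝ, IsInvariantForm π Ω β := by
  have h1 : ∀ y z, z = y → ∀ u v : E,
      pullbackForm π Ω z u v = pullbackForm π Ω y u v := by
    rintro y z rfl u v
    rfl
  refine ⟨LinearMap.mk₂ ℝ (fun u v => Ω (π 1) (pushInvariant π 1 u) (pushInvariant π 1 v))
    (fun u u' v => by rw [map_add, map_add, add_apply])
    (fun a u v => by rw [map_smul, map_smul, smul_apply]) (fun u v v' => by rw [map_add, map_add])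
    (fun a u v => by rw [map_smul, map_smul]), fun y u v => ?_⟩
  rw [LinearMap.mk₂_apply, pushInvariant_one, pushInvariant_one]
  exact (h1 y _ (mul_one y) _ _).symm.trans (h y 1 u v)

/-- For each `y` a separate atlas is used whose frame at `π y` is the projection of the invariant
frame from `y` itself. -/
theorem IsInvariantForm.of_isChernRicciForm (hJ : IsAlmostComplexStructure J)
    (hΩ₀ : IsAlmostHermitian J Ω₀) (hπ : IsLocalDiffeomorph 𝓘(ℝ, E) 𝓘(ℝ, E) ∞ π)
    (hπs : Function.Surjective π)
    (hj : ∀ y u, J (π y) (pushInvariant π y u) = pushInvariant π y (j u))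
    (hβ : IsInvariantForm π Ω₀ β) (hρ : IsChernRicciForm J Ω₀ ρ) :
    IsInvariantForm π ρ (FrameAtlas.modelRicci (bracketMap E G) j) := by
  intro y u v
  have hH := hβ.isHermitianForm hJ hΩ₀ hπ hj
  obtain ⟨𝒜, hy, h𝒜⟩ := exists_frameAtlas hJ hΩ₀ hπ hπs hj hβ y
  rw [← hy, ← hy]
  exact 𝒜.isConst_of_isChernRicciForm hH.sq (h𝒜 _ _ hβ) hH hρ _ _ (𝒜.mem _) u v

theorem IsInvariantForm.affineFlow
    (hj : ∀ y u, J (π y) (pushInvariant π y u) = pushInvariant π y (j u))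
    (hβ : IsInvariantForm π Ω₀ β)
    (hρ : IsInvariantForm π ρ (FrameAtlas.modelRicci (bracketMap E G) j)) (t : ℝ) :
    IsInvariantForm π (affineFlow J Ω₀ ρ t) (β - (2 * t) • modelForm (bracketMap E G) j) := by
  intro y u v
  rw [affineFlow_apply, oneOnePart, hj, hj, hβ, hρ, hρ, LinearMap.sub_apply, LinearMap.sub_apply,
    LinearMap.smul_apply, LinearMap.smul_apply, modelForm_apply, smul_eq_mul]
  ring

/-- This is `trace_chernAnti` at the bracket `[X, Y]`, with the Lie algebra identified with the
model space. -/
theorem two_mul_invariantForm {𝔧 : GroupLieAlgebra 𝓘(ℝ, E) G →ₗ[ℝ] GroupLieAlgebra 𝓘(ℝ, E) G}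
    (hsq : ∀ u, 𝔧 (𝔧 u) = -u) (X Y : GroupLieAlgebra 𝓘(ℝ, E) G) :
    2 * invariantForm 𝔧 X Y =
      FrameAtlas.modelRicci (L := E) (bracketMap E G) (j := 𝔧) X Y := by
  have h := trace_chernAnti (V := E) (bracketMap E G) (j := 𝔧) hsq (bracketMap E G X Y)
  refine Eq.trans ?_ (congrArg (1 / 2 * ·) h).symm
  change 2 * (-(1 / 4) * LinearMap.trace ℝ _ (𝔧 ∘ₗ LieAlgebra.ad ℝ _ ⁅X, Y⁆) +
    1 / 4 * LinearMap.trace ℝ _ (LieAlgebra.ad ℝ _ (𝔧 ⁅X, Y⁆))) =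
    1 / 2 * (LinearMap.trace ℝ _ (LieAlgebra.ad ℝ _ (𝔧 ⁅X, Y⁆)) -
      LinearMap.trace ℝ _ (𝔧 ∘ₗ LieAlgebra.ad ℝ _ ⁅X, Y⁆))
  ring

theorem oneOnePart_invariantForm {𝔧 : GroupLieAlgebra 𝓘(ℝ, E) G →ₗ[ℝ] GroupLieAlgebra 𝓘(ℝ, E) G}
    (hsq : ∀ u, 𝔧 (𝔧 u) = -u) (X Y : GroupLieAlgebra 𝓘(ℝ, E) G) :
    oneOnePart 𝔧 (invariantForm 𝔧) X Y =
      modelForm (L := E) (bracketMap E G) (j := 𝔧) X Y := by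
  have h1 := two_mul_invariantForm hsq X Y
  have h2 := two_mul_invariantForm hsq (𝔧 X) (𝔧 Y)
  refine Eq.trans ?_ (congrArg (1 / 4 * ·) (congrArg₂ (· + ·) h1 h2))
  rw [oneOnePart]
  ring

end LeftInvariant

/-! ### Sign and eigenvalues of the Chern-Ricci operator -/

section Spectrum

variable {V : Type*} [AddCommGroup V] [Module ℝ V] {m : ℕ} {j P : V →ₗ[ℝ] V}
  {β : V →ₗ[ℝ] V →ₗ[ℝ] ℝ} {e : Module.Basis (Fin m) ℝ V} {p : Fin m → ℝ}

theorem IsHermitianForm.operator_nonpos_iff (h : IsHermitianForm j β)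
    (he : ∀ i k, β (e i) (j (e k)) = if i = k then 1 else 0) (hp : ∀ i, P (e i) = p i • e i) :
    (∀ u, β (P u) (j u) ≤ 0) ↔ ∀ i, p i ≤ 0 := by
  constructor
  · intro hP i
    simpa [hp, he] using hP (e i)
  · intro hpn u
    have h1 : P u = ∑ i, (p i * e.repr u i) • e i := by
      conv_lhs => rw [← e.sum_repr u]
      simp only [map_sum, map_smul, hp, smul_smul, mul_comm]
    have h2 : ∀ i, β (e i) (j u) = e.repr u i := fun i => by
      rw [repr_eq_of_orthonormal (metricOf j β) e he, h.metric_symm]; rfl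
    rw [h1]
    simp only [map_sum, map_smul, LinearMap.sum_apply, LinearMap.smul_apply, h2, smul_eq_mul]
    exact Finset.sum_nonpos fun i _ => by nlinarith [hpn i, mul_self_nonneg (e.repr u i)]

theorem hasEigenvalue_iff_of_diagonal (hp : ∀ i, P (e i) = p i • e i) (μ : ℝ) :
    Module.End.HasEigenvalue P μ ↔ ∃ i, p i = μ := by
  constructor
  · intro hμ
    obtain ⟨u, hu⟩ := hμ.exists_hasEigenvector
    by_contra! hne
    refine hu.2 (e.repr.map_eq_zero_iff.1 (Finsupp.ext fun i => ?_))
    have h1 : ∀ w, e.repr (P w) i = p i * e.repr w i := by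
      intro w
      have : e.coord i ∘ₗ P = p i • e.coord i := e.ext fun k => by
        by_cases hk : k = i
        · simp [hp, hk]
        · simp [hp, hk]
      exact LinearMap.congr_fun this w
    have h2 := h1 u
    rw [hu.apply_eq_smul, map_smul, Finsupp.smul_apply, smul_eq_mul] at h2
    exact (mul_eq_zero.1 (by linear_combination h2 : (μ - p i) * e.repr u i = 0)).resolve_left
      (sub_ne_zero.2 (hne i).symm)
  · rintro ⟨i, rfl⟩
    exact Module.End.hasEigenvalue_of_hasEigenvector
      ⟨Module.End.mem_eigenspace_iff.2 (hp i), e.ne_zero i⟩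

end Spectrum

end AlmostComplexFlow

end

/-! ### The main theorem -/

theorem mainTheorem3
    {E : Type*} [NormedAddCommGroup E] [NormedSpace ℝ E] [FiniteDimensional ℝ E] [CompleteSpace E]
    (n : ℕ) (hn : Module.finrank ℝ E = 2 * n)
    {M : Type*} [TopologicalSpace M] [ChartedSpace E M] [IsManifold 𝓘(ℝ, E) ∞ M]
    [CompactSpace M] [T2Space M]
    {G : Type*} [Group G] [TopologicalSpace G] [ChartedSpace E G] [LieGroup 𝓘(ℝ, E) ∞ G]
    [SimplyConnectedSpace G]
    (J : AlmostComplexFlow.EndField E M) (Ω₀ : AlmostComplexFlow.FormField E M)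
    (hJ : AlmostComplexFlow.IsAlmostComplexStructure J)
    (hΩ₀ : AlmostComplexFlow.IsAlmostHermitian J Ω₀)
    (π : G → M) (hπ : IsCoveringMap π) (hπsurj : Function.Surjective π)
    (hπdiff : IsLocalDiffeomorph 𝓘(ℝ, E) 𝓘(ℝ, E) ∞ π)
    (hJinv : AlmostComplexFlow.IsLeftInvariantEnd (AlmostComplexFlow.pullbackEnd π J))
    (hΩinv : AlmostComplexFlow.IsLeftInvariantForm (AlmostComplexFlow.pullbackForm π Ω₀))
    (𝔧 : GroupLieAlgebra 𝓘(ℝ, E) G →ₗ[ℝ] GroupLieAlgebra 𝓘(ℝ, E) G)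
    (h𝔧 : ∀ X, 𝔧 X = AlmostComplexFlow.pullbackEnd π J 1 X) :
    ∃ (T : EReal) (Ω : ℝ → AlmostComplexFlow.FormField E M)
      (P₀ : GroupLieAlgebra 𝓘(ℝ, E) G →ₗ[ℝ] GroupLieAlgebra 𝓘(ℝ, E) G)
      (e : Module.Basis (Fin (2 * n)) ℝ (GroupLieAlgebra 𝓘(ℝ, E) G)) (p : Fin (2 * n) → ℝ)
      (R : ℝ → ℝ),
      -- `P₀` is the Chern-Ricci operator of `Ω₀`
      (∀ P, AlmostComplexFlow.IsChernRicciOperator 𝔧 (AlmostComplexFlow.pullbackForm π Ω₀ 1) P ↔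
        P = P₀) ∧
      -- it is diagonal in the orthonormal basis `e`, with eigenvalues `p`
      (∀ α β, AlmostComplexFlow.pullbackForm π Ω₀ 1 (e α) (𝔧 (e β)) = if α = β then 1 else 0) ∧
      (∀ α, P₀ (e α) = p α • e α) ∧
      -- `Ω` is the maximal solution of the flow and `T` its maximal existence time
      AlmostComplexFlow.IsMaximalFlowSolution J Ω₀ T Ω ∧
      -- `Ω_t = Ω₀ - 2 t p^{(1,1)}` and `Ric(Ω_t) = 2 p`
      (∀ t ∈ AlmostComplexFlow.timeInterval T, ∀ (y : G) (X Y : GroupLieAlgebra 𝓘(ℝ, E) G),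
        AlmostComplexFlow.pullbackForm π (Ω t) y
            (mulInvariantVectorField X y) (mulInvariantVectorField Y y) =
          AlmostComplexFlow.pullbackForm π Ω₀ 1 X Y -
            2 * t * AlmostComplexFlow.oneOnePart 𝔧 (AlmostComplexFlow.invariantForm 𝔧) X Y) ∧
      (∀ t ∈ AlmostComplexFlow.timeInterval T, ∀ ρ, AlmostComplexFlow.IsChernRicciForm J (Ω t) ρ →
        ∀ (y : G) (X Y : GroupLieAlgebra 𝓘(ℝ, E) G),
          AlmostComplexFlow.pullbackForm π ρ y
              (mulInvariantVectorField X y) (mulInvariantVectorField Y y) =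
            2 * AlmostComplexFlow.invariantForm 𝔧 X Y) ∧
      -- `P_t = (Id - 2 t P₀)⁻¹ P₀` is the Chern-Ricci operator of `Ω_t`
      (∀ t ∈ AlmostComplexFlow.timeInterval T, IsUnit (1 - (2 * t) • P₀) ∧
        ∀ P, AlmostComplexFlow.IsChernRicciOperator 𝔧
            (AlmostComplexFlow.pullbackForm π (Ω t) 1) P ↔
          P = Ring.inverse (1 - (2 * t) • P₀) * P₀) ∧
      -- the maximal existence time
      ((∀ X, AlmostComplexFlow.pullbackForm π Ω₀ 1 (P₀ X) (𝔧 X) ≤ 0) → T = ⊤) ∧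
      ((¬ ∀ X, AlmostComplexFlow.pullbackForm π Ω₀ 1 (P₀ X) (𝔧 X) ≤ 0) →
        ∃ pmax : ℝ, 0 < pmax ∧ IsGreatest {μ : ℝ | Module.End.HasEigenvalue P₀ μ} pmax ∧
          T = ((1 / (2 * pmax) : ℝ) : EReal)) ∧
      -- the Chern scalar curvature of `Ω_t` is the constant `R t`
      (∀ t ∈ AlmostComplexFlow.timeInterval T, ∀ s : M → ℝ,
        AlmostComplexFlow.IsChernScalarCurvature J (Ω t) s ↔ s = fun _ => R t) ∧
      (∀ t ∈ AlmostComplexFlow.timeInterval T, R t = ∑ α, p α / (1 - 2 * t * p α)) ∧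
      (∀ t ∈ AlmostComplexFlow.timeInterval T, HasDerivWithinAt R
        (∑ α, 2 * p α ^ 2 / (1 - 2 * t * p α) ^ 2) (AlmostComplexFlow.timeInterval T) t) ∧
      MonotoneOn R (AlmostComplexFlow.timeInterval T) ∧
      (P₀ ≠ 0 → StrictMonoOn R (AlmostComplexFlow.timeInterval T)) ∧
      -- blow-up: if `T` is finite, the integral of `R` over `[0,T)` is infinite
      (∀ T' : ℝ, T = (T' : EReal) →
        Tendsto (fun s => ∫ t in (0 : ℝ)..s, R t) (𝓝[<] T') atTop) ∧
      -- `R(Ω_t) ≤ C / (T - t)`, the right-hand side being `0` for `T = ∞`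
      (∀ T' : ℝ, T = (T' : EReal) →
        ∃ C : ℝ, 0 < C ∧ ∀ t ∈ AlmostComplexFlow.timeInterval T, R t ≤ C / (T' - t)) ∧
      (T = ⊤ → ∀ t ∈ AlmostComplexFlow.timeInterval T, R t ≤ 0) := by
  have hjpush := AlmostComplexFlow.complex_pushInvariant hπdiff hJinv h𝔧
  obtain ⟨β, hβ⟩ := AlmostComplexFlow.exists_isInvariantForm hΩinv
  have hH := hβ.isHermitianForm hJ hΩ₀ hπdiff hjpush
  obtain ⟨𝒜, -, h𝒜⟩ :=
    AlmostComplexFlow.exists_frameAtlas hJ hΩ₀ hπdiff hπsurj hjpush hβ 1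
  have hM : Nonempty M := ⟨π 1⟩
  have hβ𝒜 := h𝒜 _ _ hβ
  obtain ⟨ρ, hρ⟩ := 𝒜.exists_isChernRicciForm hH.sq hβ𝒜 hH
  have hρinv := AlmostComplexFlow.IsInvariantForm.of_isChernRicciForm hJ hΩ₀ hπdiff hπsurj hjpush
    hβ hρ
  have hρ𝒜 := h𝒜 _ _ hρinv
  -- `modelForm` is `p^{(1,1)}` on the model space, so this `P` is `P₀` and the `p α` are its
  -- eigenvalues.
  obtain ⟨P, e, p, hP, he, hp⟩ := hH.exists_diagonal hn
    (AlmostComplexFlow.modelForm_alternating 𝒜.bracket_swap)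
    (AlmostComplexFlow.modelForm_invariant hH.sq)
  have hΩinv := AlmostComplexFlow.IsInvariantForm.affineFlow hjpush hβ hρinv
  have hform := AlmostComplexFlow.oneOnePart_invariantForm (G := G) (𝔧 := 𝔧) hH.sq
  have hpos : ∀ t ∈ AlmostComplexFlow.timeInterval (AlmostComplexFlow.maxTime p),
      ∀ α, 0 < 1 - 2 * t * p α := fun t ht =>
    (AlmostComplexFlow.mem_timeInterval_maxTime.1 ht).2
  refine ⟨AlmostComplexFlow.maxTime p, AlmostComplexFlow.affineFlow J Ω₀ ρ, P, e, p,
    AlmostComplexFlow.scalarFun p, fun Q => ?_, fun α γ => ?_, hp,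
    AlmostComplexFlow.FrameAtlas.isMaximalFlowSolution_affineFlow hH hP he hp hβ𝒜 hρ𝒜,
    fun t ht y X Y => ?_, fun t ht ρ' hρ' y X Y => ?_, fun t ht => ⟨?_, fun Q => ?_⟩, fun hle => ?_,
    fun hle => ?_,
    fun t ht s => AlmostComplexFlow.FrameAtlas.isChernScalarCurvature_affineFlow_iff hH hP he hp
      hβ𝒜 hρ𝒜 ht s, fun t ht => rfl,
    fun t ht => (AlmostComplexFlow.hasDerivAt_scalarFun (hpos t ht)).hasDerivWithinAt,
    AlmostComplexFlow.monotoneOn_scalarFun, fun hP0 => ?_,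
    fun T' hT => AlmostComplexFlow.tendsto_integral_scalarFun hT,
    fun T' hT => AlmostComplexFlow.scalarFun_le hT,
    fun hT t ht => AlmostComplexFlow.scalarFun_nonpos hT ht⟩
  · constructor
    · intro hQ
      refine LinearMap.ext fun u => hH.form_inj fun v => ?_
      exact (hβ.pullbackForm_one (Q u) v).symm.trans
        ((hQ u v).symm.trans ((hform u v).trans (hP u v)))
    · rintro rfl X Y
      exact (hform X Y).trans ((hP X Y).trans (hβ.pullbackForm_one (Q X) Y).symm)
  · exact (hβ.pullbackForm_one (e α) (𝔧 (e γ))).trans (he α γ)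
  · rw [hform]
    refine ((hΩinv t).pullbackForm_apply y X Y).trans ?_
    exact congrArg (· - 2 * t * _) (hβ.pullbackForm_one X Y).symm
  · have h := AlmostComplexFlow.IsInvariantForm.of_isChernRicciForm hJ
      ((h𝒜 _ _ (hΩinv t)).isAlmostHermitian (𝒜.isHermitianForm_flow hH hP he hp ht)) hπdiff hπsurj
      hjpush (hΩinv t) hρ'
    exact (h.pullbackForm_apply y X Y).trans
      (AlmostComplexFlow.two_mul_invariantForm (G := G) (𝔧 := 𝔧) hH.sq X Y).symm
  · exact AlmostComplexFlow.isUnit_flow hp (hpos t ht)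
  · refine Iff.trans (forall₂_congr fun X Y => ?_) (hH.operator_flow hP
      (AlmostComplexFlow.isUnit_flow hp (hpos t ht)) Q)
    exact Eq.congr (hform X Y) ((hΩinv t).pullbackForm_one (Q X) Y)
  · refine AlmostComplexFlow.maxTime_eq_top ((hH.operator_nonpos_iff he hp).1 fun X => ?_)
    exact (hβ.pullbackForm_one (P X) (𝔧 X)).symm.trans_le (hle X)
  · have hp0 : ¬ ∀ α, p α ≤ 0 := fun h => hle fun X =>
      (hβ.pullbackForm_one (P X) (𝔧 X)).trans_le ((hH.operator_nonpos_iff he hp).2 h X)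
    obtain ⟨α₀, h0, hmax, hT⟩ := AlmostComplexFlow.exists_maxTime_eq hp0
    refine ⟨p α₀, h0, ⟨(AlmostComplexFlow.hasEigenvalue_iff_of_diagonal hp _).2 ⟨α₀, rfl⟩,
      fun μ hμ => ?_⟩, hT⟩
    obtain ⟨α, rfl⟩ := (AlmostComplexFlow.hasEigenvalue_iff_of_diagonal hp μ).1 hμ
    exact hmax α
  · refine AlmostComplexFlow.strictMonoOn_scalarFun fun h => hP0 (e.ext fun α => ?_)
    rw [hp, h]
    exact zero_smul ℝ (e α)
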